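/- **Proposition 3.4.** Let $A\in M_n(\mathbb C)$ and assume that $A$ is not a $2\times 2$ normal matrix. Let $W(A)=\{\langle Ax,x\rangle : x\in\mathbb C^n,\ \|x\|=1\}$ be the numerical range of $A$ and $\partial W(A)$ its boundary in $\mathbb C$. Let $k(A)$ be the maximum size of an orthonormal set $\{x_1,\dots,x_k\}\subset\mathbb C^n$ such that all the values $\langle Ax_j,x_j\rangle$ lie on $\partial W(A)$. Put $H_1=(A+A^*)/2$, $H_2=(A-A^*)/(2i)$, $F_A(x:y:t)=\det(xH_1+yH_2+tI_n)$, and let $\Gamma_F$ be the curve $F_A=0$ in $\mathbb{CP}^2$ (the base curve). Let $\Gamma^\wedge_F$ (the boundary generating curve) be the dual curve of $\Gamma_F$, that is, the Zariski closure, in the dual plane, of the set of tangent lines to (the reduced curve) $\Gamma_F$ at its nonsingular points, the line $ax+by+ct=0$ being the point $(a:b:c)$ of the dual plane. The number $p+iq\in\mathbb C$ ($p,q\in\mathbb R$) is identified with the point $(p:q:1)$. A point of $\Gamma^\wedge_F$ is called singular if $\Gamma^\wedge_F$ is not a nonsingular curve at that point; in particular, isolated points of $\Gamma^\wedge_F$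 are singular. A *seed* of $A$ is a subset of $\partial W(A)$ of one of the following types: * a *flat portion*: the intersection of $\partial W(A)$ with a support line of $W(A)$, if this intersection contains more than one point; * a *singular point*: a point of $\Gamma^\wedge_F\cap\partial W(A)$ which is a singular point of $\Gamma^\wedge_F$. If $k(A)=2$, then $A$ has no seeds. That is, $\partial W(A)$ has no flat portions, and no singular point of $\Gamma^\wedge_F$ lies on $\partial W(A)$. -/

import Mathlib

open scoped Matrix LinearAlgebra.Projectivization

noncomputable section

namespace GauWu

/-! ### Numerical range and Gau--Wu number -/

/-- The value `⟨A x, x⟩` (scalar product linear in the first variable); Mathlib's inner product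
is linear in the second variable. -/
def quadForm {n : ℕ} (A : Matrix (Fin n) (Fin n) ℂ) (x : EuclideanSpace ℂ (Fin n)) : ℂ :=
  inner ℂ x (Matrix.toEuclideanLin A x)

/-- The numerical range `W(A) = {⟨A x, x⟩ : ‖x‖ = 1}`. -/
def numericalRange {n : ℕ} (A : Matrix (Fin n) (Fin n) ℂ) : Set ℂ :=
  {z | ∃ x : EuclideanSpace ℂ (Fin n), ‖x‖ = 1 ∧ quadForm A x = z}

/-- The Gau--Wu number `k(A)`: the maximal size of an orthonormal family of vectors whose values
`⟨A x_j, x_j⟩` all lie on the boundary of `W(A)`. (The set of sizes contains `0` and is bounded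
by `n`, so the supremum is a maximum.) -/
def gauWuNumber {n : ℕ} (A : Matrix (Fin n) (Fin n) ℂ) : ℕ :=
  sSup {k | ∃ x : Fin k → EuclideanSpace ℂ (Fin n),
    Orthonormal ℂ x ∧ ∀ j, quadForm A (x j) ∈ frontier (numericalRange A)}

/-! ### The complex projective plane -/

/-- The complex projective plane. Its dual plane is identified with it: the point `(a : b : c)`
corresponds to the line `a x + b y + c t = 0`. -/
abbrev Plane : Type := ℙ ℂ (Fin 3 → ℂ)

/-- Polynomials in the homogeneous coordinates `x = X 0`, `y = X 1`, `t = X 2`. -/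
abbrev Poly : Type := MvPolynomial (Fin 3) ℂ

/-- `G` vanishes at all representatives of the projective point `P`. -/
def VanishesAt (G : Poly) (P : Plane) : Prop :=
  ∀ v ∈ P.submodule, MvPolynomial.eval v G = 0

/-- The projective zero set of a homogeneous polynomial. -/
def curve (G : Poly) : Set Plane := {P | VanishesAt G P}

/-- The (homogeneous) vanishing ideal of a set of points of the projective plane. -/
def vanishingIdeal (S : Set Plane) : Ideal Poly where
  carrier := {G | ∀ P ∈ S, VanishesAt G P}
  zero_mem' := fun P _ v _ => by simp
  add_mem' := fun ha hb P hP v hv => by simp [ha P hP v hv, hb P hP v hv]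
  smul_mem' := fun c G hG P hP v hv => by simp [hG P hP v hv]

/-- The Zariski closure of a set of points of the projective plane. -/
def zariskiClosure (S : Set Plane) : Set Plane :=
  {P | ∀ G ∈ vanishingIdeal S, VanishesAt G P}

/-- The gradient `(∂G/∂x, ∂G/∂y, ∂G/∂t)` at `v`, as a linear map in `G`. -/
def gradAt (v : Fin 3 → ℂ) : Poly →ₗ[ℂ] (Fin 3 → ℂ) :=
  LinearMap.pi fun i =>
    (MvPolynomial.aeval v).toLinearMap ∘ₗ (MvPolynomial.pderiv i).toLinearMap

/-- The space of gradients at `P` of all polynomials vanishing on `S`. If `S` is the plane curve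
`f = 0` with `f` square-free, it is spanned by the gradient of `f` at `P`. It does not depend on
the representative of `P`, because the vanishing ideal is homogeneous. -/
def conormalSpace (S : Set Plane) (P : Plane) : Submodule ℂ (Fin 3 → ℂ) :=
  ((vanishingIdeal S).restrictScalars ℂ).map (gradAt P.rep)

/-- `S` is at its point `P` a nonsingular curve with tangent line `L` (a point of the dual plane):
the conormal space of `S` at `P` is one-dimensional and spanned by the coordinates of `L`. -/
def IsTangentLine (S : Set Plane) (P L : Plane) : Prop :=
  P ∈ S ∧ conormalSpace S P = L.submodule

/-- `P` is a singular point of `S`: a point of `S` where `S` is not a nonsingular curve. An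
isolated point of `S` (where the conormal space has dimension two) counts as singular. -/
def IsSingularPoint (S : Set Plane) (P : Plane) : Prop :=
  P ∈ S ∧ ¬ ∃ L, IsTangentLine S P L

/-- The dual of a plane curve: the Zariski closure of the set of tangent lines at nonsingular
points. It is the union of the duals of the irreducible components; the dual of a line is a
point. -/
def dualCurve (S : Set Plane) : Set Plane :=
  zariskiClosure {L | ∃ P, IsTangentLine S P L}

/-! ### Base polynomial, base curve, boundary generating curve -/

/-- `H₁ = Re A = (A + A*) / 2`. -/
def rePart {n : ℕ} (A : Matrix (Fin n) (Fin n) ℂ) : Matrix (Fin n) (Fin n) ℂ :=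
  (1 / 2 : ℂ) • (A + Aᴴ)

/-- `H₂ = Im A = (A - A*) / (2 i)`. -/
def imPart {n : ℕ} (A : Matrix (Fin n) (Fin n) ℂ) : Matrix (Fin n) (Fin n) ℂ :=
  (1 / (2 * Complex.I) : ℂ) • (A - Aᴴ)

/-- The base polynomial `F_A(x : y : t) = det (x H₁ + y H₂ + t I)`. -/
def basePolynomial {n : ℕ} (A : Matrix (Fin n) (Fin n) ℂ) : Poly :=
  Matrix.det
    ((MvPolynomial.X 0 : Poly) • (rePart A).map MvPolynomial.C
      + (MvPolynomial.X 1 : Poly) • (imPart A).map MvPolynomial.C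
      + (MvPolynomial.X 2 : Poly) • (1 : Matrix (Fin n) (Fin n) Poly))

/-- The base curve `F_A = 0`. -/
def baseCurve {n : ℕ} (A : Matrix (Fin n) (Fin n) ℂ) : Set Plane :=
  curve (basePolynomial A)

/-- The boundary generating curve: the dual of the base curve. -/
def boundaryGeneratingCurve {n : ℕ} (A : Matrix (Fin n) (Fin n) ℂ) : Set Plane :=
  dualCurve (baseCurve A)

/-- The embedding of `ℂ` as the real affine points: `p + i q ↦ (p : q : 1)`. -/
def affinePoint (z : ℂ) : Plane :=
  Projectivization.mk ℂ ![(z.re : ℂ), (z.im : ℂ), 1] (fun h => one_ne_zero (congrFun h 2))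

/-! ### Seeds -/

/-- `ℓ` is a support line of `W`: a line of the real plane `ℂ` that meets `W` and has `W` on one
side. The line is `{z : Re (conj u * z) = c}` with `u ≠ 0`. -/
def IsSupportLine (W ℓ : Set ℂ) : Prop :=
  ∃ (u : ℂ) (c : ℝ), u ≠ 0 ∧ ℓ = {z : ℂ | ((starRingEnd ℂ) u * z).re = c} ∧
    (∀ z ∈ W, ((starRingEnd ℂ) u * z).re ≤ c) ∧ (W ∩ ℓ).Nonempty

/-- A flat portion: the intersection of the boundary of `W(A)` with a support line, if it contains
more than one point. -/
def IsFlatPortion {n : ℕ} (A : Matrix (Fin n) (Fin n) ℂ) (S : Set ℂ) : Prop :=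
  ∃ ℓ, IsSupportLine (numericalRange A) ℓ ∧ S = frontier (numericalRange A) ∩ ℓ ∧ S.Nontrivial

/-- `z` is a point of the boundary of `W(A)` and a singular point of the boundary generating
curve. -/
def IsSingularBoundaryPoint {n : ℕ} (A : Matrix (Fin n) (Fin n) ℂ) (z : ℂ) : Prop :=
  z ∈ frontier (numericalRange A) ∧ IsSingularPoint (boundaryGeneratingCurve A) (affinePoint z)

/-- A seed of `A`: a flat portion, or a singular point of the boundary generating curve that lies
on the boundary of `W(A)`. -/
def IsSeed {n : ℕ} (A : Matrix (Fin n) (Fin n) ℂ) (S : Set ℂ) : Prop :=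
  IsFlatPortion A S ∨ ∃ z, S = {z} ∧ IsSingularBoundaryPoint A z

end GauWu

end

section

open scoped Matrix LinearAlgebra.Projectivization
open Polynomial Topology Filter
open scoped Polynomial.Bivariate

namespace GauWu

variable {n : ℕ}

/-! ### Derivatives of polynomial functions -/

/-! For a direction u ≠ 0 let H_u be the Hermitian part of conj(u) A. Since W(A) is compact and
convex, each boundary point z is ⟨Av, v⟩ for a unit vector v in the top eigenspace of some H_u. Two
orthogonal top eigenvectors of H_u, together with an eigenvector for the least eigenvalue, would
give an orthonormal triple with values on ∂W(A), unless H_u is scalar; then every unit vector has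
its value on ∂W(A), so n = 2 and A is normal. Hence every top eigenspace is a line
(`IsExtremal.inner_ne_zero`, `IsExtremal.ker`), which excludes flat portions. Moreover v is not an
eigenvector of H_{iu}: otherwise, turning the direction until the top eigenvalue on the complement
of v catches up with that of v would produce two orthogonal top eigenvectors
(`IsExtremal.mulVec_ne`).

In coordinates adapted to z the base curve is det(x M₀ + y M₁ + t) = 0 with M₀ ≤ 0, ker M₀ = ℂv,
⟨M₁v, v⟩ = 0 and M₁v ≠ 0, while z becomes the line t = 0. A Schur complement writes the determinant
as tα − y²β with α and β nonzero at (1:0:0) (`exists_block_formula`). So the base curve is smooth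
there with simple contact with t = 0, and its nearby tangents trace a smooth branch of the dual
curve through z. This bounds the conormal space at z from above.

It remains to see that nothing else of the dual curve passes through z, that is, to find a
polynomial vanishing on the dual with nonzero gradient at z. The other points of the base curve on t
= 0 are real. Kernel vectors of the pencil there are not isotropic for M₀, so at nearby real
abscissas the slopes of the branches, which are of the form ⟨M₀u, u⟩/⟨u, u⟩ up to sign, stay away
from 0, even when the point is singular (`exists_slope_polynomial`). Thus the ideal of the pairs
(tangent line, point of tangency), specialized to the line z, contains the coordinate y of the
point. Nakayama's lemma makes y a quotient N/r of polynomials in the line near z, and substituting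
it into the equation of the curve gives the desired polynomial
(`IsSimplePencil.exists_dual_equation`). -/

theorem hasStrictFDerivAt_eval (G : Poly) (v : Fin 3 → ℂ) :
    HasStrictFDerivAt (fun w : Fin 3 → ℂ => MvPolynomial.eval w G)
      (∑ i, gradAt v G i • ContinuousLinearMap.proj (R := ℂ) (φ := fun _ : Fin 3 => ℂ) i) v := by
  induction G using MvPolynomial.induction_on with
  | C a =>
    convert! hasStrictFDerivAt_const (𝕜 := ℂ) a v using 1
    · ext; simp
    · ext; simp [gradAt]
  | add p q hp hq =>
    convert! hp.add hq using 1
    · ext; simp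
    · ext w
      simp [add_mul, Finset.sum_add_distrib]
  | mul_X p i hp =>
    convert! hp.mul (ContinuousLinearMap.proj (R := ℂ) (φ := fun _ : Fin 3 => ℂ)
      i).hasStrictFDerivAt using 1
    · ext; simp
    · ext w
      simp only [gradAt, LinearMap.pi_apply, LinearMap.comp_apply, Derivation.coeFn_coe,
        Derivation.leibniz, MvPolynomial.pderiv_X, AlgHom.toLinearMap_apply, smul_eq_mul, map_add,
        map_mul, MvPolynomial.aeval_X, MvPolynomial.aeval_eq_eval]
      simp [Pi.single_apply, Finset.mul_sum, mul_assoc, apply_ite, add_mul,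
        Finset.sum_add_distrib]

theorem hasDerivAt_eval_comp (G : Poly) {γ : ℂ → Fin 3 → ℂ} {γ' : Fin 3 → ℂ} {s : ℂ}
    (h : HasDerivAt γ γ' s) :
    HasDerivAt (fun s => MvPolynomial.eval (γ s) G) (gradAt (γ s) G ⬝ᵥ γ') s := by
  convert! (hasStrictFDerivAt_eval G (γ s)).hasFDerivAt.comp_hasDerivAt s h using 1

theorem gradAt_dotProduct_eq_zero (G : Poly) {γ : ℂ → Fin 3 → ℂ} {γ' : Fin 3 → ℂ} {s : ℂ}
    (h : HasDerivAt γ γ' s) (h0 : ∀ᶠ u in 𝓝 s, MvPolynomial.eval (γ u) G = 0) :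
    gradAt (γ s) G ⬝ᵥ γ' = 0 :=
  (hasDerivAt_eval_comp G h).unique
    ((hasDerivAt_const s (0 : ℂ)).congr_of_eventuallyEq (by simpa [EventuallyEq] using h0))

/-- The implicit function theorem for a function of two complex variables. -/
theorem exists_implicit {f : ℂ × ℂ → ℂ} {f' : ℂ × ℂ →L[ℂ] ℂ} {x t : ℂ}
    (hf : HasStrictFDerivAt f f' (x, t)) (h0 : f (x, t) = 0) (ht : f' (0, 1) ≠ 0) :
    ∃ τ : ℂ → ℂ, HasDerivAt τ (-(f' (1, 0)) / f' (0, 1)) x ∧ τ x = t ∧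
      ∀ᶠ y in 𝓝 x, f (y, τ y) = 0 := by
  have hinv : (f' ∘L .inr ℂ ℂ ℂ).IsInvertible := by
    refine ⟨ContinuousLinearEquiv.unitsEquivAut ℂ (Units.mk0 _ ht), ?_⟩
    ext; simp
  have hc := hf.hasStrictFDerivAt_implicitFunctionOfProdDomain hinv
  have hv : hf.implicitFunctionOfProdDomain hinv x = t :=
    (hf.eventually_apply_eq_iff_implicitFunctionOfProdDomain hinv).self_of_nhds.mp rfl
  have he := hf.eventually_apply_implicitFunctionOfProdDomain hinv
  simp only [h0] at he
  have hz : ∀ᶠ y in 𝓝 x, f (y, hf.implicitFunctionOfProdDomain hinv y) = 0 := he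
  refine ⟨_, ?_, hv, hz⟩
  have hd := hc.hasFDerivAt.hasDerivAt
  set d := (-(f' ∘L .inr ℂ ℂ ℂ).inverse ∘L (f' ∘L .inl ℂ ℂ ℂ)) 1 with hdd
  have h1 : HasDerivAt (fun y => (y, hf.implicitFunctionOfProdDomain hinv y)) (1, d) x :=
    (hasDerivAt_id x).prodMk hd
  have h2 : HasDerivAt (fun y => f (y, hf.implicitFunctionOfProdDomain hinv y)) (f' (1, d)) x := by
    have hf2 : HasFDerivAt f f' (x, hf.implicitFunctionOfProdDomain hinv x) := by
      rw [hv]; exact hf.hasFDerivAt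
    exact hf2.comp_hasDerivAt x h1
  -- Differentiating f(y, τ y) = 0 makes the derivative explicit; the abstract theorem gives it only
  -- through the inverse of a linear map.
  have h3 : f' (1, d) = 0 :=
    h2.unique ((hasDerivAt_const x (0 : ℂ)).congr_of_eventuallyEq (by simpa [EventuallyEq] using hz))
  have h4 : f' (1, d) = f' (1, 0) + d * f' (0, 1) := by
    have : ((1, d) : ℂ × ℂ) = (1, 0) + d • (0, 1) := by simp
    rw [this, map_add, map_smul, smul_eq_mul]
  have : -(f' (1, 0)) / f' (0, 1) = d := by
    field_simp
    linear_combination h4 - h3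
  rw [this]
  exact hd

theorem exists_hasStrictFDerivAt_evalEval (f : ℂ[X][Y]) :
    ∃ fx : ℂ[X][Y], ∀ x t : ℂ, HasStrictFDerivAt (fun q : ℂ × ℂ => f.evalEval q.1 q.2)
      (fx.evalEval x t • ContinuousLinearMap.fst ℂ ℂ ℂ +
        (derivative f).evalEval x t • ContinuousLinearMap.snd ℂ ℂ ℂ) (x, t) := by
  induction f using Polynomial.induction_on' with
  | add p q hp hq =>
    obtain ⟨px, hp⟩ := hp
    obtain ⟨qx, hq⟩ := hq
    refine ⟨px + qx, fun x t => ?_⟩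
    convert! (hp x t).add (hq x t) using 1
    · ext; simp
    · ext <;> simp
  | monomial n a =>
    refine ⟨monomial n (derivative a), fun x t => ?_⟩
    have h1 : HasStrictFDerivAt (fun q : ℂ × ℂ => a.eval q.1)
        ((derivative a).eval x • ContinuousLinearMap.fst ℂ ℂ ℂ) (x, t) :=
      HasStrictDerivAt.comp_hasStrictFDerivAt (f := Prod.fst) (x, t) (a.hasStrictDerivAt x)
        hasStrictFDerivAt_fst
    have h2 : HasStrictFDerivAt (fun q : ℂ × ℂ => q.2 ^ n)
        ((n * t ^ (n - 1)) • ContinuousLinearMap.snd ℂ ℂ ℂ) (x, t) :=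
      HasStrictDerivAt.comp_hasStrictFDerivAt (f := Prod.snd) (x, t) (hasStrictDerivAt_pow n t)
        hasStrictFDerivAt_snd
    convert! h1.mul h2 using 1
    · ext; simp [evalEval, eval_monomial]
    · ext <;> simp [evalEval, eval_monomial, derivative_monomial]
      · ring
      · ring

/-! ### Homogenization -/

/-- A power of `lc` of exponent at least the total degree clears all denominators. Allowing every
large exponent lets the two terms of a sum share one. -/
theorem exists_homogenization (q : ℂ[X][Y]) (la lb lc : Poly) :
    ∃ D₀ : ℕ, ∀ D ≥ D₀, ∃ Q : Poly, ∀ v, MvPolynomial.eval v lc ≠ 0 →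
      MvPolynomial.eval v Q = MvPolynomial.eval v lc ^ D *
        q.evalEval (MvPolynomial.eval v la / MvPolynomial.eval v lc)
          (MvPolynomial.eval v lb / MvPolynomial.eval v lc) := by
  induction q using Polynomial.induction_on' with
  | add p q hp hq =>
    obtain ⟨D₁, hp⟩ := hp
    obtain ⟨D₂, hq⟩ := hq
    refine ⟨max D₁ D₂, fun D hD => ?_⟩
    obtain ⟨P, hP⟩ := hp D (le_trans (le_max_left _ _) hD)
    obtain ⟨Q, hQ⟩ := hq D (le_trans (le_max_right _ _) hD)
    exact ⟨P + Q, fun v hv => by simp [hP v hv, hQ v hv, mul_add]⟩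
  | monomial n p =>
    induction p using Polynomial.induction_on' with
    | add p q hp hq =>
      obtain ⟨D₁, hp⟩ := hp
      obtain ⟨D₂, hq⟩ := hq
      refine ⟨max D₁ D₂, fun D hD => ?_⟩
      obtain ⟨P, hP⟩ := hp D (le_trans (le_max_left _ _) hD)
      obtain ⟨Q, hQ⟩ := hq D (le_trans (le_max_right _ _) hD)
      exact ⟨P + Q, fun v hv => by simp [hP v hv, hQ v hv, mul_add]⟩
    | monomial m a =>
      refine ⟨n + m, fun D hD => ⟨MvPolynomial.C a * la ^ m * lb ^ n * lc ^ (D - (n + m)), ?_⟩⟩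
      intro v hv
      obtain ⟨k, rfl⟩ := Nat.exists_eq_add_of_le hD
      simp only [evalEval, eval_monomial, eval_mul, eval_pow, eval_C, map_mul, map_pow,
        MvPolynomial.eval_C, add_tsub_cancel_left, pow_add, div_pow]
      field_simp

/-- A bivariate polynomial has a homogenization with respect to arbitrary forms, which vanishes
where the last form does. -/
theorem exists_homogenization_vanishing (q : ℂ[X][Y]) (la lb lc : Poly) :
    ∃ (D : ℕ) (Q : Poly), (∀ v, MvPolynomial.eval v lc = 0 → MvPolynomial.eval v Q = 0) ∧
      ∀ v, MvPolynomial.eval v lc ≠ 0 →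
      MvPolynomial.eval v Q = MvPolynomial.eval v lc ^ D *
        q.evalEval (MvPolynomial.eval v la / MvPolynomial.eval v lc)
          (MvPolynomial.eval v lb / MvPolynomial.eval v lc) := by
  obtain ⟨D, h⟩ := exists_homogenization q la lb lc
  obtain ⟨Q, hQ⟩ := h D le_rfl
  refine ⟨D + 1, lc * Q, fun v hv => by simp [hv], fun v hv => ?_⟩
  rw [map_mul, hQ v hv]
  ring

/-! ### A form of Nakayama's lemma -/

/-- Modulo `m` the variable lies in `J`, and `p` is monic up to `m`, so the image of the powers of X
in R[X]/(J + R) is a finite module N with N = mN. Some r ≡ 1 mod `m` kills it, and rX ∈ J + R is the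
conclusion. -/
theorem exists_sub_one_mem_mul_X_sub_C_mem {R : Type*} [CommRing R] (m : Ideal R) (J : Ideal R[X])
    {n : ℕ} {p : R[X]} (hp : p ∈ J) (hpn : p.natDegree ≤ n) (hlead : p.coeff n - 1 ∈ m)
    {g : R[X]} (hg : g ∈ J) (hgX : ∀ i, (g - X).coeff i ∈ m) :
    ∃ r N : R, r - 1 ∈ m ∧ C r * X - C N ∈ J := by
  classical
  let B : Submodule R R[X] := J.restrictScalars R ⊔ LinearMap.range (Algebra.linearMap R R[X])
  let π := B.mkQ
  -- This bound contains every (g − X) X^(k−1) with k ≤ n, and it is at least 1, so X itself is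
  -- among the generators.
  let D := n + g.natDegree + 1
  let N : Submodule R (R[X] ⧸ B) := Submodule.span R ((fun k => π (X ^ k)) '' Set.Icc 1 D)
  have hN : N.FG := Submodule.fg_span ((Set.finite_Icc 1 D).image _)
  have hJ : ∀ q ∈ J, π q = 0 := fun q hq => by
    rw [Submodule.mkQ_apply, Submodule.Quotient.mk_eq_zero]
    exact Submodule.mem_sup_left hq
  have hconst : π (X ^ 0) = 0 := by
    rw [Submodule.mkQ_apply, Submodule.Quotient.mk_eq_zero]
    exact Submodule.mem_sup_right ⟨1, by simp⟩
  have hXN : ∀ k ≤ D, π (X ^ k) ∈ N := by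
    intro k hk
    rcases Nat.eq_zero_or_pos k with rfl | h
    · rw [hconst]; exact N.zero_mem
    · exact Submodule.subset_span ⟨k, ⟨h, hk⟩, rfl⟩
  have hsum : ∀ q : R[X], π q = ∑ i ∈ Finset.range (q.natDegree + 1), q.coeff i • π (X ^ i) := by
    intro q
    conv_lhs => rw [q.as_sum_range_C_mul_X_pow]
    simp [map_sum, ← smul_eq_C_mul]
  have hsmall : ∀ q : R[X], q.natDegree ≤ D → (∀ i, q.coeff i ∈ m) → π q ∈ m • N := by
    intro q hq hm
    rw [hsum]
    refine Submodule.sum_mem _ fun i hi => Submodule.smul_mem_smul (hm i) (hXN i ?_)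
    exact (Nat.lt_succ_iff.mp (Finset.mem_range.mp hi)).trans hq
  have key : ∀ k, 1 ≤ k → k ≤ D → π (X ^ k) ∈ m • N := by
    intro k
    induction k using Nat.strong_induction_on with
    | _ k ih =>
      intro h1 hk
      rcases le_or_gt k n with hkn | hkn
      -- In degrees up to n, trade X for g: the error has coefficients in m.
      · have : π (X ^ k) = π (-((g - X) * X ^ (k - 1))) := by
          have e : (X : R[X]) ^ k = g * X ^ (k - 1) + -((g - X) * X ^ (k - 1)) := by
            obtain ⟨j, rfl⟩ := Nat.exists_eq_add_of_le' h1
            simp only [Nat.add_sub_cancel]; ring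
          rw [e, map_add, hJ _ (J.mul_mem_right _ hg), zero_add]
        rw [this]
        refine hsmall _ ?_ fun i => ?_
        · rw [natDegree_neg]
          refine natDegree_mul_le.trans ?_
          have h2 := natDegree_sub_le g (X : R[X])
          have h3 := natDegree_X_le (R := R)
          have h4 := natDegree_X_pow_le (R := R) (k - 1)
          have h5 : max g.natDegree (X : R[X]).natDegree ≤ g.natDegree + 1 := by
            refine max_le (by omega) (by omega)
          omega
        · rw [coeff_neg, coeff_mul_X_pow']
          split_ifs
          · exact m.neg_mem (hgX _)
          · simp
      -- Above degree n, the nearly monic p reduces the power to lower positive ones, up to an error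
      -- in m.
      · obtain ⟨l, rfl⟩ := Nat.exists_eq_add_of_lt hkn
        have hpe : p = ∑ i ∈ Finset.range n, C (p.coeff i) * X ^ i + C (p.coeff n) * X ^ n := by
          rw [← Finset.sum_range_succ (fun i => C (p.coeff i) * X ^ i) n]
          exact p.as_sum_range_C_mul_X_pow' (Nat.lt_succ_of_le hpn)
        have e : (X : R[X]) ^ (n + l + 1) = p * X ^ (l + 1)
            + -((∑ i ∈ Finset.range n, C (p.coeff i) * X ^ i) * X ^ (l + 1))
            + -(C (p.coeff n - 1) * X ^ (n + l + 1)) := by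
          have h2 := congrArg (· * X ^ (l + 1)) hpe
          simp only [C_sub, C_1]
          linear_combination -h2
        rw [e, map_add, map_add, hJ _ (J.mul_mem_right _ hp), zero_add]
        refine Submodule.add_mem _ ?_ ?_
        · rw [map_neg, Finset.sum_mul, map_sum]
          refine Submodule.neg_mem _ (Submodule.sum_mem _ fun i hi => ?_)
          rw [mul_assoc, ← pow_add, ← smul_eq_C_mul, map_smul]
          have := Finset.mem_range.mp hi
          exact Submodule.smul_mem _ _ (ih _ (by omega) (by omega) (by omega))
        · refine hsmall _ ?_ fun i => ?_
          · rw [natDegree_neg]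
            exact (natDegree_C_mul_X_pow_le _ _).trans hk
          · rw [coeff_neg, coeff_C_mul]
            exact m.neg_mem (m.mul_mem_right _ hlead)
  have hle : N ≤ m • N := by
    refine Submodule.span_le.mpr ?_
    rintro _ ⟨k, hk, rfl⟩
    exact key k hk.1 hk.2
  obtain ⟨r, hr, hr0⟩ :=
    Submodule.exists_sub_one_mem_and_smul_eq_zero_of_fg_of_le_smul m N hN hle
  have h1 := hr0 _ (hXN 1 (by omega))
  rw [← map_smul, Submodule.mkQ_apply, Submodule.Quotient.mk_eq_zero, pow_one] at h1
  obtain ⟨j, hj, c, ⟨a, rfl⟩, h2⟩ := Submodule.mem_sup.mp h1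
  refine ⟨r, a, hr, ?_⟩
  rw [← smul_eq_C_mul, ← h2]
  simpa [Algebra.linearMap_apply] using hj

/-! ### Tangent lines of plane curves -/

theorem smul_mem_submodule_mk {v : Fin 3 → ℂ} (hv : v ≠ 0) (c : ℂ) :
    c • v ∈ (Projectivization.mk ℂ v hv).submodule := by
  rw [Projectivization.submodule_mk]
  exact Submodule.smul_mem _ _ (Submodule.mem_span_singleton_self v)

theorem exists_rep_eq_smul {v : Fin 3 → ℂ} (hv : v ≠ 0) :
    ∃ a : ℂ, a ≠ 0 ∧ (Projectivization.mk ℂ v hv).rep = a • v := by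
  obtain ⟨a, ha⟩ := Projectivization.exists_smul_eq_mk_rep ℂ v hv
  exact ⟨a, a.ne_zero, ha.symm⟩

theorem vanishesAt_mk {G : Poly} {v : Fin 3 → ℂ} (hv : v ≠ 0) :
    VanishesAt G (Projectivization.mk ℂ v hv) ↔ ∀ c : ℂ, MvPolynomial.eval (c • v) G = 0 := by
  refine ⟨fun h c => h _ (smul_mem_submodule_mk hv c), fun h w hw => ?_⟩
  rw [Projectivization.submodule_mk] at hw
  obtain ⟨c, rfl⟩ := Submodule.mem_span_singleton.mp hw
  exact h c

theorem eval_rep_of_vanishesAt {G : Poly} {P : Plane} (h : VanishesAt G P) :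
    MvPolynomial.eval P.rep G = 0 :=
  h _ (by rw [Projectivization.submodule_eq]; exact Submodule.mem_span_singleton_self _)

theorem mem_curve_mk {F : Poly} {n : ℕ}
    (hF : ∀ (c : ℂ) v, MvPolynomial.eval (c • v) F = c ^ n * MvPolynomial.eval v F)
    {v : Fin 3 → ℂ} (hv : v ≠ 0) :
    Projectivization.mk ℂ v hv ∈ curve F ↔ MvPolynomial.eval v F = 0 := by
  change VanishesAt _ _ ↔ _
  rw [vanishesAt_mk]
  refine ⟨fun h => by simpa using h 1, fun h c => by rw [hF, h, mul_zero]⟩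

theorem hasDerivAt_line (v w : Fin 3 → ℂ) (s : ℂ) :
    HasDerivAt (fun s : ℂ => v + s • w) w s := by
  simpa using ((hasDerivAt_id s).smul_const w).const_add v

/-- Euler's relation; it needs no homogeneity of G, because G vanishes at all representatives of P.
-/
theorem gradAt_dotProduct_rep {S : Set Plane} {P : Plane} {G : Poly} (hG : G ∈ vanishingIdeal S)
    (hP : P ∈ S) : gradAt P.rep G ⬝ᵥ P.rep = 0 := by
  have h := gradAt_dotProduct_eq_zero G (hasDerivAt_line P.rep P.rep 0)
    (Eventually.of_forall fun s => hG P hP _ (by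
      rw [Projectivization.submodule_eq]
      exact Submodule.mem_span_singleton.mpr ⟨1 + s, by rw [add_smul, one_smul]⟩))
  simpa using h

theorem mem_conormalSpace {S : Set Plane} {P : Plane} {w : Fin 3 → ℂ} :
    w ∈ conormalSpace S P ↔ ∃ G ∈ vanishingIdeal S, gradAt P.rep G = w := by
  simp [conormalSpace, Submodule.mem_map]

theorem mem_span_of_dotProduct {a b : Fin 3 → ℂ} (ha : a ≠ 0)
    (h : ∀ w, a ⬝ᵥ w = 0 → b ⬝ᵥ w = 0) : b ∈ Submodule.span ℂ {a} := by
  obtain ⟨i, hi⟩ := Function.ne_iff.mp ha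
  simp only [Pi.zero_apply] at hi
  refine Submodule.mem_span_singleton.mpr ⟨b i / a i, funext fun j => ?_⟩
  have := h (a i • Pi.single j 1 - a j • Pi.single i 1) (by
    simp [dotProduct_sub, dotProduct_smul]; ring)
  simp only [dotProduct_sub, dotProduct_smul, dotProduct_single_one, smul_eq_mul] at this
  simp only [Pi.smul_apply, smul_eq_mul]
  field_simp
  linear_combination -this

/-- A point of a plane curve where the gradient does not vanish is nonsingular, with the tangent
line given by the gradient. -/
theorem isTangentLine_mk {F : Poly} {n : ℕ}
    (hF : ∀ (c : ℂ) v, MvPolynomial.eval (c • v) F = c ^ n * MvPolynomial.eval v F)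
    {v : Fin 3 → ℂ} (hv : v ≠ 0) (h0 : MvPolynomial.eval v F = 0) (hg : gradAt v F ≠ 0) :
    IsTangentLine (curve F) (Projectivization.mk ℂ v hv)
      (Projectivization.mk ℂ (gradAt v F) hg) := by
  refine ⟨(mem_curve_mk hF hv).mpr h0, ?_⟩
  obtain ⟨a, ha, hrep⟩ := exists_rep_eq_smul hv
  -- For each w killed by the gradient of F, the implicit function theorem gives an arc on the curve
  -- through v with velocity w. Since G vanishes along it, the gradient of G kills w too. No
  -- square-freeness of F is needed.
  have hle : ∀ G ∈ vanishingIdeal (curve F), gradAt (a • v) G ∈ Submodule.span ℂ {gradAt v F} := by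
    intro G hG
    refine mem_span_of_dotProduct hg fun w hw => ?_
    obtain ⟨e, he⟩ : ∃ e, gradAt v F ⬝ᵥ e ≠ 0 := by
      by_contra! hc
      exact hg (dotProduct_eq_zero _ hc)
    let Λ : ℂ × ℂ →L[ℂ] (Fin 3 → ℂ) :=
      (ContinuousLinearMap.fst ℂ ℂ ℂ).smulRight w + (ContinuousLinearMap.snd ℂ ℂ ℂ).smulRight e
    have hΛ0 : Λ (0, 0) = 0 := map_zero Λ
    have hΛ : HasStrictFDerivAt (fun q : ℂ × ℂ => v + Λ q) Λ (0, 0) :=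
      Λ.hasStrictFDerivAt.const_add v
    have hf := HasStrictFDerivAt.comp (f := fun q : ℂ × ℂ => v + Λ q) (0, 0)
      (hasStrictFDerivAt_eval F _) hΛ
    obtain ⟨τ, hτ, hτ0, hτz⟩ := exists_implicit hf (by simpa [hΛ0] using h0)
      (by simpa [hΛ0, Λ, dotProduct] using he)
    have hd : HasDerivAt (fun s : ℂ => a • (v + Λ (s, τ s))) (a • w) 0 := by
      have h1 : HasDerivAt (fun s : ℂ => (s, τ s)) (1, 0) 0 := by
        refine (hasDerivAt_id (0 : ℂ)).prodMk ?_
        convert! hτ using 1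
        have : ∑ i, gradAt v F i * w i = 0 := hw
        simp [hΛ0, Λ, this]
      have h2 := (Λ.hasFDerivAt.comp_hasDerivAt (0 : ℂ) h1).const_add v
      have h3 := h2.const_smul a
      rwa [show Λ (1, 0) = w by simp [Λ]] at h3
    have hcont : ∀ᶠ s in 𝓝 (0 : ℂ), v + Λ (s, τ s) ≠ 0 := by
      have : ContinuousAt (fun s : ℂ => v + Λ (s, τ s)) 0 :=
        continuousAt_const.add (Λ.continuous.continuousAt.comp
          (continuousAt_id.prodMk hτ.continuousAt))
      refine this.eventually_ne ?_
      simpa [hτ0, hΛ0] using hv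
    have h3 := gradAt_dotProduct_eq_zero G hd (by
      filter_upwards [hτz, hcont] with s hs hs'
      exact hG _ ((mem_curve_mk hF hs').mpr hs) _ (smul_mem_submodule_mk hs' a))
    rw [dotProduct_smul, hτ0] at h3
    have h4 : a • (v + Λ (0, 0)) = a • v := by rw [hΛ0, add_zero]
    rw [h4] at h3
    exact (smul_eq_zero.mp h3).resolve_left ha
  have hFmem : F ∈ vanishingIdeal (curve F) := fun P hP => hP
  have hne : gradAt (a • v) F ≠ 0 := by
    intro hz
    obtain ⟨e, he⟩ : ∃ e, gradAt v F ⬝ᵥ e ≠ 0 := by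
      by_contra! hc
      exact hg (dotProduct_eq_zero _ hc)
    have h1 : HasDerivAt (fun s : ℂ => MvPolynomial.eval (a • (v + s • e)) F) _ 0 :=
      hasDerivAt_eval_comp F ((hasDerivAt_line v e 0).const_smul a)
    have h2 := (hasDerivAt_eval_comp F (hasDerivAt_line v e 0)).const_mul (a ^ n)
    simp only [← hF] at h2
    have h3 := h1.unique h2
    simp only [zero_smul, add_zero, hz, zero_dotProduct] at h3
    exact (mul_ne_zero (pow_ne_zero n ha) he) h3.symm
  rw [Projectivization.submodule_mk]
  refine le_antisymm (fun w hw => ?_) ?_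
  · obtain ⟨G, hG, rfl⟩ := mem_conormalSpace.mp hw
    rw [hrep]
    exact hle G hG
  · rw [Submodule.span_singleton_le_iff_mem]
    obtain ⟨c, hc⟩ := Submodule.mem_span_singleton.mp (hle F hFmem)
    have hc0 : c ≠ 0 := by
      rintro rfl
      exact hne (by rw [← hc, zero_smul])
    have : gradAt v F = c⁻¹ • gradAt (a • v) F := by
      rw [← hc, smul_smul, inv_mul_cancel₀ hc0, one_smul]
    rw [this]
    refine Submodule.smul_mem _ _ (mem_conormalSpace.mpr ⟨F, hFmem, by rw [hrep]⟩)

theorem IsTangentLine.unique {S : Set Plane} {P L L' : Plane} (h : IsTangentLine S P L)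
    (h' : IsTangentLine S P L') : L = L' :=
  Projectivization.submodule_injective (h.2.symm.trans h'.2)

theorem IsTangentLine.exists_gradAt_eq {S : Set Plane} {P L : Plane} (h : IsTangentLine S P L)
    {G : Poly} (hG : G ∈ vanishingIdeal S) : ∃ κ : ℂ, gradAt P.rep G = κ • L.rep := by
  have h1 : gradAt P.rep G ∈ L.submodule := h.2 ▸ mem_conormalSpace.mpr ⟨G, hG, rfl⟩
  rw [Projectivization.submodule_eq] at h1
  obtain ⟨κ, hκ⟩ := Submodule.mem_span_singleton.mp h1
  exact ⟨κ, hκ.symm⟩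

theorem IsTangentLine.rep_dotProduct_rep {S : Set Plane} {P L : Plane} (h : IsTangentLine S P L) :
    L.rep ⬝ᵥ P.rep = 0 := by
  have h1 : L.rep ∈ conormalSpace S P := by
    rw [h.2, Projectivization.submodule_eq]
    exact Submodule.mem_span_singleton_self _
  obtain ⟨G, hG, hGL⟩ := mem_conormalSpace.mp h1
  rw [← hGL]
  exact gradAt_dotProduct_rep hG h.1

/-- Allows conormal spaces of the dual curve to be computed from the tangent lines alone, without
their limits. -/
theorem vanishingIdeal_zariskiClosure (S : Set Plane) :
    vanishingIdeal (zariskiClosure S) = vanishingIdeal S := by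
  ext G
  exact ⟨fun h P hP => h P fun G' hG' => hG' P hP, fun h P hP => hP G h⟩

/-- A finite set of points can be separated from another point by a polynomial. -/
theorem exists_vanishesAt_finite {E : Set Plane} (hE : E.Finite) {z : Plane} (hz : z ∉ E) :
    ∃ H : Poly, (∀ L ∈ E, VanishesAt H L) ∧ MvPolynomial.eval z.rep H ≠ 0 := by
  induction E, hE using Set.Finite.induction_on with
  | empty => exact ⟨1, by simp, by simp⟩
  | @insert L E hL hE ih =>
    obtain ⟨H, hH, hHz⟩ := ih fun h => hz (Set.mem_insert_of_mem _ h)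
    have hzL : z ≠ L := fun h => hz (h ▸ Set.mem_insert _ _)
    obtain ⟨i, j, hij⟩ : ∃ i j, z.rep i * L.rep j - z.rep j * L.rep i ≠ 0 := by
      by_contra! hc
      obtain ⟨i, hi⟩ := Function.ne_iff.mp L.rep_nonzero
      simp only [Pi.zero_apply] at hi
      apply hzL
      rw [← z.mk_rep, ← L.mk_rep, Projectivization.mk_eq_mk_iff']
      refine ⟨z.rep i / L.rep i, funext fun j => ?_⟩
      simp only [Pi.smul_apply, smul_eq_mul]
      field_simp
      linear_combination hc i j
    refine ⟨H * (MvPolynomial.C (L.rep j) * MvPolynomial.X i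
      - MvPolynomial.C (L.rep i) * MvPolynomial.X j), ?_, ?_⟩
    · rintro M (rfl | hM) v hv
      · rw [Projectivization.submodule_eq] at hv
        obtain ⟨c, rfl⟩ := Submodule.mem_span_singleton.mp hv
        simp only [map_mul, map_sub, MvPolynomial.eval_C, MvPolynomial.eval_X, Pi.smul_apply,
          smul_eq_mul]
        ring
      · rw [map_mul, hH M hM v hv, zero_mul]
    · rw [map_mul]
      refine mul_ne_zero hHz ?_
      simp only [map_mul, map_sub, MvPolynomial.eval_C, MvPolynomial.eval_X]
      intro h
      exact hij (by linear_combination h)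

/-! ### Square-free parts of monic bivariate polynomials -/

theorem exists_integral_multiple {R : Type*} [CommRing R] [IsDomain R]
    (a : (FractionRing R)[X]) :
    ∃ (b : R) (A : R[X]), b ≠ 0 ∧ A.map (algebraMap R (FractionRing R)) =
      C (algebraMap R (FractionRing R) b) * a := by
  obtain ⟨b, hb, h⟩ := IsLocalization.integerNormalization_spec (nonZeroDivisors R) a
  refine ⟨b, _, nonZeroDivisors.ne_zero hb, h.trans ?_⟩
  rw [← algebraMap_smul (FractionRing R) b a, smul_eq_C_mul]

/-- The radical over the fraction field descends to a monic f over R because R is integrally closed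
(Gauss). In characteristic 0 it is separable, and clearing denominators in its Bézout identity gives
d. Where d does not vanish, f and f' have no common root. -/
theorem exists_squarefree_part {R : Type*} [CommRing R] [IsDomain R] [IsIntegrallyClosed R]
    [CharZero R] {p : R[X]} (hp : p.Monic) :
    ∃ (f A B : R[X]) (d : R) (k : ℕ), f ∣ p ∧ p ∣ f ^ k ∧ d ≠ 0 ∧
      A * f + B * derivative f = C d := by
  classical
  let K := FractionRing R
  let ι := algebraMap R K
  have hι : Function.Injective ι := IsFractionRing.injective R K
  have : CharZero K := charZero_of_injective_algebraMap hι
  let q := UniqueFactorizationMonoid.radical (p.map ι)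
  have hp0 : p.map ι ≠ 0 := (hp.map ι).ne_zero
  have hqp : q ∣ p.map ι := UniqueFactorizationMonoid.radical_dvd_self
  obtain ⟨k, hk⟩ := UniqueFactorizationMonoid.exists_dvd_radical_self_pow hp0
  have hq0 : q ≠ 0 := ne_zero_of_dvd_ne_zero hp0 hqp
  obtain ⟨f, hf⟩ := IsIntegrallyClosed.eq_map_mul_C_of_dvd K hp hqp
  have hlc : q.leadingCoeff ≠ 0 := leadingCoeff_ne_zero.mpr hq0
  have hunit : IsUnit (C q.leadingCoeff) := isUnit_C.mpr hlc.isUnit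
  have hassoc : Associated (f.map ι) q := ⟨hunit.unit, by rw [IsUnit.unit_spec]; exact hf⟩
  have hfm : f.Monic := by
    have h1 := congrArg leadingCoeff hf
    rw [leadingCoeff_mul, leadingCoeff_C] at h1
    have h2 : (f.map ι).leadingCoeff = 1 := mul_right_cancel₀ hlc (h1.trans (one_mul _).symm)
    exact monic_of_injective hι h2
  have hsep : (f.map ι).Separable := by
    rw [PerfectField.separable_iff_squarefree]
    exact (hassoc.squarefree_iff).mpr UniqueFactorizationMonoid.squarefree_radical
  obtain ⟨a, b, hab⟩ := hsep
  obtain ⟨da, A, hda, hA⟩ := exists_integral_multiple a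
  obtain ⟨db, B, hdb, hB⟩ := exists_integral_multiple b
  refine ⟨f, C db * A, C da * B, da * db, k, ?_, ?_, mul_ne_zero hda hdb, ?_⟩
  · exact (map_dvd_map ι hι hfm).mp ((hassoc.dvd).trans hqp)
  · refine (map_dvd_map ι hι hp).mp ?_
    rw [Polynomial.map_pow]
    exact hk.trans (pow_dvd_pow_of_dvd hassoc.symm.dvd k)
  · apply map_injective ι hι
    rw [derivative_map] at hab
    have hA' : A.map ι = C (ι da) * a := hA
    have hB' : B.map ι = C (ι db) * b := hB
    simp only [Polynomial.map_add, Polynomial.map_mul, hA', hB', map_C, map_mul]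
    linear_combination C (ι da) * C (ι db) * hab

/-! ### Polynomials of a matrix -/

theorem aeval_mulVec_eq_zero {H : Matrix (Fin n) (Fin n) ℂ} {t : ℂ} {w : Fin n → ℂ}
    (hw : (t • (1 : Matrix (Fin n) (Fin n) ℂ) - H) *ᵥ w = 0) {q : ℂ[X]} (hq : q.eval t = 0) :
    aeval H q *ᵥ w = 0 := by
  obtain ⟨s, hs⟩ := dvd_iff_isRoot.mpr hq
  have h1 : aeval H q = aeval H s * -(t • (1 : Matrix (Fin n) (Fin n) ℂ) - H) := by
    rw [hs, mul_comm, map_mul]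
    simp [Algebra.algebraMap_eq_smul_one]
  rw [h1, ← Matrix.mulVec_mulVec, Matrix.neg_mulVec, hw, neg_zero, Matrix.mulVec_zero]

theorem det_aeval_of_isHermitian {H : Matrix (Fin n) (Fin n) ℂ} (hH : H.IsHermitian) (q : ℂ[X]) :
    (aeval H q).det = ∏ i, q.eval (hH.eigenvalues i : ℂ) := by
  have h1 : aeval H q = Unitary.conjStarAlgAut ℂ _ hH.eigenvectorUnitary
      (Matrix.diagonal fun i => q.eval (hH.eigenvalues i : ℂ)) := by
    conv_lhs => rw [hH.spectral_theorem]
    rw [aeval_algHom_apply]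
    congr 1
    have := aeval_algHom_apply (Matrix.diagonalAlgHom ℂ (n := Fin n) (α := ℂ))
      (RCLike.ofReal ∘ hH.eigenvalues) q
    rw [Matrix.diagonalAlgHom_apply, Matrix.diagonalAlgHom_apply, aeval_pi_apply] at this
    rw [this]
    simp [coe_aeval_eq_eval]
  rw [h1, Unitary.conjStarAlgAut_apply, Matrix.det_mul_comm, ← mul_assoc]
  simp [Matrix.det_diagonal]

/-! ### Slopes of the branches of a Hermitian pencil -/

/-- The polynomial `det (σ f_t(x, -M(x)) - f_x(x, -M(x)))` where `M(x) = M₁ + x M₀`. -/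
noncomputable def slopeDet (M₀ M₁ : Matrix (Fin n) (Fin n) ℂ) (ft fx : ℂ[X][Y]) : ℂ[X][Y] :=
  Matrix.det ((X : ℂ[X][Y]) • (aeval (-(M₁.map C + (X : ℂ[X]) • M₀.map C)) ft).map C
    - (aeval (-(M₁.map C + (X : ℂ[X]) • M₀.map C)) fx).map C)

theorem map_eval_pencil (M₀ M₁ : Matrix (Fin n) (Fin n) ℂ) (x : ℂ) :
    (-(M₁.map C + (X : ℂ[X]) • M₀.map C)).map (eval x) = -(M₁ + x • M₀) := by
  ext i j
  simp only [Matrix.map_apply, Matrix.neg_apply, Matrix.add_apply, Matrix.smul_apply, smul_eq_mul,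
    eval_neg, eval_add, eval_mul, eval_C, eval_X]

theorem map_eval_aeval (M : Matrix (Fin n) (Fin n) ℂ[X]) (f : ℂ[X][Y]) (x : ℂ) :
    (aeval M f).map (eval x) = aeval (M.map (eval x)) (f.map (evalRingHom x)) := by
  have := map_aeval_eq_aeval_map (R := ℂ[X]) (S := Matrix (Fin n) (Fin n) ℂ[X]) (T := ℂ)
    (U := Matrix (Fin n) (Fin n) ℂ) (φ := evalRingHom x) (ψ := (evalRingHom x).mapMatrix)
    (by
      refine RingHom.ext fun a => Matrix.ext fun i j => ?_
      by_cases h : i = j <;> simp [Matrix.algebraMap_matrix_apply, h]) f M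
  simpa using this

theorem evalEval_slopeDet (M₀ M₁ : Matrix (Fin n) (Fin n) ℂ) (ft fx : ℂ[X][Y]) (x σ : ℂ) :
    (slopeDet M₀ M₁ ft fx).evalEval x σ = (aeval (-(M₁ + x • M₀))
      (C σ * ft.map (evalRingHom x) - fx.map (evalRingHom x))).det := by
  rw [slopeDet, ← coe_evalEvalRingHom, RingHom.map_det]
  congr 1
  rw [map_sub (aeval _), map_mul (aeval _), aeval_C, ← map_eval_pencil, ← map_eval_aeval, ← map_eval_aeval]
  ext i j
  simp [Matrix.algebraMap_eq_diagonal, mul_comm σ]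

theorem exists_norm_eq_one_of_det_eq_zero {M : Matrix (Fin n) (Fin n) ℂ} (h : M.det = 0) :
    ∃ w : Fin n → ℂ, ‖w‖ = 1 ∧ M *ᵥ w = 0 := by
  obtain ⟨w, hw, hMw⟩ := Matrix.exists_mulVec_eq_zero_iff.mpr h
  refine ⟨((‖w‖⁻¹ : ℝ) : ℂ) • w, ?_, by rw [Matrix.mulVec_smul, hMw, smul_zero]⟩
  rw [norm_smul, Complex.norm_real, norm_inv, norm_norm, inv_mul_cancel₀ (norm_ne_zero_iff.mpr hw)]

theorem dotProduct_mulVec_comm_of_isHermitian {M : Matrix (Fin n) (Fin n) ℂ} (hM : M.IsHermitian)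
    (u w : Fin n → ℂ) : star u ⬝ᵥ M *ᵥ w = star (M *ᵥ u) ⬝ᵥ w := by
  rw [Matrix.star_mulVec, hM.eq, Matrix.dotProduct_mulVec]

open scoped ComplexOrder in
theorem star_dotProduct_self_ne_zero {u : Fin n → ℂ} (hu : u ≠ 0) : star u ⬝ᵥ u ≠ 0 :=
  fun h => hu (dotProduct_star_self_eq_zero.mp h)

/-- Eigenvectors annihilate a Hermitian pencil also from the left. -/
theorem star_dotProduct_mulVec_add_smul {M : Matrix (Fin n) (Fin n) ℂ} (hM : M.IsHermitian)
    {u : Fin n → ℂ} {t : ℂ} (hu : u ≠ 0) (h : M *ᵥ u + t • u = 0) (w : Fin n → ℂ) :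
    star u ⬝ᵥ (M *ᵥ w) + t * (star u ⬝ᵥ w) = 0 := by
  have hMu : M *ᵥ u = -(t • u) := eq_neg_of_add_eq_zero_left h
  have h1 := dotProduct_mulVec_comm_of_isHermitian hM u u
  rw [hMu] at h1
  simp only [dotProduct_neg, dotProduct_smul, star_neg, star_smul, neg_dotProduct, smul_dotProduct,
    smul_eq_mul, neg_inj] at h1
  have ht : t = star t := mul_right_cancel₀ (star_dotProduct_self_ne_zero hu) h1
  rw [dotProduct_mulVec_comm_of_isHermitian hM, hMu]
  simp only [star_neg, star_smul, neg_dotProduct, smul_dotProduct, smul_eq_mul, ← ht]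
  ring

/-- First-order perturbation theory: the derivative of the branch t = τ(x) is −⟨M₀u, u⟩/⟨u, u⟩. As
the kernel at (x, t) may have higher dimension, u cannot be arbitrary; it is a limit of unit kernel
vectors taken along the branch. -/
theorem slope_eq {M₀ M₁ : Matrix (Fin n) (Fin n) ℂ} (h₀ : M₀.IsHermitian) (h₁ : M₁.IsHermitian)
    {f fx : ℂ[X][Y]} {x : ℝ} {t : ℂ}
    (hfx : HasStrictFDerivAt (fun q : ℂ × ℂ => f.evalEval q.1 q.2)
      (fx.evalEval (x : ℂ) t • ContinuousLinearMap.fst ℂ ℂ ℂ +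
        (derivative f).evalEval (x : ℂ) t • ContinuousLinearMap.snd ℂ ℂ ℂ) ((x : ℂ), t))
    (hdet : ∀ y s : ℂ, f.evalEval y s = 0 →
      (M₁ + y • M₀ + s • (1 : Matrix (Fin n) (Fin n) ℂ)).det = 0)
    (h0 : f.evalEval (x : ℂ) t = 0) (ht : (derivative f).evalEval (x : ℂ) t ≠ 0) :
    ∃ u : Fin n → ℂ, ‖u‖ = 1 ∧ (M₁ + (x : ℂ) • M₀) *ᵥ u + t • u = 0 ∧
      fx.evalEval (x : ℂ) t * (star u ⬝ᵥ u) = (derivative f).evalEval (x : ℂ) t * (star u ⬝ᵥ M₀ *ᵥ u) := by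
  obtain ⟨τ, hτ, hτ0, hτz⟩ := exists_implicit hfx h0 (by simpa using ht)
  have hτ' : HasDerivAt τ (-(fx.evalEval (x : ℂ) t) / (derivative f).evalEval (x : ℂ) t) x := by
    simpa using hτ
  let y : ℕ → ℂ := fun k => ((x + 1 / (k + 1) : ℝ) : ℂ)
  have hy : Tendsto y atTop (𝓝 x) := by
    have h1 : Tendsto (fun k : ℕ => x + 1 / ((k : ℝ) + 1)) atTop (𝓝 (x + 0)) :=
      tendsto_const_nhds.add tendsto_one_div_add_atTop_nhds_zero_nat
    rw [add_zero] at h1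
    exact (Complex.continuous_ofReal.tendsto x).comp h1
  have hyne : ∀ k, y k ≠ x := fun k h => by
    have h1 : x + 1 / ((k : ℝ) + 1) = x := Complex.ofReal_injective h
    have h2 : (0 : ℝ) < 1 / ((k : ℝ) + 1) := by positivity
    linarith
  have hev := hy.eventually hτz
  have hw : ∀ k, ∃ w : Fin n → ℂ, f.evalEval (y k) (τ (y k)) = 0 →
      ‖w‖ = 1 ∧ (M₁ + y k • M₀ + τ (y k) • (1 : Matrix (Fin n) (Fin n) ℂ)) *ᵥ w = 0 := by
    intro k
    by_cases h : f.evalEval (y k) (τ (y k)) = 0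
    · obtain ⟨w, hw⟩ := exists_norm_eq_one_of_det_eq_zero (hdet _ _ h)
      exact ⟨w, fun _ => hw⟩
    · exact ⟨0, fun h' => absurd h' h⟩
  choose w hw using hw
  obtain ⟨N, hN⟩ := eventually_atTop.mp hev
  have hmem : ∀ k, w (k + N) ∈ Metric.sphere (0 : Fin n → ℂ) 1 := fun k => by
    rw [mem_sphere_zero_iff_norm]
    exact (hw _ (hN _ (by omega))).1
  obtain ⟨u, hu, φ, hφ, hlim⟩ := (isCompact_sphere (0 : Fin n → ℂ) 1).tendsto_subseq hmem
  rw [mem_sphere_zero_iff_norm] at hu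
  have hu0 : u ≠ 0 := by
    rintro rfl
    simp at hu
  have hsub : Tendsto (fun k => φ k + N) atTop atTop :=
    (tendsto_add_atTop_nat N).comp hφ.tendsto_atTop
  have hyl : Tendsto (fun k => y (φ k + N)) atTop (𝓝 x) := hy.comp hsub
  have hτl : Tendsto (fun k => τ (y (φ k + N))) atTop (𝓝 t) := by
    have := hτ.continuousAt.tendsto.comp hyl
    rwa [hτ0] at this
  have hmulVec : Continuous fun q : ℂ × ℂ × (Fin n → ℂ) =>
      (M₁ + q.1 • M₀) *ᵥ q.2.2 + q.2.1 • q.2.2 := by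
    refine Continuous.add (Continuous.matrix_mulVec ?_ ?_) ?_ <;> fun_prop
  have hker : ∀ k, (M₁ + y (φ k + N) • M₀) *ᵥ w (φ k + N) + τ (y (φ k + N)) • w (φ k + N) = 0 := by
    intro k
    have := (hw _ (hN (φ k + N) (by omega))).2
    rwa [Matrix.add_mulVec, Matrix.smul_mulVec, Matrix.one_mulVec] at this
  have hueq : (M₁ + (x : ℂ) • M₀) *ᵥ u + t • u = 0 := by
    have h1 := (hmulVec.tendsto (x, t, u)).comp (hyl.prodMk_nhds (hτl.prodMk_nhds hlim))
    refine tendsto_nhds_unique h1 ?_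
    refine tendsto_const_nhds.congr fun k => ?_
    exact (hker k).symm
  refine ⟨u, hu, hueq, ?_⟩
  have hH : (M₁ + (x : ℂ) • M₀).IsHermitian := by
    refine h₁.add ?_
    rw [Matrix.IsHermitian, Matrix.conjTranspose_smul, h₀.eq]
    simp
  have hslope := hasDerivAt_iff_tendsto_slope.mp hτ'
  have hsl : Tendsto (fun k => slope τ x (y (φ k + N))) atTop
      (𝓝 (-(fx.evalEval (x : ℂ) t) / (derivative f).evalEval (x : ℂ) t)) :=
    hslope.comp (tendsto_nhdsWithin_iff.mpr ⟨hyl, Eventually.of_forall fun k => hyne _⟩)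
  have hdot : ∀ v : Fin n → ℂ, Continuous fun w : Fin n → ℂ => v ⬝ᵥ w := fun v => by
    unfold dotProduct; fun_prop
  have hdM : Continuous fun w : Fin n → ℂ => star u ⬝ᵥ M₀ *ᵥ w :=
    (hdot _).comp (continuous_const.matrix_mulVec continuous_id)
  -- Pair the kernel equation at the k-th point with u and subtract the one at x, where u
  -- annihilates the pencil from the left; dividing by the step leaves a difference quotient of τ.
  have hzero : ∀ k, star u ⬝ᵥ M₀ *ᵥ w (φ k + N)
      + slope τ x (y (φ k + N)) * (star u ⬝ᵥ w (φ k + N)) = 0 := by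
    intro k
    have h1 := congrArg (fun v => star u ⬝ᵥ v) (hker k)
    have h2 := star_dotProduct_mulVec_add_smul hH hu0 hueq (w (φ k + N))
    simp only [dotProduct_add, dotProduct_smul, dotProduct_zero, Matrix.add_mulVec,
      Matrix.smul_mulVec, smul_eq_mul] at h1 h2
    rw [slope_def_field, hτ0]
    have h3 : y (φ k + N) - x ≠ 0 := sub_ne_zero.mpr (hyne _)
    field_simp
    linear_combination h1 - h2
  have hfin := ((hdM.tendsto u).comp hlim).add (hsl.mul (((hdot (star u)).tendsto u).comp hlim))
  have h4 := tendsto_nhds_unique hfin (tendsto_const_nhds.congr fun k => (hzero k).symm)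
  field_simp at h4
  linear_combination -h4

/-- If no kernel vector of the pencil `M₁ + x M₀ + t` is isotropic for `M₀`, the slopes of the
branches are bounded away from zero on bounded intervals. -/
theorem exists_slope_bound {M₀ M₁ : Matrix (Fin n) (Fin n) ℂ}
    (hdef : ∀ (x : ℝ) (t : ℂ) (u : Fin n → ℂ), u ≠ 0 → (M₁ + (x : ℂ) • M₀) *ᵥ u + t • u = 0 →
      star u ⬝ᵥ M₀ *ᵥ u ≠ 0) (a b : ℝ) :
    ∃ c : ℝ, 0 < c ∧ ∀ x ∈ Set.Icc a b, ∀ (t : ℂ) (u : Fin n → ℂ), ‖u‖ = 1 →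
      (M₁ + (x : ℂ) • M₀) *ᵥ u + t • u = 0 →
      c * ‖star u ⬝ᵥ u‖ ≤ ‖star u ⬝ᵥ M₀ *ᵥ u‖ := by
  -- The eigenvector condition with t eliminated through the Rayleigh quotient and no division: a
  -- closed condition, so K is compact.
  let K : Set (ℝ × (Fin n → ℂ)) := {q | q ∈ Set.Icc a b ×ˢ Metric.sphere (0 : Fin n → ℂ) 1 ∧
    (star q.2 ⬝ᵥ q.2) • ((M₁ + (q.1 : ℂ) • M₀) *ᵥ q.2) -
      (star q.2 ⬝ᵥ (M₁ + (q.1 : ℂ) • M₀) *ᵥ q.2) • q.2 = 0}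
  have hmv : Continuous fun q : ℝ × (Fin n → ℂ) => (M₁ + (q.1 : ℂ) • M₀) *ᵥ q.2 :=
    Continuous.matrix_mulVec (by fun_prop) (by fun_prop)
  have hmv0 : Continuous fun q : ℝ × (Fin n → ℂ) => M₀ *ᵥ q.2 :=
    Continuous.matrix_mulVec (by fun_prop) (by fun_prop)
  have hss : Continuous fun q : ℝ × (Fin n → ℂ) => star q.2 ⬝ᵥ q.2 :=
    Continuous.dotProduct (by fun_prop) (by fun_prop)
  have hK : IsCompact K := by
    refine (isCompact_Icc.prod (isCompact_sphere _ _)).inter_right (isClosed_eq ?_ continuous_const)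
    exact (hss.smul hmv).sub ((Continuous.dotProduct (by fun_prop) hmv).smul continuous_snd)
  have hcont : ContinuousOn (fun q : ℝ × (Fin n → ℂ) =>
      ‖star q.2 ⬝ᵥ M₀ *ᵥ q.2‖ / ‖star q.2 ⬝ᵥ q.2‖) K := by
    refine ContinuousOn.div ?_ hss.norm.continuousOn fun q hq => ?_
    · exact (Continuous.dotProduct (by fun_prop) hmv0).norm.continuousOn
    · have h0 : q.2 ≠ 0 := fun h => by simpa [h] using hq.1.2
      exact norm_ne_zero_iff.mpr (star_dotProduct_self_ne_zero h0)
  have hmem : ∀ x ∈ Set.Icc a b, ∀ (t : ℂ) (u : Fin n → ℂ), ‖u‖ = 1 →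
      (M₁ + (x : ℂ) • M₀) *ᵥ u + t • u = 0 → (x, u) ∈ K := by
    intro x hx t u hu h
    refine ⟨⟨hx, by simpa using hu⟩, ?_⟩
    have h1 : (M₁ + (x : ℂ) • M₀) *ᵥ u = -(t • u) := eq_neg_of_add_eq_zero_left h
    simp only [h1, dotProduct_neg, dotProduct_smul, smul_eq_mul]
    module
  rcases K.eq_empty_or_nonempty with hE | hne
  · exact ⟨1, one_pos, fun x hx t u hu h => by
      have := hmem x hx t u hu h
      rw [hE] at this
      exact this.elim⟩
  · obtain ⟨q, hq, hmin⟩ := hK.exists_isMinOn hne hcont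
    have hmin' : ∀ r ∈ K, ‖star q.2 ⬝ᵥ M₀ *ᵥ q.2‖ / ‖star q.2 ⬝ᵥ q.2‖ ≤
        ‖star r.2 ⬝ᵥ M₀ *ᵥ r.2‖ / ‖star r.2 ⬝ᵥ r.2‖ := fun r hr => hmin hr
    have h0 : q.2 ≠ 0 := fun h => by simpa [h] using hq.1.2
    have hs0 := star_dotProduct_self_ne_zero h0
    have hpos : 0 < ‖star q.2 ⬝ᵥ M₀ *ᵥ q.2‖ / ‖star q.2 ⬝ᵥ q.2‖ := by
      refine div_pos (norm_pos_iff.mpr ?_) (norm_pos_iff.mpr hs0)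
      refine hdef q.1 (-((star q.2 ⬝ᵥ (M₁ + (q.1 : ℂ) • M₀) *ᵥ q.2) / (star q.2 ⬝ᵥ q.2))) q.2 h0 ?_
      have h2 := hq.2
      have h3 : (M₁ + (q.1 : ℂ) • M₀) *ᵥ q.2 = (star q.2 ⬝ᵥ q.2)⁻¹ •
          ((star q.2 ⬝ᵥ (M₁ + (q.1 : ℂ) • M₀) *ᵥ q.2) • q.2) := by
        rw [eq_inv_smul_iff₀ hs0]
        exact sub_eq_zero.mp h2
      rw [neg_smul, div_eq_inv_mul, mul_smul, ← h3, add_neg_cancel]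
    refine ⟨_, hpos, fun x hx t u hu h => ?_⟩
    have h5 : u ≠ 0 := fun h => by simp [h] at hu
    have h6 := hmin' _ (hmem x hx t u hu h)
    rwa [le_div_iff₀ (norm_pos_iff.mpr (star_dotProduct_self_ne_zero h5))] at h6

theorem evalEval_charpoly (M₀ M₁ : Matrix (Fin n) (Fin n) ℂ) (x t : ℂ) :
    (-(M₁.map C + (X : ℂ[X]) • M₀.map C)).charpoly.evalEval x t =
      (M₁ + x • M₀ + t • (1 : Matrix (Fin n) (Fin n) ℂ)).det := by
  rw [← map_evalRingHom_eval, ← Matrix.charpoly_map, coe_evalRingHom, map_eval_pencil,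
    Matrix.eval_charpoly]
  congr 1
  rw [Matrix.scalar_apply, ← Matrix.smul_one_eq_diagonal]
  abel

/-- The roots t are eigenvalues of −M(x), so substituting this matrix for t eliminates t: an
eigenvector for t is annihilated once σ f_t = f_x. Here x may be complex. -/
theorem slopeDet_eq_zero {M₀ M₁ : Matrix (Fin n) (Fin n) ℂ} {ft fx : ℂ[X][Y]} {x t σ : ℂ}
    (hdet : (M₁ + x • M₀ + t • (1 : Matrix (Fin n) (Fin n) ℂ)).det = 0)
    (hσ : σ * ft.evalEval x t = fx.evalEval x t) :
    (slopeDet M₀ M₁ ft fx).evalEval x σ = 0 := by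
  rw [evalEval_slopeDet]
  obtain ⟨w, hw, h⟩ := Matrix.exists_mulVec_eq_zero_iff.mpr hdet
  refine Matrix.exists_mulVec_eq_zero_iff.mp ⟨w, hw, aeval_mulVec_eq_zero (t := t) ?_ ?_⟩
  · rw [← h]
    congr 1
    abel
  · rw [eval_sub, eval_mul, eval_C, map_evalRingHom_eval, map_evalRingHom_eval, hσ, sub_self]

theorem isHermitian_pencil {M₀ M₁ : Matrix (Fin n) (Fin n) ℂ} (h₀ : M₀.IsHermitian)
    (h₁ : M₁.IsHermitian) (x : ℝ) : (M₁ + (x : ℂ) • M₀).IsHermitian := by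
  refine h₁.add ?_
  rw [Matrix.IsHermitian, Matrix.conjTranspose_smul, h₀.eq]
  simp

theorem det_sub_eigenvalue {H : Matrix (Fin n) (Fin n) ℂ} (hH : H.IsHermitian) (i : Fin n) :
    ((hH.eigenvalues i : ℂ) • (1 : Matrix (Fin n) (Fin n) ℂ) - H).det = 0 := by
  have h := Matrix.eval_charpoly H (hH.eigenvalues i : ℂ)
  rw [Matrix.scalar_apply, ← Matrix.smul_one_eq_diagonal] at h
  rw [← h, hH.charpoly_eq, eval_prod]
  exact Finset.prod_eq_zero (Finset.mem_univ i) (by simp)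

/-- A polynomial relation between the abscissa `x` and the slope `σ` of the branches of the curve
`det (M₁ + x M₀ + t) = 0` which excludes the slope zero at a given real abscissa. -/
theorem exists_slope_polynomial {M₀ M₁ : Matrix (Fin n) (Fin n) ℂ} (h₀ : M₀.IsHermitian)
    (h₁ : M₁.IsHermitian)
    (hdef : ∀ (x : ℝ) (t : ℂ) (u : Fin n → ℂ), u ≠ 0 → (M₁ + (x : ℂ) • M₀) *ᵥ u + t • u = 0 →
      star u ⬝ᵥ M₀ *ᵥ u ≠ 0) (x₀ : ℝ) :
    ∃ f fx Ψ : ℂ[X][Y],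
      (∀ x t : ℂ, HasStrictFDerivAt (fun q : ℂ × ℂ => f.evalEval q.1 q.2)
        (fx.evalEval x t • ContinuousLinearMap.fst ℂ ℂ ℂ +
          (derivative f).evalEval x t • ContinuousLinearMap.snd ℂ ℂ ℂ) (x, t)) ∧
      (∀ x t : ℂ, (M₁ + x • M₀ + t • (1 : Matrix (Fin n) (Fin n) ℂ)).det = 0 →
        f.evalEval x t = 0) ∧
      (∀ x t σ : ℂ, x ≠ x₀ → (M₁ + x • M₀ + t • (1 : Matrix (Fin n) (Fin n) ℂ)).det = 0 →
        σ * (derivative f).evalEval x t = fx.evalEval x t → Ψ.evalEval x σ = 0) ∧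
      Ψ.evalEval (x₀ : ℂ) 0 ≠ 0 := by
  obtain ⟨f, A, B, d, k, hfp, hpf, hd, hAB⟩ :=
    exists_squarefree_part (-(M₁.map C + (X : ℂ[X]) • M₀.map C)).charpoly_monic
  obtain ⟨fx, hfx⟩ := exists_hasStrictFDerivAt_evalEval f
  have hf0 : ∀ x t : ℂ, (M₁ + x • M₀ + t • (1 : Matrix (Fin n) (Fin n) ℂ)).det = 0 →
      f.evalEval x t = 0 := by
    intro x t h
    have h1 := evalEval_dvd x t hpf
    rw [evalEval_charpoly, h, zero_dvd_iff, evalEval_pow] at h1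
    exact by_contra fun hf => pow_ne_zero k hf h1
  have hf1 : ∀ x t : ℂ, f.evalEval x t = 0 →
      (M₁ + x • M₀ + t • (1 : Matrix (Fin n) (Fin n) ℂ)).det = 0 := by
    intro x t h
    have h1 := evalEval_dvd x t hfp
    rwa [evalEval_charpoly, h, zero_dvd_iff] at h1
  obtain ⟨c, hc, hbound⟩ := exists_slope_bound hdef (x₀ - 1) (x₀ + 1)
  have hslope : ∀ x ∈ Set.Icc (x₀ - 1) (x₀ + 1), d.eval (x : ℂ) ≠ 0 → ∀ t : ℂ,
      (M₁ + (x : ℂ) • M₀ + t • (1 : Matrix (Fin n) (Fin n) ℂ)).det = 0 →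
      (derivative f).evalEval (x : ℂ) t ≠ 0 ∧
      c * ‖(derivative f).evalEval (x : ℂ) t‖ ≤ ‖fx.evalEval (x : ℂ) t‖ := by
    intro x hx hdx t ht
    have h1 : (derivative f).evalEval (x : ℂ) t ≠ 0 := by
      intro h
      have h2 := congrArg (evalEval (x : ℂ) t) hAB
      rw [evalEval_add, evalEval_mul, evalEval_mul, hf0 _ _ ht, h, evalEval_C] at h2
      simp only [mul_zero, add_zero] at h2
      exact hdx h2.symm
    refine ⟨h1, ?_⟩
    obtain ⟨u, hu, hker, hs⟩ := slope_eq h₀ h₁ (hfx x t) hf1 (hf0 _ _ ht) h1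
    have h3 := hbound x hx t u hu hker
    have hu0 : u ≠ 0 := fun h => by simp [h] at hu
    have h4 := congrArg norm hs
    rw [norm_mul, norm_mul] at h4
    have h5 : 0 < ‖star u ⬝ᵥ u‖ := norm_pos_iff.mpr (star_dotProduct_self_ne_zero hu0)
    refine le_of_mul_le_mul_right ?_ h5
    rw [h4, mul_comm c, mul_assoc]
    exact mul_le_mul_of_nonneg_left h3 (norm_nonneg _)
  let Ψ₀ := slopeDet M₀ M₁ (derivative f) fx
  have hprod : ∀ (x : ℝ) (σ : ℂ), Ψ₀.evalEval (x : ℂ) σ = ∏ i,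
      (σ * (derivative f).evalEval (x : ℂ) ((isHermitian_pencil h₀ h₁ x).neg.eigenvalues i : ℂ) -
        fx.evalEval (x : ℂ) ((isHermitian_pencil h₀ h₁ x).neg.eigenvalues i : ℂ)) := by
    intro x σ
    rw [evalEval_slopeDet, det_aeval_of_isHermitian (isHermitian_pencil h₀ h₁ x).neg]
    simp only [eval_sub, eval_mul, eval_C, map_evalRingHom_eval]
  have heig : ∀ (x : ℝ) (i : Fin n), (M₁ + (x : ℂ) • M₀ +
      ((isHermitian_pencil h₀ h₁ x).neg.eigenvalues i : ℂ) •
        (1 : Matrix (Fin n) (Fin n) ℂ)).det = 0 := by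
    intro x i
    rw [← det_sub_eigenvalue (isHermitian_pencil h₀ h₁ x).neg i]
    congr 1
    abel
  -- The factors are σ f_t − f_x with |f_x| ≥ c |f_t|, so each is at most |σ|/c + 1 times its value
  -- at σ = 0.
  have hle : ∀ x ∈ Set.Icc (x₀ - 1) (x₀ + 1), d.eval (x : ℂ) ≠ 0 → ∀ σ : ℂ,
      ‖Ψ₀.evalEval (x : ℂ) σ‖ ≤ (‖σ‖ / c + 1) ^ n * ‖Ψ₀.evalEval (x : ℂ) 0‖ := by
    intro x hx hdx σ
    have h1 : (‖σ‖ / c + 1) ^ n = ∏ _i : Fin n, (‖σ‖ / c + 1) := by simp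
    rw [hprod, hprod, norm_prod, norm_prod, h1, ← Finset.prod_mul_distrib]
    refine Finset.prod_le_prod (fun _ _ => norm_nonneg _) fun i _ => ?_
    obtain ⟨-, h2⟩ := hslope x hx hdx _ (heig x i)
    rw [zero_mul, zero_sub, norm_neg]
    refine (norm_sub_le _ _).trans ?_
    rw [norm_mul, add_mul, one_mul]
    refine add_le_add ?_ le_rfl
    rw [div_mul_eq_mul_div, le_div_iff₀ hc, mul_assoc, mul_comm _ c]
    exact mul_le_mul_of_nonneg_left h2 (norm_nonneg _)
  have hne : ∀ x ∈ Set.Icc (x₀ - 1) (x₀ + 1), d.eval (x : ℂ) ≠ 0 → Ψ₀.evalEval (x : ℂ) 0 ≠ 0 := by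
    intro x hx hdx
    rw [hprod, Finset.prod_ne_zero_iff]
    intro i _
    obtain ⟨h1, h2⟩ := hslope x hx hdx _ (heig x i)
    rw [zero_mul, zero_sub]
    exact neg_ne_zero.mpr (norm_pos_iff.mp ((mul_pos hc (norm_pos_iff.mpr h1)).trans_le h2))
  have hev : ∀ᶠ x : ℝ in 𝓝[≠] x₀, x ∈ Set.Icc (x₀ - 1) (x₀ + 1) ∧ d.eval (x : ℂ) ≠ 0 := by
    refine Eventually.and ?_ ?_
    · exact mem_nhdsWithin_of_mem_nhds (Icc_mem_nhds (by linarith) (by linarith))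
    · have hfin : {x : ℝ | d.eval (x : ℂ) = 0}.Finite := by
        have h1 : {z : ℂ | d.eval z = 0}.Finite := by
          simpa [Set.ext_iff, IsRoot] using
            (Polynomial.finite_setOfPred_isRoot hd)
        exact h1.preimage Complex.ofReal_injective.injOn
      have := (hfin.subset (Set.inter_subset_left (t := {x₀}ᶜ))).isClosed.isOpen_compl.mem_nhds
        (show x₀ ∈ ({x : ℝ | d.eval (x : ℂ) = 0} ∩ {x₀}ᶜ)ᶜ by simp)
      filter_upwards [mem_nhdsWithin_of_mem_nhds this, self_mem_nhdsWithin] with x hx hx' h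
      exact hx ⟨h, hx'⟩
  have hΨ₀ : Ψ₀ ≠ 0 := by
    obtain ⟨x, hx, hdx⟩ := hev.exists
    intro h
    apply hne x hx hdx
    rw [h, evalEval_zero]
  -- At a singular point over x₀ both partial derivatives vanish, so Ψ₀ may vanish identically in σ
  -- there. Dividing out the power of x − x₀ preserves the preceding inequality.
  have hfm : FiniteMultiplicity (C (X - C (x₀ : ℂ)) : ℂ[X][Y]) Ψ₀ := by
    refine FiniteMultiplicity.of_not_isUnit ?_ hΨ₀
    rw [isUnit_C]
    exact not_isUnit_X_sub_C _
  obtain ⟨Ψ, hΨ, hndvd⟩ := hfm.exists_eq_pow_mul_and_not_dvd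
  set m := multiplicity (C (X - C (x₀ : ℂ)) : ℂ[X][Y]) Ψ₀
  have heval : ∀ x σ : ℂ, Ψ₀.evalEval x σ = (x - x₀) ^ m * Ψ.evalEval x σ := by
    intro x σ
    conv_lhs => rw [hΨ]
    simp [evalEval_mul, evalEval_pow, evalEval_C]
  refine ⟨f, fx, Ψ, hfx, hf0, fun x t σ hx ht hσ => ?_, fun hzero => hndvd ?_⟩
  · have h1 : Ψ₀.evalEval x σ = 0 := slopeDet_eq_zero ht hσ
    rw [heval] at h1
    exact (mul_eq_zero.mp h1).resolve_left (pow_ne_zero _ (sub_ne_zero.mpr hx))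
  · have hcont : ∀ σ : ℂ, Continuous fun x : ℝ => Ψ.evalEval (x : ℂ) σ := by
      intro σ
      unfold evalEval
      exact (Polynomial.continuous _).comp Complex.continuous_ofReal
    -- Let x → x₀ in the inequality: a zero of Ψ(x₀, ·) at σ = 0 would force a zero at every σ,
    -- hence another factor x − x₀.
    have hall : ∀ σ : ℂ, Ψ.evalEval (x₀ : ℂ) σ = 0 := by
      intro σ
      have h1 : ∀ᶠ x : ℝ in 𝓝[≠] x₀,
          ‖Ψ.evalEval (x : ℂ) σ‖ ≤ (‖σ‖ / c + 1) ^ n * ‖Ψ.evalEval (x : ℂ) 0‖ := by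
        filter_upwards [hev, self_mem_nhdsWithin] with x hx hx'
        have h2 := hle x hx.1 hx.2 σ
        rw [heval, heval, norm_mul, norm_mul, mul_left_comm] at h2
        refine le_of_mul_le_mul_left h2 (norm_pos_iff.mpr (pow_ne_zero _ (sub_ne_zero.mpr ?_)))
        exact fun h => hx' (Complex.ofReal_injective h)
      have h3 := le_of_tendsto_of_tendsto
        (((hcont σ).norm.tendsto x₀).mono_left nhdsWithin_le_nhds)
        ((((hcont 0).norm.const_mul _).tendsto x₀).mono_left nhdsWithin_le_nhds) h1
      rw [hzero, norm_zero, mul_zero] at h3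
      exact norm_le_zero_iff.mp h3
    rw [C_dvd_iff_dvd_coeff]
    have h4 : Ψ.map (evalRingHom (x₀ : ℂ)) = 0 := by
      refine Polynomial.funext fun σ => ?_
      rw [map_evalRingHom_eval, hall, eval_zero]
    intro i
    rw [dvd_iff_isRoot, IsRoot, ← coe_evalRingHom, ← coeff_map, h4, coeff_zero]

/-! ### The determinant of a Hermitian pencil near a simple extreme eigenvalue -/

/-- The Schur complement formula with the adjugate in place of the inverse, so that it holds in a
polynomial ring; the extra factor det E is cancelled at the end. -/
theorem det_fromBlocks_unique {R m k : Type*} [CommRing R] [IsDomain R] [Fintype m] [Unique m]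
    [DecidableEq m] [Fintype k] [DecidableEq k] (A : Matrix m m R) (B : Matrix m k R)
    (C : Matrix k m R) {E : Matrix k k R} (hE : E.det ≠ 0) :
    (Matrix.fromBlocks A B C E).det =
      E.det * A default default - (B * E.adjugate * C) default default := by
  refine mul_right_cancel₀ hE ?_
  have h1 : Matrix.fromBlocks A B C E *
      Matrix.fromBlocks (E.det • (1 : Matrix m m R)) 0 (-(E.adjugate * C)) 1 =
      Matrix.fromBlocks (E.det • A - B * E.adjugate * C) B 0 E := by
    rw [Matrix.fromBlocks_multiply]
    congr 1
    · simp [Matrix.mul_assoc, sub_eq_add_neg]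
    · simp
    · rw [Matrix.mul_neg, ← Matrix.mul_assoc, Matrix.mul_adjugate]
      simp
    · simp
  have h2 := congrArg Matrix.det h1
  rw [Matrix.det_mul, Matrix.det_fromBlocks_zero₁₂, Matrix.det_fromBlocks_zero₂₁] at h2
  rw [Matrix.det_one, mul_one, Matrix.det_unique (E.det • (1 : Matrix m m R)),
    Matrix.det_unique (_ - _)] at h2
  simpa using h2

theorem det_eq_of_unique_subtype {R : Type*} [CommRing R] [IsDomain R]
    (T : Matrix (Fin n) (Fin n) R) (p : Fin n → Prop) [DecidablePred p] [Unique {i // p i}]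
    (hE : (T.toBlock (fun i => ¬ p i) (fun i => ¬ p i)).det ≠ 0) :
    T.det = (T.toBlock (fun i => ¬ p i) (fun i => ¬ p i)).det * T.toBlock p p default default -
      (T.toBlock p (fun i => ¬ p i) * (T.toBlock (fun i => ¬ p i) (fun i => ¬ p i)).adjugate *
        T.toBlock (fun i => ¬ p i) p) default default := by
  rw [Matrix.det_toBlock T p]
  exact det_fromBlocks_unique _ _ _ hE

theorem det_eq_of_distinguished_index {R : Type*} [CommRing R] [IsDomain R]
    (T : Matrix (Fin n) (Fin n) R) (i₀ : Fin n)
    (hE : (T.toBlock (fun i => ¬ i = i₀) (fun i => ¬ i = i₀)).det ≠ 0) :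
    T.det = (T.toBlock (fun i => ¬ i = i₀) (fun i => ¬ i = i₀)).det * T i₀ i₀ -
      (T.toBlock (fun i => i = i₀) (fun i => ¬ i = i₀) *
        (T.toBlock (fun i => ¬ i = i₀) (fun i => ¬ i = i₀)).adjugate *
        T.toBlock (fun i => ¬ i = i₀) (fun i => i = i₀)) ⟨i₀, rfl⟩ ⟨i₀, rfl⟩ := by
  let _ : Unique {i // i = i₀} := ⟨⟨⟨i₀, rfl⟩⟩, fun a => Subtype.ext a.2⟩
  exact det_eq_of_unique_subtype T (fun i => i = i₀) hE

/-- The matrix `x M₀ + y M₁ + t`. -/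
noncomputable def pencilPoly (M₀ M₁ : Matrix (Fin n) (Fin n) ℂ) : Matrix (Fin n) (Fin n) Poly :=
  (MvPolynomial.X 0 : Poly) • M₀.map MvPolynomial.C +
    (MvPolynomial.X 1 : Poly) • M₁.map MvPolynomial.C
    + (MvPolynomial.X 2 : Poly) • (1 : Matrix (Fin n) (Fin n) Poly)

theorem map_eval_pencilPoly (M₀ M₁ : Matrix (Fin n) (Fin n) ℂ) (p : Fin 3 → ℂ) :
    (pencilPoly M₀ M₁).map (MvPolynomial.eval p) =
      p 0 • M₀ + p 1 • M₁ + p 2 • (1 : Matrix (Fin n) (Fin n) ℂ) := by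
  ext i j
  by_cases h : i = j <;> simp [pencilPoly, h]

theorem eval_det_pencilPoly (M₀ M₁ : Matrix (Fin n) (Fin n) ℂ) (p : Fin 3 → ℂ) :
    MvPolynomial.eval p (pencilPoly M₀ M₁).det =
      (p 0 • M₀ + p 1 • M₁ + p 2 • (1 : Matrix (Fin n) (Fin n) ℂ)).det := by
  rw [← map_eval_pencilPoly, RingHom.map_det]
  rfl

/-- Split off the index i₀, whose diagonal entry is t and whose row and column are otherwise
divisible by y. At (1:0:0) the value of β is a nonzero multiple of Σ |N_{j i₀}|²/d_j. Its
nonvanishing uses that the remaining d_j are all negative, so no cancellation can occur. -/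
theorem exists_block_formula_diagonal (d : Fin n → ℝ) (hd : ∀ i, d i ≤ 0)
    {N : Matrix (Fin n) (Fin n) ℂ} (hN : N.IsHermitian) (i₀ : Fin n) (h0 : d i₀ = 0)
    (hne : ∀ i, i ≠ i₀ → d i ≠ 0) (hN0 : N i₀ i₀ = 0) {k : Fin n} (hk : N k i₀ ≠ 0) :
    ∃ α β : Poly, (pencilPoly (Matrix.diagonal fun i => (d i : ℂ)) N).det =
        MvPolynomial.X 2 * α - MvPolynomial.X 1 ^ 2 * β ∧
      MvPolynomial.eval ![1, 0, 0] α ≠ 0 ∧ MvPolynomial.eval ![1, 0, 0] β ≠ 0 := by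
  obtain ⟨T, hT⟩ : ∃ T, T = pencilPoly (Matrix.diagonal fun i => (d i : ℂ)) N := ⟨_, rfl⟩
  obtain ⟨E, hEdef⟩ : ∃ E, E = T.toBlock (fun i => ¬ i = i₀) (fun i => ¬ i = i₀) := ⟨_, rfl⟩
  obtain ⟨B, hBdef⟩ : ∃ B : Matrix {i // i = i₀} {i // ¬ i = i₀} Poly,
    B = (N.toBlock _ _).map MvPolynomial.C := ⟨_, rfl⟩
  obtain ⟨C, hCdef⟩ : ∃ C : Matrix {i // ¬ i = i₀} {i // i = i₀} Poly,
    C = (N.toBlock _ _).map MvPolynomial.C := ⟨_, rfl⟩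
  have hB : T.toBlock (fun i => i = i₀) (fun i => ¬ i = i₀) = (MvPolynomial.X 1 : Poly) • B := by
    ext1 i j
    have hij : (i : Fin n) ≠ j := fun h => j.2 (h ▸ i.2)
    simp [hT, hBdef, pencilPoly, Matrix.toBlock_apply, hij]
  have hC : T.toBlock (fun i => ¬ i = i₀) (fun i => i = i₀) = (MvPolynomial.X 1 : Poly) • C := by
    ext1 i j
    have hij : (i : Fin n) ≠ j := fun h => i.2 (h ▸ j.2)
    simp [hT, hCdef, pencilPoly, Matrix.toBlock_apply, hij]
  have hA : T i₀ i₀ = MvPolynomial.X 2 := by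
    simp [hT, pencilPoly, h0, hN0]
  obtain ⟨e, he⟩ : ∃ e : Poly →+* ℂ, e = MvPolynomial.eval ![1, 0, 0] := ⟨_, rfl⟩
  have hEe : E.map e = Matrix.diagonal fun i : {i // ¬ i = i₀} => (d i : ℂ) := by
    ext i j
    rw [Matrix.map_apply, hEdef, Matrix.toBlock_apply, hT, he]
    by_cases hij : i = j
    · subst hij; simp [pencilPoly]
    · have : (i : Fin n) ≠ j := fun h => hij (Subtype.ext h)
      simp [pencilPoly, this, hij]
  have hdq : ∀ i : {i // ¬ i = i₀}, (d i : ℂ) ≠ 0 := fun i =>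
    Complex.ofReal_ne_zero.mpr (hne i i.2)
  have hdet : e E.det = ∏ i : {i // ¬ i = i₀}, (d i : ℂ) := by
    rw [RingHom.map_det, RingHom.mapMatrix_apply, hEe, Matrix.det_diagonal]
  have hdet0 : e E.det ≠ 0 := by
    rw [hdet]
    exact Finset.prod_ne_zero_iff.mpr fun i _ => hdq i
  have hE : E.det ≠ 0 := fun h => hdet0 (by rw [h, map_zero])
  refine ⟨E.det, (B * E.adjugate * C) ⟨i₀, rfl⟩ ⟨i₀, rfl⟩, ?_, by rw [← he]; exact hdet0, ?_⟩
  · rw [← hT, det_eq_of_distinguished_index T i₀ (hEdef ▸ hE), hA, hB, hC, ← hEdef]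
    simp only [Matrix.smul_mul, Matrix.mul_smul, Matrix.smul_apply, smul_eq_mul]
    ring
  · rw [← he]
    have hadj : E.adjugate.map e =
        (e E.det) • Matrix.diagonal fun i : {i // ¬ i = i₀} => ((d i)⁻¹ : ℂ) := by
      have h1 := RingHom.map_adjugate e E
      rw [RingHom.mapMatrix_apply, RingHom.mapMatrix_apply] at h1
      rw [h1, hEe, Matrix.adjugate_diagonal, hdet, ← Matrix.diagonal_smul]
      congr 1
      ext i
      rw [Pi.smul_apply, smul_eq_mul, ← Finset.mul_prod_erase _ _ (Finset.mem_univ i),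
        mul_comm, ← mul_assoc, inv_mul_cancel₀ (hdq i), one_mul]
    have hval : e ((B * E.adjugate * C) ⟨i₀, rfl⟩ ⟨i₀, rfl⟩) =
        e E.det * ∑ j : {i // ¬ i = i₀}, N i₀ j * (d j : ℂ)⁻¹ * N j i₀ := by
      have hBe : B.map e = N.toBlock _ _ := by
        ext; simp [hBdef, he]
      have hCe : C.map e = N.toBlock _ _ := by
        ext; simp [hCdef, he]
      have h2 : (B * E.adjugate * C).map e = B.map e * E.adjugate.map e * C.map e := by
        rw [Matrix.map_mul, Matrix.map_mul]
      rw [← Matrix.map_apply (f := e), h2, hBe, hCe, hadj]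
      rw [Matrix.mul_smul, Matrix.smul_mul, Matrix.smul_apply, smul_eq_mul, Matrix.mul_apply]
      simp [Matrix.mul_diagonal, Matrix.toBlock_apply]
    rw [hval]
    refine mul_ne_zero hdet0 ?_
    have hterm : ∀ j : {i // ¬ i = i₀}, N i₀ j * (d j : ℂ)⁻¹ * N j i₀ =
        ((‖N j i₀‖ ^ 2 * (d j)⁻¹ : ℝ) : ℂ) := by
      intro j
      have h1 : N i₀ j = star (N j i₀) := (hN.apply i₀ j).symm
      have h2 : star (N j i₀) * N j i₀ = ((‖N j i₀‖ ^ 2 : ℝ) : ℂ) := by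
        rw [mul_comm]
        simpa using Complex.mul_conj' (N j i₀)
      rw [h1, Complex.ofReal_mul, ← h2, Complex.ofReal_inv]
      ring
    rw [Finset.sum_congr rfl fun j _ => hterm j, ← Complex.ofReal_sum]
    refine Complex.ofReal_ne_zero.mpr (ne_of_lt ?_)
    have hki : ¬ k = i₀ := fun h => hk (by rw [h, hN0])
    refine Finset.sum_neg' (fun j _ => ?_) ⟨⟨k, hki⟩, Finset.mem_univ _, ?_⟩
    · exact mul_nonpos_of_nonneg_of_nonpos (by positivity) (inv_nonpos.mpr (hd j))
    · exact mul_neg_of_pos_of_neg (by positivity)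
        (inv_lt_zero.mpr (lt_of_le_of_ne (hd k) (hne k hki)))

open scoped ComplexOrder in
theorem exists_unitary_diagonalization {M : Matrix (Fin n) (Fin n) ℂ} (h : (-M).PosSemidef) :
    ∃ (U : Matrix (Fin n) (Fin n) ℂ) (d : Fin n → ℝ), U * star U = 1 ∧ star U * U = 1 ∧
      (∀ i, d i ≤ 0) ∧ M = U * (Matrix.diagonal fun i => (d i : ℂ)) * star U := by
  have hH := h.isHermitian
  refine ⟨hH.eigenvectorUnitary, fun i => -hH.eigenvalues i,
    Unitary.coe_mul_star_self hH.eigenvectorUnitary,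
    Unitary.coe_star_mul_self hH.eigenvectorUnitary,
    fun i => neg_nonpos.mpr (h.eigenvalues_nonneg i), ?_⟩
  have h1 := hH.spectral_theorem
  rw [Unitary.conjStarAlgAut_apply] at h1
  have h2 : (Matrix.diagonal fun i => ((-hH.eigenvalues i : ℝ) : ℂ)) =
      -Matrix.diagonal (RCLike.ofReal ∘ hH.eigenvalues) := by
    rw [Matrix.diagonal_neg]
    congr 1
    ext i
    exact Complex.ofReal_neg _
  rw [h2, Matrix.mul_neg, Matrix.neg_mul, ← neg_eq_iff_eq_neg]
  exact h1

open scoped ComplexOrder in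
/-- The determinant of a Hermitian pencil `x M₀ + y M₁ + t` where `M₀ ≤ 0` has a one-dimensional
kernel, spanned by `v`, to second order near `(1 : 0 : 0)`. -/
theorem exists_block_formula {M₀ M₁ : Matrix (Fin n) (Fin n) ℂ} (h₀ : (-M₀).PosSemidef)
    (h₁ : M₁.IsHermitian) {v : Fin n → ℂ} (hv : v ≠ 0) (hM₀v : M₀ *ᵥ v = 0)
    (hker : ∀ w, M₀ *ᵥ w = 0 → ∃ ζ : ℂ, w = ζ • v) (hv₁ : star v ⬝ᵥ M₁ *ᵥ v = 0)
    (hM₁v : M₁ *ᵥ v ≠ 0) :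
    ∃ α β : Poly, (∀ p : Fin 3 → ℂ,
        (p 0 • M₀ + p 1 • M₁ + p 2 • (1 : Matrix (Fin n) (Fin n) ℂ)).det =
        p 2 * MvPolynomial.eval p α - p 1 ^ 2 * MvPolynomial.eval p β) ∧
      MvPolynomial.eval ![1, 0, 0] α ≠ 0 ∧ MvPolynomial.eval ![1, 0, 0] β ≠ 0 := by
  classical
  obtain ⟨U, d, hUU, hUU', hd, hM₀⟩ := exists_unitary_diagonalization h₀
  obtain ⟨D, hD⟩ : ∃ D : Matrix (Fin n) (Fin n) ℂ, D = Matrix.diagonal fun i => (d i : ℂ) :=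
    ⟨_, rfl⟩
  rw [← hD] at hM₀
  let N := star U * M₁ * U
  have hM₁ : M₁ = U * N * star U := by
    simp only [N, Matrix.mul_assoc, hUU, Matrix.mul_one]
    rw [← Matrix.mul_assoc, hUU, Matrix.one_mul]
  have hNh : N.IsHermitian := by
    simp only [N, Matrix.IsHermitian, Matrix.star_eq_conjTranspose, Matrix.conjTranspose_mul,
      Matrix.conjTranspose_conjTranspose, h₁.eq, Matrix.mul_assoc]
  have hUinj : ∀ w, U *ᵥ w = 0 → w = 0 := fun w hw => by
    have := congrArg (fun z => star U *ᵥ z) hw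
    simpa [Matrix.mulVec_mulVec, hUU'] using this
  have hDker : ∀ i, d i = 0 → ∃ ζ : ℂ, U *ᵥ (Pi.single i 1) = ζ • v := by
    intro i hi
    refine hker _ ?_
    rw [hM₀, Matrix.mulVec_mulVec, Matrix.mul_assoc, hUU', Matrix.mul_one, ← Matrix.mulVec_mulVec]
    have : D *ᵥ Pi.single i 1 = 0 := by
      ext j
      by_cases hij : i = j
      · subst hij; simp [hD, Matrix.mulVec_diagonal, hi]
      · simp [hD, Matrix.mulVec_diagonal, Ne.symm hij]
    rw [this, Matrix.mulVec_zero]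
  let v' := star U *ᵥ v
  have hvv' : U *ᵥ v' = v := by simp [v', Matrix.mulVec_mulVec, hUU]
  have hDv' : D *ᵥ v' = 0 := by
    refine hUinj _ ?_
    rw [← hM₀v, hM₀]
    simp [v', Matrix.mulVec_mulVec, Matrix.mul_assoc]
  have hv'0 : v' ≠ 0 := fun h => hv (by rw [← hvv', h, Matrix.mulVec_zero])
  obtain ⟨i₀, hi₀⟩ := Function.ne_iff.mp hv'0
  have hd0 : d i₀ = 0 := by
    have := congrFun hDv' i₀
    simp only [hD, Matrix.mulVec_diagonal, Pi.zero_apply, mul_eq_zero] at this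
    exact Complex.ofReal_eq_zero.mp (this.resolve_right hi₀)
  obtain ⟨ζ, hζ⟩ := hDker i₀ hd0
  have hsingle : ∀ (i : Fin n) (ξ : ℂ), U *ᵥ (Pi.single i 1) = ξ • v → Pi.single i 1 = ξ • v' := by
    intro i ξ h
    have := congrArg (fun z => star U *ᵥ z) h
    simpa only [Matrix.mulVec_mulVec, hUU', Matrix.mulVec_smul, Matrix.one_mulVec] using this
  have hne : ∀ i, i ≠ i₀ → d i ≠ 0 := by
    intro i hi hdi
    obtain ⟨ξ, hξ⟩ := hDker i hdi
    have h1 := hsingle i ξ hξ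
    have h2 := congrFun h1 i₀
    simp only [Pi.single_apply, Ne.symm hi, if_false, Pi.smul_apply, smul_eq_mul] at h2
    have h3 : ξ = 0 := (mul_eq_zero.mp h2.symm).resolve_right hi₀
    have h4 := congrFun h1 i
    simp [h3] at h4
  have hNcol : ∀ i j, N i j = star (U *ᵥ Pi.single i 1) ⬝ᵥ M₁ *ᵥ (U *ᵥ Pi.single j 1) := by
    intro i j
    rw [Matrix.star_mulVec, ← Matrix.dotProduct_mulVec, Matrix.mulVec_mulVec, Matrix.mulVec_mulVec,
      Pi.star_single, star_one]
    simp [N, Matrix.star_eq_conjTranspose]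
  have hN0 : N i₀ i₀ = 0 := by
    rw [hNcol, hζ, Matrix.mulVec_smul, dotProduct_smul, star_smul, smul_dotProduct, hv₁]
    simp
  have hζ0 : ζ ≠ 0 := by
    rintro rfl
    have := congrFun (hsingle i₀ 0 hζ) i₀
    simp at this
  obtain ⟨k, hk⟩ : ∃ k, N k i₀ ≠ 0 := by
    by_contra! hall
    apply hM₁v
    have h1 : N *ᵥ Pi.single i₀ 1 = 0 := by
      ext k
      simp [hall k]
    have h2 : M₁ *ᵥ (U *ᵥ Pi.single i₀ 1) = 0 := by
      conv_lhs => rw [hM₁]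
      rw [Matrix.mulVec_mulVec, Matrix.mul_assoc, hUU', Matrix.mul_one, ← Matrix.mulVec_mulVec, h1,
        Matrix.mulVec_zero]
    rw [hζ, Matrix.mulVec_smul] at h2
    exact (smul_eq_zero.mp h2).resolve_left hζ0
  obtain ⟨α, β, hαβ, hα, hβ⟩ := exists_block_formula_diagonal d hd hNh i₀ hd0 hne hN0 hk
  refine ⟨α, β, fun p => ?_, hα, hβ⟩
  have h1 := congrArg (MvPolynomial.eval p) hαβ
  rw [eval_det_pencilPoly] at h1
  simp only [map_sub, map_mul, map_pow, MvPolynomial.eval_X] at h1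
  rw [← h1, ← hD, ← Matrix.det_conj_of_mul_eq_one hUU hUU' (N := p 0 • D + _ + _)]
  congr 1
  conv_lhs => rw [hM₀, hM₁]
  simp only [Matrix.mul_add, Matrix.add_mul, Matrix.mul_smul, Matrix.smul_mul, Matrix.mul_one, hUU]

/-! ### Simple pencils -/

open scoped ComplexOrder in
/-- A pair of Hermitian matrices such that `M₀ ≤ 0` has the one-dimensional kernel spanned by `v`,
and `v` is isotropic for `M₁`, but not in its kernel. -/
structure IsSimplePencil (M₀ M₁ : Matrix (Fin n) (Fin n) ℂ) (v : Fin n → ℂ) : Prop where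
  posSemidef : (-M₀).PosSemidef
  isHermitian : M₁.IsHermitian
  ne_zero : v ≠ 0
  mulVec_eq_zero : M₀ *ᵥ v = 0
  ker : ∀ w, M₀ *ᵥ w = 0 → ∃ ζ : ℂ, w = ζ • v
  isotropic : star v ⬝ᵥ M₁ *ᵥ v = 0
  mulVec_ne_zero : M₁ *ᵥ v ≠ 0

namespace IsSimplePencil
variable {M₀ M₁ : Matrix (Fin n) (Fin n) ℂ} {v : Fin n → ℂ}

open scoped ComplexOrder in
theorem isHermitian₀ (h : IsSimplePencil M₀ M₁ v) : M₀.IsHermitian := by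
  simpa using h.posSemidef.isHermitian.neg

open scoped ComplexOrder in
-- An isotropic vector of a semidefinite form lies in its kernel, so u would be a multiple of v and
-- M₁v = −tv; isotropy of v gives t = 0, contradicting M₁v ≠ 0.
theorem dotProduct_ne_zero (h : IsSimplePencil M₀ M₁ v) {x t : ℂ} {u : Fin n → ℂ} (hu : u ≠ 0)
    (hxt : (M₁ + x • M₀) *ᵥ u + t • u = 0) : star u ⬝ᵥ M₀ *ᵥ u ≠ 0 := by
  intro h0
  have h1 : M₀ *ᵥ u = 0 := by
    have := (h.posSemidef.dotProduct_mulVec_zero_iff u).mp (by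
      rw [Matrix.neg_mulVec, dotProduct_neg, h0, neg_zero])
    rwa [Matrix.neg_mulVec, neg_eq_zero] at this
  obtain ⟨ζ, rfl⟩ := h.ker u h1
  have hζ : ζ ≠ 0 := fun hζ => hu (by rw [hζ, zero_smul])
  have h2 : M₁ *ᵥ v + t • v = 0 := by
    have h3 : ζ • (M₁ *ᵥ v + t • v) = 0 := by
      rw [← hxt, Matrix.add_mulVec, Matrix.smul_mulVec, h1, Matrix.mulVec_smul]
      module
    exact (smul_eq_zero.mp h3).resolve_left hζ
  have h4 := congrArg (fun w => star v ⬝ᵥ w) h2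
  simp only [dotProduct_add, dotProduct_smul, h.isotropic, dotProduct_zero, zero_add,
    smul_eq_mul] at h4
  have ht : t = 0 := (mul_eq_zero.mp h4).resolve_right (star_dotProduct_self_ne_zero h.ne_zero)
  rw [ht, zero_smul, add_zero] at h2
  exact h.mulVec_ne_zero h2

theorem star_dotProduct_real {M : Matrix (Fin n) (Fin n) ℂ} (hM : M.IsHermitian)
    (u : Fin n → ℂ) : ∃ r : ℝ, star u ⬝ᵥ M *ᵥ u = r := by
  have h1 : star (star u ⬝ᵥ M *ᵥ u) = star u ⬝ᵥ M *ᵥ u := by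
    rw [← Matrix.star_dotProduct, ← dotProduct_mulVec_comm_of_isHermitian hM]
  exact ⟨_, (Complex.conj_eq_iff_re.mp h1).symm⟩

/-- The line `t = 0` meets the curve `det (x M₀ + y M₁ + t) = 0` in real points only. -/
theorem exists_real_of_det_eq_zero (h : IsSimplePencil M₀ M₁ v) {y : ℂ} (hy : y ≠ 0)
    (hdet : (M₀ + y • M₁).det = 0) : ∃ x : ℝ, y⁻¹ = x := by
  obtain ⟨w, hw, hMw⟩ := Matrix.exists_mulVec_eq_zero_iff.mpr hdet
  have h1 : (M₁ + y⁻¹ • M₀) *ᵥ w + (0 : ℂ) • w = 0 := by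
    have : M₁ + y⁻¹ • M₀ = y⁻¹ • (M₀ + y • M₁) := by
      rw [smul_add, smul_smul, inv_mul_cancel₀ hy, one_smul, add_comm]
    rw [this, Matrix.smul_mulVec, hMw, smul_zero, zero_smul, add_zero]
  have h2 := h.dotProduct_ne_zero hw h1
  obtain ⟨r₀, hr₀⟩ := star_dotProduct_real h.isHermitian₀ w
  obtain ⟨r₁, hr₁⟩ := star_dotProduct_real h.isHermitian w
  have h3 := congrArg (fun u => star w ⬝ᵥ u) h1
  simp only [Matrix.add_mulVec, Matrix.smul_mulVec, dotProduct_add, dotProduct_smul,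
    dotProduct_zero, zero_smul, smul_eq_mul, hr₀, hr₁, add_zero] at h3
  rw [hr₀] at h2
  refine ⟨-r₁ / r₀, ?_⟩
  push_cast
  rw [eq_div_iff h2]
  linear_combination h3

end IsSimplePencil

/-! ### Elimination of the point of tangency -/

/-- Evaluation of polynomials in three variables. -/
noncomputable def evalTriple (τ : ℂ × ℂ × ℂ) : ℂ[X][Y][X] →+* ℂ :=
  eval₂RingHom (evalEvalRingHom τ.1 τ.2.1) τ.2.2

theorem evalTriple_eq (τ : ℂ × ℂ × ℂ) (q : ℂ[X][Y][X]) :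
    evalTriple τ q = eval₂ (evalEvalRingHom τ.1 τ.2.1) τ.2.2 q := rfl

theorem eval₂_det {R S : Type*} [CommRing R] [CommRing S] (φ : R →+* S) (y : S)
    (M : Matrix (Fin n) (Fin n) R[X]) : eval₂ φ y M.det = (M.map (eval₂ φ y)).det :=
  RingHom.map_det (eval₂RingHom φ y) M

theorem evalTriple_X (τ : ℂ × ℂ × ℂ) : evalTriple τ X = τ.2.2 := by
  simp [evalTriple]

theorem eval_map_evalEvalRingHom (a b y : ℂ) (q : ℂ[X][Y][X]) :
    (q.map (evalEvalRingHom a b)).eval y = evalTriple (a, b, y) q := by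
  rw [eval_map]; rfl

/-- `det ((M₀ - a) + y (M₁ - b))` as a polynomial in `a`, `b`, `y`. -/
noncomputable def linePoly (M₀ M₁ : Matrix (Fin n) (Fin n) ℂ) : ℂ[X][Y][X] :=
  Matrix.det ((X : ℂ[X][Y][X]) •
      (M₁.map (fun c => (C (C c) : ℂ[X][Y])) - (X : ℂ[X][Y]) • 1).map C
    + (M₀.map (fun c => (C (C c) : ℂ[X][Y])) - (C X : ℂ[X][Y]) • 1).map C)

theorem evalTriple_linePoly (M₀ M₁ : Matrix (Fin n) (Fin n) ℂ) (a b y : ℂ) :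
    evalTriple (a, b, y) (linePoly M₀ M₁) = ((M₀ - a • (1 : Matrix (Fin n) (Fin n) ℂ))
      + y • (M₁ - b • (1 : Matrix (Fin n) (Fin n) ℂ))).det := by
  rw [evalTriple_eq, linePoly, eval₂_det]
  congr 1
  ext i j
  rw [Matrix.map_apply, Matrix.add_apply, Matrix.smul_apply, smul_eq_mul, Matrix.map_apply,
    Matrix.map_apply, eval₂_add, eval₂_mul, eval₂_X, eval₂_C, eval₂_C]
  by_cases hij : i = j
  · subst hij
    simp
    ring
  · simp [hij, add_comm]

theorem evalEval_coeff_linePoly (M₀ M₁ : Matrix (Fin n) (Fin n) ℂ) :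
    ((linePoly M₀ M₁).coeff n).evalEval 0 0 = M₁.det := by
  have h := coeff_det_X_add_C_card (M₁.map (fun c => (C (C c) : ℂ[X][Y])) - (X : ℂ[X][Y]) • 1)
    (M₀.map (fun c => (C (C c) : ℂ[X][Y])) - (C X : ℂ[X][Y]) • 1)
  rw [Fintype.card_fin] at h
  rw [linePoly, h, ← coe_evalEvalRingHom, RingHom.map_det]
  congr 1
  ext i j
  by_cases hij : i = j
  · subst hij
    simp
  · simp [hij]

theorem natDegree_linePoly_le (M₀ M₁ : Matrix (Fin n) (Fin n) ℂ) :
    (linePoly M₀ M₁).natDegree ≤ n := by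
  refine (natDegree_det_X_add_C_le (M₁.map (fun c => (C (C c) : ℂ[X][Y])) - (X : ℂ[X][Y]) • 1)
    (M₀.map (fun c => (C (C c) : ℂ[X][Y])) - (C X : ℂ[X][Y]) • 1)).trans ?_
  rw [Fintype.card_fin]

/-- A polynomial with at most a simple zero at the origin and no other zero divides `X`. -/
theorem dvd_X_of_roots {g : ℂ[X]} (hg : g ≠ 0) (hroot : ∀ y, y ≠ 0 → g.eval y ≠ 0)
    (h2 : ¬ X ^ 2 ∣ g) : g ∣ X := by
  obtain ⟨h, hh, hnd⟩ := exists_eq_pow_rootMultiplicity_mul_and_not_dvd g hg 0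
  rw [C_0, sub_zero] at hh hnd
  have hdeg : h.degree = 0 := by
    by_contra hd
    obtain ⟨y, hy⟩ := IsAlgClosed.exists_root h hd
    by_cases hy0 : y = 0
    · subst hy0
      exact hnd (by simpa using dvd_iff_isRoot.mpr hy)
    · refine hroot y hy0 ?_
      rw [hh, eval_mul, hy, mul_zero]
  obtain ⟨c, hc⟩ := isUnit_iff_degree_eq_zero.mpr hdeg
  have hm : g.rootMultiplicity 0 ≤ 1 := by
    by_contra! hm
    exact h2 (hh ▸ (pow_dvd_pow X hm).mul_right h)
  rw [hh, ← hc]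
  exact (Units.mul_right_dvd).mpr (by simpa using pow_dvd_pow (X : ℂ[X]) hm)

/-- A triple (a, b, y) stands for the line ax + by + t = 0 tangent at (1 : y : −(a + by)). The
polynomials vanishing on T, specialized at a = b = 0, have y = 0 as their only common zero, and it
is simple. So y is a rational function of (a, b) near the origin and can be eliminated.
Invertibility of M₁ keeps the degree in y from dropping at the origin, as Nakayama's lemma requires.
-/
theorem IsSimplePencil.exists_dual_equation {M₀ M₁ : Matrix (Fin n) (Fin n) ℂ} {v : Fin n → ℂ}
    (h : IsSimplePencil M₀ M₁ v) (hdet : M₁.det ≠ 0) (T : Set (ℂ × ℂ × ℂ))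
    (hT0 : ∀ a b y, (a, b, y) ∈ T → ((M₀ - a • (1 : Matrix (Fin n) (Fin n) ℂ))
      + y • (M₁ - b • (1 : Matrix (Fin n) (Fin n) ℂ))).det = 0)
    (hT1 : ∀ a b y, (a, b, y) ∈ T → HasDerivAt (fun s : ℂ =>
      ((M₀ - a • (1 : Matrix (Fin n) (Fin n) ℂ))
      + s • (M₁ - b • (1 : Matrix (Fin n) (Fin n) ℂ))).det) 0 y)
    (hT2 : ∀ f fx : ℂ[X][Y], (∀ x t : ℂ, HasStrictFDerivAt (fun q : ℂ × ℂ => f.evalEval q.1 q.2)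
        (fx.evalEval x t • ContinuousLinearMap.fst ℂ ℂ ℂ +
          (derivative f).evalEval x t • ContinuousLinearMap.snd ℂ ℂ ℂ) (x, t)) →
      (∀ x t : ℂ, (M₁ + x • M₀ + t • (1 : Matrix (Fin n) (Fin n) ℂ)).det = 0 →
        f.evalEval x t = 0) → ∀ a b y, (a, b, y) ∈ T → y ≠ 0 →
      ∃ t : ℂ, (M₁ + y⁻¹ • M₀ + t • (1 : Matrix (Fin n) (Fin n) ℂ)).det = 0 ∧
        a * (derivative f).evalEval y⁻¹ t = fx.evalEval y⁻¹ t)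
    (hT3 : ∀ a b y, (a, b, y) ∈ T → y ≠ 0 → (M₀ + y • M₁).det ≠ 0) (h000 : (0, 0, 0) ∈ T) :
    ∃ G : ℂ[X][Y], (∀ a b y, (a, b, y) ∈ T → G.evalEval a b = 0) ∧
      ∃ δ : ℂ, δ ≠ 0 ∧ HasDerivAt (fun s => G.evalEval s 0) δ 0 := by
  obtain ⟨α, β, hαβ, hα, hβ⟩ := exists_block_formula h.posSemidef h.isHermitian h.ne_zero
    h.mulVec_eq_zero h.ker h.isotropic h.mulVec_ne_zero
  let J : Ideal ℂ[X][Y][X] := ⨅ τ ∈ T, RingHom.ker (evalTriple τ)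
  have hJ : ∀ q, q ∈ J ↔ ∀ τ ∈ T, evalTriple τ q = 0 := by
    intro q
    simp only [J, Submodule.mem_iInf, RingHom.mem_ker]
  let ε := evalEvalRingHom (0 : ℂ) 0
  let m : Ideal ℂ[X][Y] := RingHom.ker ε
  have hε : Function.Surjective (mapRingHom ε) := map_surjective ε (evalEval_surjective 0 0)
  let Φ := linePoly M₀ M₁
  have hΦJ : Φ ∈ J := (hJ _).mpr fun ⟨a, b, y⟩ hτ => by
    rw [evalTriple_linePoly]; exact hT0 a b y hτ
  have hΦ'J : derivative Φ ∈ J := (hJ _).mpr fun ⟨a, b, y⟩ hτ => by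
    rw [← eval_map_evalEvalRingHom, ← derivative_map]
    refine (Polynomial.hasDerivAt _ y).unique ?_
    refine (hT1 a b y hτ).congr_of_eventuallyEq (Eventually.of_forall fun s => ?_)
    simp only [eval_map_evalEvalRingHom]
    exact evalTriple_linePoly M₀ M₁ a b s
  let J₀ : Ideal ℂ[X] := J.map (mapRingHom ε)
  -- The generator g of the specialized ideal divides X: a nonzero root is excluded by the slope
  -- polynomial at that root, and a double root at 0 by the derivative of Φ, which vanishes on T
  -- because tangency is a double root.
  have hXJ₀ : (X : ℂ[X]) ∈ J₀ := by
    obtain ⟨g, hg⟩ := (IsPrincipalIdealRing.principal J₀).principal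
    have hmem : ∀ q, q ∈ J → g ∣ q.map ε := by
      intro q hq
      have : q.map ε ∈ J₀ := Ideal.mem_map_of_mem (mapRingHom ε) hq
      rw [hg] at this
      exact Ideal.mem_span_singleton.mp this
    -- The restriction of β to the line t = 0.
    let b : ℂ[X] := MvPolynomial.aeval ![(1 : ℂ[X]), X, 0] β
    have hb : ∀ y, b.eval y = MvPolynomial.eval ![1, y, 0] β := by
      intro y
      rw [← coe_evalRingHom]
      simp only [b, MvPolynomial.aeval_def, MvPolynomial.eval, MvPolynomial.coe_eval₂Hom]
      rw [MvPolynomial.hom_eval₂]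
      congr 1
      · ext; simp
      · ext i; fin_cases i <;> simp
    have hΦ₀ : Φ.map ε = -(X ^ 2 * b) := by
      refine Polynomial.funext fun y => ?_
      have h1 := hαβ ![1, y, 0]
      rw [eval_map_evalEvalRingHom, evalTriple_linePoly]
      simp only [Matrix.cons_val_zero, Matrix.cons_val_one, one_smul, Matrix.cons_val, zero_smul,
        add_zero, zero_mul, zero_sub] at h1
      simp only [zero_smul, sub_zero, h1, eval_neg, eval_mul, eval_pow, eval_X, hb]
    have hb0 : b.eval 0 ≠ 0 := by rw [hb]; exact hβ
    have hg0 : g ≠ 0 := by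
      rintro rfl
      have h1 := zero_dvd_iff.mp (hmem _ hΦJ)
      rw [hΦ₀, neg_eq_zero, mul_eq_zero] at h1
      rcases h1 with h1 | h1
      · exact pow_ne_zero 2 X_ne_zero h1
      · exact hb0 (by rw [h1, eval_zero])
    have hdvd : g ∣ X := by
      refine dvd_X_of_roots hg0 (fun y hy hgy => ?_) fun h2 => ?_
      · have hΦy : (M₀ + y • M₁).det = 0 := by
          obtain ⟨k, hk⟩ := hmem _ hΦJ
          have h1 := congrArg (eval y) hk
          rw [eval_mul, hgy, zero_mul] at h1
          rw [eval_map_evalEvalRingHom, evalTriple_linePoly] at h1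
          simpa using h1
        obtain ⟨x₀, hx₀⟩ := h.exists_real_of_det_eq_zero hy hΦy
        obtain ⟨f, fx, Ψ, hf1, hf2, hΨ, hΨ0⟩ := exists_slope_polynomial h.isHermitian₀
          h.isHermitian (fun x t u hu hxt => h.dotProduct_ne_zero hu hxt) x₀
        -- Ψ relates the abscissa x = 1/y in the chart y = 1 to the slope a. Swapping makes x the
        -- outer variable, reversal turns 1/y into y, and the factor X takes care of y = 0.
        let q : ℂ[X][Y][X] := X * ((Bivariate.swap Ψ).reverse).map C
        have hq : ∀ a b y : ℂ, evalTriple (a, b, y) q =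
            y * eval₂ (evalRingHom a) y (Bivariate.swap Ψ).reverse := by
          intro a b y
          rw [map_mul, evalTriple_X, evalTriple, coe_eval₂RingHom, eval₂_map]
          congr 2
          ext <;> simp
        have hswap : ∀ x σ : ℂ, eval₂ (evalRingHom σ) x (Bivariate.swap Ψ) = Ψ.evalEval x σ := by
          intro x σ
          rw [eval₂_evalRingHom, ← coe_aevalAeval_eq_evalEval, ← coe_aevalAeval_eq_evalEval]
          exact Bivariate.aevalAeval_swap σ x Ψ
        have hqJ : q ∈ J := (hJ _).mpr fun ⟨a, b, s⟩ hτ => by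
          rw [hq]
          by_cases hs : s = 0
          · rw [hs, zero_mul]
          · obtain ⟨t, ht, hat⟩ := hT2 f fx hf1 hf2 a b s hτ hs
            have hsx : s⁻¹ ≠ x₀ := by
              rw [← hx₀]
              intro hsy
              exact hT3 a b s hτ hs (inv_injective hsy ▸ hΦy)
            have h1 := hΨ _ t a hsx ht hat
            let _ : Invertible s⁻¹ := invertibleOfNonzero (inv_ne_zero hs)
            have h2 := (eval₂_reverse_eq_zero_iff (evalRingHom a) s⁻¹ (Bivariate.swap Ψ)).mpr
              (by rw [hswap]; exact h1)
            rw [invOf_eq_inv, inv_inv] at h2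
            rw [h2, mul_zero]
        obtain ⟨k, hk⟩ := hmem _ hqJ
        have h3 := congrArg (eval y) hk
        rw [eval_mul, hgy, zero_mul] at h3
        rw [eval_map_evalEvalRingHom, hq] at h3
        let _ : Invertible y⁻¹ := invertibleOfNonzero (inv_ne_zero hy)
        have h4 := (eval₂_reverse_eq_zero_iff (evalRingHom 0) y⁻¹ (Bivariate.swap Ψ)).mp (by
          rw [invOf_eq_inv, inv_inv]
          exact (mul_eq_zero.mp h3).resolve_left hy)
        rw [hswap, hx₀] at h4
        exact hΨ0 h4
      · have h3 := h2.trans (hmem _ hΦ'J)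
        rw [← derivative_map, hΦ₀] at h3
        have h4 : derivative (-(X ^ 2 * b)) = X * (-(C 2 * b + X * derivative b)) := by
          simp only [derivative_neg, derivative_mul, derivative_X_pow]
          push_cast
          simp
          ring
        rw [h4, pow_two] at h3
        have h5 := (mul_dvd_mul_iff_left X_ne_zero).mp h3
        rw [X_dvd_iff, coeff_zero_eq_eval_zero] at h5
        simp at h5
        exact hb0 h5
    rw [hg]
    exact Ideal.mem_span_singleton.mpr hdvd
  obtain ⟨g, hgJ, hgX⟩ := (Ideal.mem_map_iff_of_surjective _ hε).mp hXJ₀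
  -- Φ is rescaled by 1/det M₁ so that its coefficient of degree n equals 1 at the origin.
  obtain ⟨r, N, hr, hrN⟩ := exists_sub_one_mem_mul_X_sub_C_mem m J (n := n)
    (p := C (C (C M₁.det⁻¹)) * Φ) (J.mul_mem_left _ hΦJ)
    ((natDegree_C_mul_le _ _).trans (natDegree_linePoly_le M₀ M₁))
    (by
      rw [coeff_C_mul, RingHom.mem_ker, map_sub, map_mul, map_one]
      have h1 : ε (Φ.coeff n) = M₁.det := evalEval_coeff_linePoly M₀ M₁
      rw [h1]
      simp [ε, hdet]) hgJ
    (by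
      intro i
      rw [RingHom.mem_ker, coeff_sub, map_sub, ← coeff_map]
      have h1 : g.map ε = X := hgX
      rw [h1, coeff_X, coeff_X]
      split_ifs <;> simp)
  have hr0 : r.evalEval 0 0 = 1 := by
    have h1 := RingHom.mem_ker.mp hr
    rw [map_sub, map_one, sub_eq_zero] at h1
    exact h1
  have hrT : ∀ a b y, (a, b, y) ∈ T → N.evalEval a b = r.evalEval a b * y := by
    intro a b y hτ
    have h1 := (hJ _).mp hrN _ hτ
    rw [evalTriple_eq, eval₂_sub, eval₂_mul, eval₂_C, eval₂_C, eval₂_X, sub_eq_zero] at h1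
    exact h1.symm
  have hN0 : N.evalEval 0 0 = 0 := by rw [hrT 0 0 0 h000, mul_zero]
  -- The equation of the line section with y = N/r substituted and denominators cleared.
  let G : ℂ[X][Y] := Matrix.det
    (r • (M₀.map (fun c => (C (C c) : ℂ[X][Y])) - (C X : ℂ[X][Y]) • 1)
      + N • (M₁.map (fun c => (C (C c) : ℂ[X][Y])) - (X : ℂ[X][Y]) • 1))
  have hG : ∀ a b, G.evalEval a b =
      (r.evalEval a b • (M₀ - a • (1 : Matrix (Fin n) (Fin n) ℂ))
        + N.evalEval a b • (M₁ - b • (1 : Matrix (Fin n) (Fin n) ℂ))).det := by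
    intro a b
    simp only [G]
    rw [← coe_evalEvalRingHom, RingHom.map_det]
    congr 1
    ext i j
    by_cases hij : i = j
    · subst hij
      simp
    · simp [hij]
  refine ⟨G, fun a b y hτ => ?_, -MvPolynomial.eval ![1, 0, 0] α, neg_ne_zero.mpr hα, ?_⟩
  · rw [hG, hrT a b y hτ, mul_smul, ← smul_add, Matrix.det_smul, hT0 a b y hτ, mul_zero]
  · obtain ⟨rx, hrx⟩ := exists_hasStrictFDerivAt_evalEval r
    obtain ⟨Nx, hNx⟩ := exists_hasStrictFDerivAt_evalEval N
    have hs : HasDerivAt (fun s : ℂ => (s, (0 : ℂ))) (1, 0) 0 :=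
      (hasDerivAt_id (0 : ℂ)).prodMk (hasDerivAt_const _ _)
    have hrd : HasDerivAt (fun s : ℂ => r.evalEval s 0) (rx.evalEval 0 0) 0 := by
      refine (HasFDerivAt.comp_hasDerivAt (f := fun s : ℂ => (s, (0 : ℂ))) (0 : ℂ)
        (hrx 0 0).hasFDerivAt hs).congr_deriv ?_
      simp
    have hNd : HasDerivAt (fun s : ℂ => N.evalEval s 0) (Nx.evalEval 0 0) 0 := by
      refine (HasFDerivAt.comp_hasDerivAt (f := fun s : ℂ => (s, (0 : ℂ))) (0 : ℂ)
        (hNx 0 0).hasFDerivAt hs).congr_deriv ?_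
      simp
    -- G(s, 0) is the pencil determinant at γ(s). As N(0, 0) = 0, the term y²β contributes nothing
    -- to first order, and the derivative is −α.
    let γ : ℂ → Fin 3 → ℂ := fun s => ![r.evalEval s 0, N.evalEval s 0, -(s * r.evalEval s 0)]
    have hγ0 : γ 0 = ![1, 0, 0] := by simp [γ, hr0, hN0]
    have hγ : ∃ γ', HasDerivAt γ γ' 0 := by
      refine ⟨![rx.evalEval 0 0, Nx.evalEval 0 0,
        -(1 * r.evalEval 0 0 + 0 * rx.evalEval 0 0)], hasDerivAt_pi.mpr fun i => ?_⟩
      fin_cases i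
      · exact hrd
      · exact hNd
      · exact ((hasDerivAt_id (0 : ℂ)).mul hrd).neg
    obtain ⟨γ', hγ⟩ := hγ
    have hGs : ∀ s, G.evalEval s 0 = -(s * r.evalEval s 0) * MvPolynomial.eval (γ s) α
        - N.evalEval s 0 ^ 2 * MvPolynomial.eval (γ s) β := by
      intro s
      have h1 := hαβ (γ s)
      simp only [γ, Matrix.cons_val_zero, Matrix.cons_val_one, Matrix.cons_val] at h1
      rw [hG, ← h1]
      congr 1
      module
    have h1 := ((((hasDerivAt_id (0 : ℂ)).mul hrd).neg).mul (hasDerivAt_eval_comp α hγ)).sub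
      ((hNd.pow 2).mul (hasDerivAt_eval_comp β hγ))
    refine (h1.congr_of_eventuallyEq (Eventually.of_forall fun s => ?_)).congr_deriv ?_
    · rw [hGs]; rfl
    · simp [hN0, hr0, hγ0]

/-! ### The dual curve near the tangent at a simple point -/

theorem gradAt_apply (v : Fin 3 → ℂ) (G : Poly) (i : Fin 3) :
    gradAt v G i = MvPolynomial.eval v (MvPolynomial.pderiv i G) := by
  simp [gradAt, MvPolynomial.aeval_eq_eval]

theorem exists_eval_eq (φ : (Fin 3 → ℂ) →ₗ[ℂ] ℂ) : ∃ l : Poly, ∀ v, MvPolynomial.eval v l = φ v := by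
  refine ⟨∑ i, MvPolynomial.C (φ fun j => if i = j then 1 else 0) * MvPolynomial.X i, fun v => ?_⟩
  rw [LinearMap.pi_apply_eq_sum_univ φ v, map_sum]
  exact Finset.sum_congr rfl fun i _ => by simp [mul_comm]

theorem finite_det_add_smul_eq_zero {A B : Matrix (Fin n) (Fin n) ℂ} (hA : A.det ≠ 0) :
    {y : ℂ | (B + y • A).det = 0}.Finite := by
  let q : ℂ[X] := Matrix.det ((X : ℂ[X]) • A.map C + B.map C)
  have hq : q ≠ 0 := by
    intro h
    have h1 := coeff_det_X_add_C_card A B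
    rw [show Matrix.det ((X : ℂ[X]) • A.map C + B.map C) = 0 from h, coeff_zero] at h1
    exact hA h1.symm
  refine (q.rootSet_finite ℂ).subset fun y hy => ?_
  rw [mem_rootSet]
  refine ⟨hq, ?_⟩
  rw [coe_aeval_eq_eval, ← coe_evalRingHom, RingHom.map_det]
  refine Eq.trans (congrArg Matrix.det ?_) (hy : (B + y • A).det = 0)
  ext i j
  simp only [RingHom.mapMatrix_apply, Matrix.map_apply, Matrix.add_apply, Matrix.smul_apply,
    smul_eq_mul, coe_evalRingHom, eval_add, eval_mul, eval_X, eval_C]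
  ring

section Core

variable {M₀ M₁ : Matrix (Fin n) (Fin n) ℂ} {v : Fin n → ℂ} {F : Poly}
  {g : (Fin 3 → ℂ) ≃ₗ[ℂ] (Fin 3 → ℂ)}

theorem eval_smul_of_pencil
    (hF : ∀ p, MvPolynomial.eval (g p) F
      = (p 0 • M₀ + p 1 • M₁ + p 2 • (1 : Matrix (Fin n) (Fin n) ℂ)).det) (c : ℂ)
    (v : Fin 3 → ℂ) : MvPolynomial.eval (c • v) F = c ^ n * MvPolynomial.eval v F := by
  obtain ⟨p, rfl⟩ := g.surjective v
  have h := Matrix.det_smul (p 0 • M₀ + p 1 • M₁ + p 2 • (1 : Matrix (Fin n) (Fin n) ℂ)) c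
  rw [Fintype.card_fin] at h
  rw [← map_smul, hF, hF, ← h]
  congr 1
  simp only [Pi.smul_apply, smul_eq_mul]
  module

theorem gradAt_dotProduct_map {Fp : Poly}
    (hFp : ∀ p, MvPolynomial.eval (g p) F = MvPolynomial.eval p Fp) (p w : Fin 3 → ℂ) :
    gradAt (g p) F ⬝ᵥ g w = gradAt p Fp ⬝ᵥ w := by
  have h1 := hasDerivAt_eval_comp F (hasDerivAt_line (g p) (g w) 0)
  have h2 := hasDerivAt_eval_comp Fp (hasDerivAt_line p w 0)
  simp only [← map_smul, ← map_add, hFp] at h1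
  simpa using h1.unique h2

theorem dotProduct_map (ℓ p : Fin 3 → ℂ) : ℓ ⬝ᵥ g p =
    p 0 * (ℓ ⬝ᵥ g (Pi.single 0 1)) + p 1 * (ℓ ⬝ᵥ g (Pi.single 1 1))
      + p 2 * (ℓ ⬝ᵥ g (Pi.single 2 1)) := by
  have : p = p 0 • Pi.single 0 1 + p 1 • Pi.single 1 1 + p 2 • Pi.single 2 1 := by
    ext i; fin_cases i <;> simp
  conv_lhs => rw [this]
  simp only [map_add, map_smul, dotProduct_add, dotProduct_smul, smul_eq_mul]

/-- The conormal space of the dual curve at the tangent `z` is at most one-dimensional. -/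
theorem gradAt_mem_span_of_mem_vanishingIdeal
    (hF : ∀ p, MvPolynomial.eval (g p) F
      = (p 0 • M₀ + p 1 • M₁ + p 2 • (1 : Matrix (Fin n) (Fin n) ℂ)).det)
    {α β : Poly} (hαβ : ∀ p : Fin 3 → ℂ, (p 0 • M₀ + p 1 • M₁
      + p 2 • (1 : Matrix (Fin n) (Fin n) ℂ)).det
        = p 2 * MvPolynomial.eval p α - p 1 ^ 2 * MvPolynomial.eval p β)
    (hα : MvPolynomial.eval ![1, 0, 0] α ≠ 0) (hβ : MvPolynomial.eval ![1, 0, 0] β ≠ 0)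
    {z : Plane} (hz0 : z.rep ⬝ᵥ g (Pi.single 0 1) = 0) (hz1 : z.rep ⬝ᵥ g (Pi.single 1 1) = 0)
    (hz : IsTangentLine (curve F) (Projectivization.mk ℂ (g (Pi.single 0 1))
      (by simp)) z)
    {G : Poly} (hG : G ∈ vanishingIdeal {L | ∃ P, IsTangentLine (curve F) P L}) :
    gradAt z.rep G ∈ Submodule.span ℂ {g (Pi.single 0 1)} := by
  have hzc : z.rep ⬝ᵥ g (Pi.single 2 1) ≠ 0 := by
    intro h
    refine z.rep_nonzero (dotProduct_eq_zero _ fun w => ?_)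
    obtain ⟨p, rfl⟩ := g.surjective w
    rw [dotProduct_map, hz0, hz1, h]
    ring
  have he0 : (![1, 0, 0] : Fin 3 → ℂ) = Pi.single 0 1 := by
    ext i; fin_cases i <;> simp
  let Fp : Poly := MvPolynomial.X 2 * α - MvPolynomial.X 1 ^ 2 * β
  have hFp : ∀ p, MvPolynomial.eval (g p) F = MvPolynomial.eval p Fp := fun p => by
    rw [hF, hαβ]; simp [Fp]
  let Λ' : ℂ × ℂ →L[ℂ] (Fin 3 → ℂ) := (ContinuousLinearMap.fst ℂ ℂ ℂ).smulRight (Pi.single 1 1)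
    + (ContinuousLinearMap.snd ℂ ℂ ℂ).smulRight (Pi.single 2 1)
  have hpq : ∀ q : ℂ × ℂ, ![1, q.1, q.2] = (![1, 0, 0] : Fin 3 → ℂ) + Λ' q := by
    intro q
    ext i; fin_cases i <;> simp [Λ']
  have hp : HasStrictFDerivAt (fun q : ℂ × ℂ => (![1, q.1, q.2] : Fin 3 → ℂ)) Λ' (0, 0) := by
    simp only [hpq]
    exact Λ'.hasStrictFDerivAt.const_add _
  have hf := HasStrictFDerivAt.comp (f := fun q : ℂ × ℂ => (![1, q.1, q.2] : Fin 3 → ℂ)) (0, 0)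
    (hasStrictFDerivAt_eval Fp _) hp
  obtain ⟨τ, hτ, hτ0, hτz⟩ := exists_implicit hf (by simp [Fp]) (by
    simp [Λ', gradAt_apply, Fp, Fin.sum_univ_three]
    simpa using hα)
  have hτ' : HasDerivAt τ 0 0 := by
    refine hτ.congr_deriv ?_
    simp [Λ', gradAt_apply, Fp, Fin.sum_univ_three]
  let p : ℂ → Fin 3 → ℂ := fun y => ![1, y, τ y]
  have hp0 : p 0 = ![1, 0, 0] := by simp [p, hτ0]
  have hpd : HasDerivAt p ![0, 1, 0] 0 := by
    refine hasDerivAt_pi.mpr fun i => ?_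
    fin_cases i
    · exact hasDerivAt_const _ _
    · exact hasDerivAt_id _
    · exact hτ'
  have hgp : HasDerivAt (fun y => g (p y)) (g ![0, 1, 0]) 0 :=
    (LinearMap.toContinuousLinearMap g.toLinearMap).hasFDerivAt.comp_hasDerivAt (0 : ℂ) hpd
  -- The arc of tangent lines at the points (1 : y : τ(y)). A gradient of G at z must kill both z
  -- and the velocity of this arc.
  let Λ : ℂ → Fin 3 → ℂ := fun y => gradAt (g (p y)) F
  obtain ⟨Λd, hΛ⟩ : ∃ Λd, HasDerivAt Λ Λd 0 := by
    refine ⟨fun i => gradAt (g (p 0)) (MvPolynomial.pderiv i F) ⬝ᵥ g ![0, 1, 0],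
      hasDerivAt_pi.mpr fun i => ?_⟩
    simp only [Λ, gradAt_apply]
    exact hasDerivAt_eval_comp (MvPolynomial.pderiv i F) hgp
  have hΛw : ∀ y w, Λ y ⬝ᵥ g w = gradAt (p y) Fp ⬝ᵥ w := fun y w =>
    gradAt_dotProduct_map hFp (p y) w
  have hΛd : ∀ i, Λd ⬝ᵥ g (Pi.single i 1) =
      MvPolynomial.eval ![1, 0, 0] (MvPolynomial.pderiv 1 (MvPolynomial.pderiv i Fp)) := by
    intro i
    have h1 : HasDerivAt (fun y => Λ y ⬝ᵥ g (Pi.single i 1)) (Λd ⬝ᵥ g (Pi.single i 1)) 0 := by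
      simp only [dotProduct]
      exact HasDerivAt.fun_sum fun j _ => (hasDerivAt_pi.mp hΛ j).mul_const _
    have h2 := hasDerivAt_eval_comp (MvPolynomial.pderiv i Fp) hpd
    simp only [hΛw, dotProduct_single_one, gradAt_apply] at h1
    rw [h1.unique h2, hp0]
    simp [dotProduct, Fin.sum_univ_three, gradAt_apply]
  have hΛd0 : Λd ⬝ᵥ g (Pi.single 0 1) = 0 := by
    rw [hΛd]
    simp [Fp]
  -- This value is −2β at (1:0:0): simple contact means that the arc of tangents moves with nonzero
  -- velocity away from z.
  have hΛd1 : Λd ⬝ᵥ g (Pi.single 1 1) ≠ 0 := by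
    rw [hΛd]
    simp [Fp]
    simpa using hβ
  have hΛ0 : Λ 0 ≠ 0 := by
    intro h
    have h1 := hΛw 0 (Pi.single 2 1)
    rw [h, zero_dotProduct, dotProduct_single_one, gradAt_apply, hp0] at h1
    simp [Fp] at h1
    exact hα (by simpa using h1.symm)
  have htan : ∀ᶠ y in 𝓝 (0 : ℂ), ∀ c : ℂ, MvPolynomial.eval (c • Λ y) G = 0 := by
    filter_upwards [hτz, hΛ.continuousAt.eventually_ne hΛ0] with y hy hy' c
    have hgy : g (p y) ≠ 0 := by
      rw [Ne, LinearEquiv.map_eq_zero_iff]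
      intro h
      simpa [p] using congrFun h 0
    have h1 := isTangentLine_mk (eval_smul_of_pencil hF) hgy ((hFp _).trans hy) hy'
    exact hG _ ⟨_, h1⟩ _ (smul_mem_submodule_mk hy' c)
  obtain ⟨s₀, hs₀⟩ : ∃ s₀ : ℂ, z.rep = s₀ • Λ 0 := by
    have hg0 : g (p 0) = g (Pi.single 0 1) := by rw [hp0, he0]
    have hF0 : MvPolynomial.eval (g (Pi.single 0 1)) F = 0 := by
      rw [hFp, ← he0]; simp [Fp]
    have h1 := isTangentLine_mk (eval_smul_of_pencil hF) (v := g (Pi.single 0 1)) (by simp)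
      hF0 (by rw [← hg0]; exact hΛ0)
    have h2 := hz.unique h1
    obtain ⟨a, -, ha⟩ := exists_rep_eq_smul (v := gradAt (g (Pi.single 0 1)) F)
      (by rw [← hg0]; exact hΛ0)
    refine ⟨a, ?_⟩
    rw [h2, ha]
    simp only [Λ, hg0]
  have hs₀0 : s₀ ≠ 0 := by
    rintro rfl
    exact z.rep_nonzero (by rw [hs₀, zero_smul])
  have h1 : gradAt z.rep G ⬝ᵥ Λd = 0 := by
    have h2 := gradAt_dotProduct_eq_zero G (hΛ.const_smul s₀) (htan.mono fun y hy => hy s₀)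
    rw [Pi.smul_apply, ← hs₀, dotProduct_smul] at h2
    exact (smul_eq_zero.mp h2).resolve_left hs₀0
  have h2 : gradAt z.rep G ⬝ᵥ z.rep = 0 := gradAt_dotProduct_rep hG ⟨_, hz⟩
  obtain ⟨w, hw⟩ := g.surjective (gradAt z.rep G)
  rw [← hw, dotProduct_comm, dotProduct_map] at h1 h2
  rw [hz0, hz1, mul_zero, mul_zero, zero_add, zero_add] at h2
  have hw2 := (mul_eq_zero.mp h2).resolve_right hzc
  rw [hw2, hΛd0, mul_zero, zero_mul, zero_add, add_zero] at h1
  have hw1 := (mul_eq_zero.mp h1).resolve_right hΛd1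
  rw [← hw]
  refine Submodule.mem_span_singleton.mpr ⟨w 0, ?_⟩
  rw [← map_smul]
  congr 1
  ext i; fin_cases i <;> simp [hw1, hw2]

end Core

/-! ### Tangent lines with their points of tangency, and regularity of the dual curve -/

section TangentTriples

variable {M₀ M₁ : Matrix (Fin n) (Fin n) ℂ} {v : Fin n → ℂ} {F : Poly}
  {g : (Fin 3 → ℂ) ≃ₗ[ℂ] (Fin 3 → ℂ)}

theorem det_smul_eq_zero_iff {c : ℂ} (hc : c ≠ 0) (M : Matrix (Fin n) (Fin n) ℂ) :
    (c • M).det = 0 ↔ M.det = 0 := by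
  rw [Matrix.det_smul, mul_eq_zero, or_iff_right (pow_ne_zero _ hc)]

/-- The tangent lines at points of a pencil curve lying on the lines `x = 0` and `y = y₀ x`, where
`M₀ + y₀ M₁` is singular, are finite in number. -/
theorem finite_exceptional_tangents
    (hF : ∀ p, MvPolynomial.eval (g p) F
      = (p 0 • M₀ + p 1 • M₁ + p 2 • (1 : Matrix (Fin n) (Fin n) ℂ)).det) (hdet : M₁.det ≠ 0) :
    {L | ∃ P, IsTangentLine (curve F) P L ∧ (g.symm P.rep 0 ≠ 0 →
      (M₀ + (g.symm P.rep 1 / g.symm P.rep 0) • M₁).det = 0)}.Finite := by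
  have h1 : (1 : Matrix (Fin n) (Fin n) ℂ).det ≠ 0 := by simp
  -- Representatives of the exceptional points of tangency. They are finite in number, and each
  -- carries at most one tangent line.
  let V : Set (Fin 3 → ℂ) :=
    (fun t : ℂ => ![0, 1, t]) '' {t | (M₁ + t • (1 : Matrix (Fin n) (Fin n) ℂ)).det = 0} ∪
    ⋃ y ∈ {y : ℂ | (M₀ + y • M₁).det = 0}, (fun t : ℂ => ![1, y, t]) ''
      {t | (M₀ + y • M₁ + t • (1 : Matrix (Fin n) (Fin n) ℂ)).det = 0}
  have hV : V.Finite := ((finite_det_add_smul_eq_zero h1).image _).union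
    ((finite_det_add_smul_eq_zero hdet).biUnion fun y _ =>
      (finite_det_add_smul_eq_zero h1).image _)
  have hfin : (⋃ q ∈ V, {L | ∃ P, IsTangentLine (curve F) P L ∧
      ∃ c : ℂ, P.rep = c • g q}).Finite := by
    refine hV.biUnion fun q _ => Set.Subsingleton.finite ?_
    rintro L ⟨P, hPL, c, hc⟩ L' ⟨P', hPL', c', hc'⟩
    have hc'0 : c' ≠ 0 := by
      rintro rfl
      exact P'.rep_nonzero (by rw [hc', zero_smul])
    have : P = P' := by
      rw [← P.mk_rep, ← P'.mk_rep, Projectivization.mk_eq_mk_iff']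
      exact ⟨c / c', by rw [hc, hc', smul_smul, div_mul_cancel₀ _ hc'0]⟩
    subst this
    exact hPL.unique hPL'
  refine hfin.subset ?_
  rintro L ⟨P, hPL, hP⟩
  set p := g.symm P.rep with hp
  have hgp : g p = P.rep := by rw [hp, LinearEquiv.apply_symm_apply]
  have hFp : (p 0 • M₀ + p 1 • M₁ + p 2 • (1 : Matrix (Fin n) (Fin n) ℂ)).det = 0 := by
    rw [← hF, hgp]
    exact eval_rep_of_vanishesAt hPL.1
  simp only [Set.mem_iUnion]
  by_cases hp0 : p 0 = 0
  · rw [hp0, zero_smul, zero_add] at hFp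
    have hp1 : p 1 ≠ 0 := by
      intro hp1
      rw [hp1, zero_smul, zero_add, Matrix.det_smul, Matrix.det_one, mul_one] at hFp
      have hp2 := eq_zero_of_pow_eq_zero hFp
      refine P.rep_nonzero ?_
      rw [← hgp, show p = 0 by ext i; fin_cases i <;> assumption, map_zero]
    have hpe : p = p 1 • ![0, 1, p 2 / p 1] := by
      ext i; fin_cases i <;> simp [hp0]
      field_simp
    refine ⟨![0, 1, p 2 / p 1], Or.inl ⟨p 2 / p 1, ?_, rfl⟩, P, hPL, p 1, ?_⟩
    · rw [Set.mem_ofPred_eq, ← det_smul_eq_zero_iff hp1, smul_add, smul_smul,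
        mul_div_cancel₀ _ hp1]
      exact hFp
    · rw [← map_smul, ← hpe, hgp]
  · have hpe : p = p 0 • ![1, p 1 / p 0, p 2 / p 0] := by
      ext i; fin_cases i <;> simp
      all_goals field_simp
    refine ⟨![1, p 1 / p 0, p 2 / p 0], Or.inr ?_, P, hPL, p 0, ?_⟩
    · refine Set.mem_biUnion (hP hp0) ⟨p 2 / p 0, ?_, rfl⟩
      rw [Set.mem_ofPred_eq, ← det_smul_eq_zero_iff hp0, smul_add, smul_add, smul_smul, smul_smul,
        mul_div_cancel₀ _ hp0, mul_div_cancel₀ _ hp0]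
      exact hFp
    · rw [← map_smul, ← hpe, hgp]

/-- The tangent lines, in affine coordinates, with the slopes of the points of tangency. -/
def tangentTriples (F : Poly) (g : (Fin 3 → ℂ) ≃ₗ[ℂ] (Fin 3 → ℂ))
    (M₀ M₁ : Matrix (Fin n) (Fin n) ℂ) : Set (ℂ × ℂ × ℂ) :=
  {τ | ∃ P L : Plane, IsTangentLine (curve F) P L ∧ g.symm P.rep 0 ≠ 0 ∧
    L.rep ⬝ᵥ g (Pi.single 2 1) ≠ 0 ∧
    τ.1 = L.rep ⬝ᵥ g (Pi.single 0 1) / L.rep ⬝ᵥ g (Pi.single 2 1) ∧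
    τ.2.1 = L.rep ⬝ᵥ g (Pi.single 1 1) / L.rep ⬝ᵥ g (Pi.single 2 1) ∧
    τ.2.2 = g.symm P.rep 1 / g.symm P.rep 0 ∧
    (τ.2.2 ≠ 0 → (M₀ + τ.2.2 • M₁).det ≠ 0)}

theorem exists_of_mem_tangentTriples {a b y : ℂ} (h : (a, b, y) ∈ tangentTriples F g M₀ M₁) :
    ∃ (P L : Plane) (p₀ ℓ : ℂ), IsTangentLine (curve F) P L ∧ p₀ ≠ 0 ∧ ℓ ≠ 0 ∧
      P.rep = p₀ • g ![1, y, -(a + b * y)] ∧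
      ∀ w, L.rep ⬝ᵥ g w = ℓ * (a * w 0 + b * w 1 + w 2) := by
  obtain ⟨P, L, hPL, hp0, hℓ, ha, hb, hy, -⟩ := h
  simp only at ha hb hy
  set p := g.symm P.rep with hp
  have hgp : g p = P.rep := by rw [hp, LinearEquiv.apply_symm_apply]
  have hw : ∀ w, L.rep ⬝ᵥ g w = (L.rep ⬝ᵥ g (Pi.single 2 1)) * (a * w 0 + b * w 1 + w 2) := by
    intro w
    rw [dotProduct_map, ha, hb]
    field_simp
  refine ⟨P, L, p 0, _, hPL, hp0, hℓ, ?_, hw⟩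
  have h1 := hPL.rep_dotProduct_rep
  rw [← hgp, hw] at h1
  have h2 := (mul_eq_zero.mp h1).resolve_left hℓ
  rw [← hgp, ← map_smul]
  congr 1
  ext i; fin_cases i
  · simp
  · simp [hy]; field_simp
  · simp only [Fin.reduceFinMk, Pi.smul_apply, Matrix.cons_val, smul_eq_mul, hy]
    field_simp
    linear_combination h2

theorem det_eq_zero_of_mem_tangentTriples
    (hF : ∀ p, MvPolynomial.eval (g p) F
      = (p 0 • M₀ + p 1 • M₁ + p 2 • (1 : Matrix (Fin n) (Fin n) ℂ)).det) {a b y : ℂ}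
    (h : (a, b, y) ∈ tangentTriples F g M₀ M₁) :
    ((M₀ - a • (1 : Matrix (Fin n) (Fin n) ℂ))
      + y • (M₁ - b • (1 : Matrix (Fin n) (Fin n) ℂ))).det = 0 := by
  obtain ⟨P, L, p₀, ℓ, hPL, hp₀, hℓ, hP, hL⟩ := exists_of_mem_tangentTriples h
  have h1 := eval_rep_of_vanishesAt hPL.1
  rw [hP, eval_smul_of_pencil hF, mul_eq_zero, or_iff_right (pow_ne_zero _ hp₀), hF] at h1
  rw [← h1]
  congr 1
  simp only [Matrix.cons_val_zero, Matrix.cons_val_one, Matrix.cons_val]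
  module

/-- The gradient of F at P is a multiple of L, possibly zero, and the direction (0, 1, −b) lies on
L; hence F restricted to L has a multiple zero at P. -/
theorem hasDerivAt_of_mem_tangentTriples
    (hF : ∀ p, MvPolynomial.eval (g p) F
      = (p 0 • M₀ + p 1 • M₁ + p 2 • (1 : Matrix (Fin n) (Fin n) ℂ)).det) {a b y : ℂ}
    (h : (a, b, y) ∈ tangentTriples F g M₀ M₁) :
    HasDerivAt (fun s : ℂ => ((M₀ - a • (1 : Matrix (Fin n) (Fin n) ℂ))
      + s • (M₁ - b • (1 : Matrix (Fin n) (Fin n) ℂ))).det) 0 y := by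
  obtain ⟨P, L, p₀, ℓ, hPL, hp₀, hℓ, hP, hL⟩ := exists_of_mem_tangentTriples h
  have hFm : F ∈ vanishingIdeal (curve F) := fun _ h => h
  obtain ⟨κ, hκ⟩ := hPL.exists_gradAt_eq hFm
  have h1 := hasDerivAt_eval_comp F (hasDerivAt_line P.rep (g ![0, 1, -b]) 0)
  rw [zero_smul, add_zero, hκ, smul_dotProduct, hL] at h1
  have h2 : HasDerivAt (fun s : ℂ => (s - y) * p₀) p₀ y := by
    simpa using ((hasDerivAt_id y).sub_const y).mul_const p₀
  have h1' : HasDerivAt (fun s => MvPolynomial.eval (P.rep + s • g ![0, 1, -b]) F) 0 ((y - y) * p₀) := by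
    rw [sub_self, zero_mul]
    refine h1.congr_deriv ?_
    simp
  have h3 := (h1'.comp y h2).const_mul ((p₀ ^ n)⁻¹)
  refine (h3.congr_of_eventuallyEq (Eventually.of_forall fun s => ?_)).congr_deriv (by simp)
  simp only [Function.comp_apply]
  have h4 : P.rep + ((s - y) * p₀) • g ![0, 1, -b] = p₀ • g ![1, s, -(a + b * s)] := by
    rw [hP, ← map_smul, ← map_smul, ← map_smul, ← map_add]
    congr 1
    ext i; fin_cases i <;> simp <;> ring
  rw [h4, eval_smul_of_pencil hF, inv_mul_cancel_left₀ (pow_ne_zero _ hp₀), hF]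
  congr 1
  simp only [Matrix.cons_val_zero, Matrix.cons_val_one, Matrix.cons_val]
  module

/-- The homogenization of f in the chart y = 1 vanishes on the curve, so its gradient at P is a
multiple of L = (a : b : 1). Comparing its x- and t-components gives the relation, also when that
multiple is zero. F itself would not do, being possibly not square-free. -/
theorem slope_of_mem_tangentTriples
    (hF : ∀ p, MvPolynomial.eval (g p) F
      = (p 0 • M₀ + p 1 • M₁ + p 2 • (1 : Matrix (Fin n) (Fin n) ℂ)).det) {f fx : ℂ[X][Y]}
    (hf : ∀ x t : ℂ, HasStrictFDerivAt (fun q : ℂ × ℂ => f.evalEval q.1 q.2)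
        (fx.evalEval x t • ContinuousLinearMap.fst ℂ ℂ ℂ +
          (derivative f).evalEval x t • ContinuousLinearMap.snd ℂ ℂ ℂ) (x, t))
    (hf0 : ∀ x t : ℂ, (M₁ + x • M₀ + t • (1 : Matrix (Fin n) (Fin n) ℂ)).det = 0 →
        f.evalEval x t = 0) {a b y : ℂ} (h : (a, b, y) ∈ tangentTriples F g M₀ M₁) (hy : y ≠ 0) :
    ∃ t : ℂ, (M₁ + y⁻¹ • M₀ + t • (1 : Matrix (Fin n) (Fin n) ℂ)).det = 0 ∧
        a * (derivative f).evalEval y⁻¹ t = fx.evalEval y⁻¹ t := by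
  have hT0 := det_eq_zero_of_mem_tangentTriples hF h
  obtain ⟨P, L, p₀, ℓ, hPL, hp₀, hℓ, hP, hL⟩ := exists_of_mem_tangentTriples h
  let coord (i : Fin 3) : (Fin 3 → ℂ) →ₗ[ℂ] ℂ := LinearMap.proj i ∘ₗ g.symm.toLinearMap
  obtain ⟨l₀, hl₀⟩ := exists_eval_eq (coord 0)
  obtain ⟨l₁, hl₁⟩ := exists_eval_eq (coord 1)
  obtain ⟨l₂, hl₂⟩ := exists_eval_eq (coord 2)
  obtain ⟨D, Q, hQ0, hQ⟩ := exists_homogenization_vanishing f l₀ l₂ l₁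
  have hl : ∀ p, MvPolynomial.eval (g p) l₀ = p 0 ∧ MvPolynomial.eval (g p) l₁ = p 1 ∧
      MvPolynomial.eval (g p) l₂ = p 2 := fun p => by
    rw [hl₀, hl₁, hl₂]; simp [coord]
  have hQm : Q ∈ vanishingIdeal (curve F) := by
    intro P' hP' w hw
    obtain ⟨p, rfl⟩ := g.surjective w
    obtain ⟨e₀, e₁, e₂⟩ := hl p
    by_cases hp1 : p 1 = 0
    · exact hQ0 _ (e₁.trans hp1)
    · rw [hQ _ (by rwa [e₁]), e₀, e₁, e₂, hf0, mul_zero]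
      have h1 := hP' _ hw
      rw [hF] at h1
      rw [← det_smul_eq_zero_iff hp1, ← h1, smul_add, smul_add, smul_smul, smul_smul,
        mul_div_cancel₀ _ hp1, mul_div_cancel₀ _ hp1, add_comm (p 1 • M₁)]
  obtain ⟨κ, hκ⟩ := hPL.exists_gradAt_eq hQm
  have hpy : p₀ * y ≠ 0 := mul_ne_zero hp₀ hy
  let t := -(a + b * y) / y
  have hdir : ∀ r s : ℂ, HasDerivAt (fun u : ℂ => (p₀ * y) ^ D *
      f.evalEval (y⁻¹ + u * (r / (p₀ * y))) (t + u * (s / (p₀ * y))))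
      (κ * (ℓ * (a * r + s))) 0 := by
    intro r s
    have h1 := hasDerivAt_eval_comp Q (hasDerivAt_line P.rep (g ![r, 0, s]) 0)
    rw [zero_smul, add_zero, hκ, smul_dotProduct, hL] at h1
    refine (h1.congr_of_eventuallyEq (Eventually.of_forall fun u => ?_)).congr_deriv (by simp)
    have h4 : P.rep + u • g ![r, 0, s]
        = g ![p₀ + u * r, p₀ * y, -(p₀ * (a + b * y)) + u * s] := by
      rw [hP, ← map_smul, ← map_smul, ← map_add]
      congr 1
      ext i; fin_cases i <;> simp
      ring
    obtain ⟨e₀, e₁, e₂⟩ := hl ![p₀ + u * r, p₀ * y, -(p₀ * (a + b * y)) + u * s]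
    simp only [Matrix.cons_val_zero, Matrix.cons_val_one, Matrix.cons_val] at e₀ e₁ e₂
    simp only
    rw [h4, hQ _ (by rwa [e₁]), e₀, e₁, e₂]
    congr 2
    · field_simp
    · simp only [t]; field_simp
  have hchain : ∀ r s : ℂ, (p₀ * y) ^ D * (fx.evalEval y⁻¹ t * (r / (p₀ * y))
      + (derivative f).evalEval y⁻¹ t * (s / (p₀ * y))) = κ * (ℓ * (a * r + s)) := by
    intro r s
    have h1 : HasDerivAt (fun u : ℂ => (y⁻¹ + u * (r / (p₀ * y)), t + u * (s / (p₀ * y))))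
        (r / (p₀ * y), s / (p₀ * y)) 0 := by
      refine HasDerivAt.prodMk ?_ ?_
      · simpa using ((hasDerivAt_id (0 : ℂ)).mul_const (r / (p₀ * y))).const_add y⁻¹
      · simpa using ((hasDerivAt_id (0 : ℂ)).mul_const (s / (p₀ * y))).const_add t
    have h2 : HasFDerivAt (fun q : ℂ × ℂ => f.evalEval q.1 q.2)
        (fx.evalEval y⁻¹ t • ContinuousLinearMap.fst ℂ ℂ ℂ +
          (derivative f).evalEval y⁻¹ t • ContinuousLinearMap.snd ℂ ℂ ℂ)
        (y⁻¹ + 0 * (r / (p₀ * y)), t + 0 * (s / (p₀ * y))) := by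
      simpa using (hf y⁻¹ t).hasFDerivAt
    have h3 := (HasFDerivAt.comp_hasDerivAt (0 : ℂ) h2 h1).const_mul ((p₀ * y) ^ D)
    have h4 := h3.unique (hdir r s)
    simpa using h4
  refine ⟨t, ?_, ?_⟩
  · rw [← det_smul_eq_zero_iff hy, ← hT0]
    congr 1
    rw [smul_add, smul_add, smul_smul, smul_smul, mul_inv_cancel₀ hy]
    simp only [t]
    rw [mul_div_cancel₀ _ hy]
    module
  · have h1 := hchain 1 0
    have h2 := hchain 0 1
    have h3 : (p₀ * y) ^ D * (1 / (p₀ * y)) ≠ 0 :=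
      mul_ne_zero (pow_ne_zero _ hpy) (one_div_ne_zero hpy)
    refine mul_left_cancel₀ h3 ?_
    linear_combination a * h2 - h1

/-- The dual of the curve of a simple pencil is nonsingular at the tangent at the point `g e₀`. -/
theorem IsSimplePencil.not_isSingularPoint (h : IsSimplePencil M₀ M₁ v)
    (hF : ∀ p, MvPolynomial.eval (g p) F
      = (p 0 • M₀ + p 1 • M₁ + p 2 • (1 : Matrix (Fin n) (Fin n) ℂ)).det) (hdet : M₁.det ≠ 0)
    {z : Plane} (hz0 : z.rep ⬝ᵥ g (Pi.single 0 1) = 0) (hz1 : z.rep ⬝ᵥ g (Pi.single 1 1) = 0) :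
    ¬ IsSingularPoint (dualCurve (curve F)) z := by
  rintro ⟨hzmem, hzs⟩
  refine hzs ⟨Projectivization.mk ℂ (g (Pi.single 0 1)) (by simp), hzmem, ?_⟩
  have hzc : z.rep ⬝ᵥ g (Pi.single 2 1) ≠ 0 := by
    intro h
    refine z.rep_nonzero (dotProduct_eq_zero _ fun w => ?_)
    obtain ⟨p, rfl⟩ := g.surjective w
    rw [dotProduct_map, hz0, hz1, h]
    ring
  obtain ⟨α, β, hαβ, hα, hβ⟩ := exists_block_formula h.posSemidef h.isHermitian h.ne_zero
    h.mulVec_eq_zero h.ker h.isotropic h.mulVec_ne_zero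
  have he0 : (![1, 0, 0] : Fin 3 → ℂ) = Pi.single 0 1 := by
    ext i; fin_cases i <;> simp
  have htan : IsTangentLine (curve F)
      (Projectivization.mk ℂ (g (Pi.single 0 1)) (by simp)) z := by
    let Fp : Poly := MvPolynomial.X 2 * α - MvPolynomial.X 1 ^ 2 * β
    have hFp : ∀ p, MvPolynomial.eval (g p) F = MvPolynomial.eval p Fp := fun p => by
      rw [hF, hαβ]; simp [Fp]
    have h1 : ∀ w, gradAt (g (Pi.single 0 1)) F ⬝ᵥ g w
        = MvPolynomial.eval ![1, 0, 0] α * w 2 := by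
      intro w
      rw [gradAt_dotProduct_map hFp, ← he0]
      simp [dotProduct, Fin.sum_univ_three, gradAt_apply, Fp]
    have hg : gradAt (g (Pi.single 0 1)) F ≠ 0 := by
      intro h0
      have h2 := h1 (Pi.single 2 1)
      rw [h0, zero_dotProduct, Pi.single_eq_same, mul_one] at h2
      exact hα h2.symm
    have hF0 : MvPolynomial.eval (g (Pi.single 0 1)) F = 0 := by
      rw [hFp, ← he0]; simp [Fp]
    have h2 := isTangentLine_mk (eval_smul_of_pencil hF) (v := g (Pi.single 0 1)) (by simp) hF0 hg
    convert h2 using 1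
    rw [← z.mk_rep, Projectivization.mk_eq_mk_iff']
    refine ⟨z.rep ⬝ᵥ g (Pi.single 2 1) / MvPolynomial.eval ![1, 0, 0] α, ?_⟩
    refine (dotProduct_eq _ _ fun w => ?_)
    obtain ⟨p, rfl⟩ := g.surjective w
    rw [smul_dotProduct, h1, dotProduct_map z.rep p, hz0, hz1, smul_eq_mul]
    field_simp
    ring
  rw [conormalSpace, dualCurve, vanishingIdeal_zariskiClosure, Projectivization.submodule_mk]
  set S := {L | ∃ P, IsTangentLine (curve F) P L}
  have hle : ∀ G ∈ vanishingIdeal S, gradAt z.rep G ∈ Submodule.span ℂ {g (Pi.single 0 1)} :=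
    fun G hG => gradAt_mem_span_of_mem_vanishingIdeal hF hαβ hα hβ hz0 hz1 htan hG
  have h000 : (0, 0, 0) ∈ tangentTriples F g M₀ M₁ := by
    obtain ⟨a, ha, hrep⟩ := exists_rep_eq_smul (v := g (Pi.single 0 1)) (by simp)
    refine ⟨_, z, htan, ?_, hzc, ?_, ?_, ?_, fun h0 => absurd rfl h0⟩
    · rw [hrep]; simpa using ha
    · simp [hz0]
    · simp [hz1]
    · rw [hrep]; simp
  obtain ⟨G₂, hG₂, δ₂, hδ₂, hd₂⟩ := h.exists_dual_equation hdet (tangentTriples F g M₀ M₁)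
    (fun _ _ _ hτ => det_eq_zero_of_mem_tangentTriples hF hτ)
    (fun _ _ _ hτ => hasDerivAt_of_mem_tangentTriples hF hτ)
    (fun _ _ hf hf0 _ _ _ hτ hy => slope_of_mem_tangentTriples hF hf hf0 hτ hy)
    (fun a b y hτ hy => by
      obtain ⟨_, _, _, _, _, _, _, _, h'⟩ := hτ
      exact h' hy) h000
  -- Tangents not covered by the triples, apart from z, which is covered by the triple (0, 0, 0). An
  -- auxiliary factor H, nonzero at z, kills these finitely many lines.
  let E := {L | ∃ P, IsTangentLine (curve F) P L ∧ (g.symm P.rep 0 ≠ 0 →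
      (M₀ + (g.symm P.rep 1 / g.symm P.rep 0) • M₁).det = 0)} \ {z}
  obtain ⟨H, hH, hHz⟩ := exists_vanishesAt_finite (E := E)
    ((finite_exceptional_tangents hF hdet).sdiff) (z := z) (fun hz => hz.2 rfl)
  let form (i : Fin 3) : (Fin 3 → ℂ) →ₗ[ℂ] ℂ :=
    (dotProductBilin ℂ ℂ).flip (g (Pi.single i 1))
  obtain ⟨l₀, hl₀⟩ := exists_eval_eq (form 0)
  obtain ⟨l₁, hl₁⟩ := exists_eval_eq (form 1)
  obtain ⟨l₂, hl₂⟩ := exists_eval_eq (form 2)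
  have hl₀ : ∀ ℓ, MvPolynomial.eval ℓ l₀ = ℓ ⬝ᵥ g (Pi.single 0 1) := hl₀
  have hl₁ : ∀ ℓ, MvPolynomial.eval ℓ l₁ = ℓ ⬝ᵥ g (Pi.single 1 1) := hl₁
  have hl₂ : ∀ ℓ, MvPolynomial.eval ℓ l₂ = ℓ ⬝ᵥ g (Pi.single 2 1) := hl₂
  obtain ⟨D, Q, hQ0, hQ⟩ := exists_homogenization_vanishing G₂ l₀ l₁ l₂
  have hQT : ∀ L : Plane, (L.rep ⬝ᵥ g (Pi.single 2 1) = 0 ∨ ∃ y,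
      (L.rep ⬝ᵥ g (Pi.single 0 1) / L.rep ⬝ᵥ g (Pi.single 2 1),
        L.rep ⬝ᵥ g (Pi.single 1 1) / L.rep ⬝ᵥ g (Pi.single 2 1), y) ∈ tangentTriples F g M₀ M₁) →
      VanishesAt Q L := by
    intro L hL w hw
    rw [Projectivization.submodule_eq] at hw
    obtain ⟨c, rfl⟩ := Submodule.mem_span_singleton.mp hw
    by_cases hc : MvPolynomial.eval (c • L.rep) l₂ = 0
    · exact hQ0 _ hc
    · rw [hQ _ hc]
      simp only [hl₀, hl₁, hl₂, smul_dotProduct, smul_eq_mul, mul_eq_zero, not_or] at hc ⊢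
      obtain ⟨y, hy⟩ := hL.resolve_left hc.2
      rw [mul_div_mul_left _ _ hc.1, mul_div_mul_left _ _ hc.1]
      exact Or.inr (hG₂ _ _ _ hy)
  have hz000 : VanishesAt Q z := hQT z (Or.inr ⟨0, by simpa [hz0, hz1] using h000⟩)
  have hGm : Q * H ∈ vanishingIdeal S := by
    rintro L ⟨P, hPL⟩ w hw
    rw [map_mul]
    by_cases hLE : L ∈ E
    · rw [hH L hLE w hw, mul_zero]
    · refine mul_eq_zero_of_left ?_ _
      by_cases hLz : L = z
      · subst hLz
        exact hz000 w hw
      · have hP : ¬ (g.symm P.rep 0 ≠ 0 →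
            (M₀ + (g.symm P.rep 1 / g.symm P.rep 0) • M₁).det = 0) :=
          fun hP => hLE ⟨⟨P, hPL, hP⟩, hLz⟩
        push Not at hP
        refine hQT L ?_ w hw
        by_cases hL2 : L.rep ⬝ᵥ g (Pi.single 2 1) = 0
        · exact Or.inl hL2
        · exact Or.inr ⟨_, P, L, hPL, hP.1, hL2, rfl, rfl, rfl, fun _ => hP.2⟩
  have hne : gradAt z.rep (Q * H) ≠ 0 := by
    intro h0
    -- The direction in the dual plane in which only the coordinate a varies; along it Q restricts
    -- to G₂(s/c, 0) up to a constant, whose derivative at 0 is nonzero.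
    let δ : Fin 3 → ℂ := fun j => g.symm (Pi.single j 1) 0
    have hδ : ∀ w, δ ⬝ᵥ g w = w 0 := by
      intro w
      have h1 := LinearMap.pi_apply_eq_sum_univ
        ((LinearMap.proj 0 : (Fin 3 → ℂ) →ₗ[ℂ] ℂ) ∘ₗ g.symm.toLinearMap) (g w)
      have h2 : ∀ i : Fin 3, (fun j => if i = j then (1 : ℂ) else 0) = Pi.single i 1 := by
        intro i; ext j; simp [Pi.single_apply, eq_comm]
      simp only [h2] at h1
      simp at h1
      rw [h1, dotProduct]
      simp [δ, mul_comm]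
    have h1 := hasDerivAt_eval_comp (Q * H) (hasDerivAt_line z.rep δ 0)
    rw [zero_smul, add_zero, h0, zero_dotProduct] at h1
    set c := z.rep ⬝ᵥ g (Pi.single 2 1)
    have hQs : ∀ s : ℂ, MvPolynomial.eval (z.rep + s • δ) Q = c ^ D * G₂.evalEval (s / c) 0 := by
      intro s
      have e₂ : MvPolynomial.eval (z.rep + s • δ) l₂ = c := by
        rw [hl₂, add_dotProduct, smul_dotProduct, hδ]
        simp [c]
      rw [hQ _ (by rwa [e₂]), e₂, hl₀, hl₁, add_dotProduct, add_dotProduct, smul_dotProduct,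
        smul_dotProduct, hδ, hδ, hz0, hz1]
      simp
    have h2 : HasDerivAt (fun s : ℂ => MvPolynomial.eval (z.rep + s • δ) Q)
        (c ^ D * (δ₂ * (1 / c))) 0 := by
      simp only [hQs]
      have h3 : HasDerivAt (fun s : ℂ => s / c) (1 / c) 0 := (hasDerivAt_id (0 : ℂ)).div_const c
      have h4 : HasDerivAt (fun s => G₂.evalEval s 0) δ₂ (0 / c) := by rwa [zero_div]
      exact (h4.comp (0 : ℂ) h3).const_mul _
    have h3 := h2.mul (hasDerivAt_eval_comp H (hasDerivAt_line z.rep δ 0))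
    have h4 := h1.unique (h3.congr_of_eventuallyEq (Eventually.of_forall fun s => by
      simp))
    rw [zero_smul, add_zero, eval_rep_of_vanishesAt hz000, zero_mul, add_zero] at h4
    exact mul_ne_zero (mul_ne_zero (pow_ne_zero _ hzc) (mul_ne_zero hδ₂ (one_div_ne_zero hzc)))
      hHz h4.symm
  refine le_antisymm ?_ ?_
  · rintro _ ⟨G, hG, rfl⟩
    exact hle G hG
  · rw [Submodule.span_singleton_le_iff_mem]
    obtain ⟨c, hc⟩ := Submodule.mem_span_singleton.mp (hle _ hGm)
    have hc0 : c ≠ 0 := by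
      rintro rfl
      exact hne (by rw [← hc, zero_smul])
    have h1 : g (Pi.single 0 1) = c⁻¹ • gradAt z.rep (Q * H) := by
      rw [← hc, smul_smul, inv_mul_cancel₀ hc0, one_smul]
    rw [h1]
    exact Submodule.smul_mem _ _ (Submodule.mem_map_of_mem hGm)

end TangentTriples

/-! ### The numerical range -/

theorem quadForm_eq (A : Matrix (Fin n) (Fin n) ℂ) (x : EuclideanSpace ℂ (Fin n)) :
    quadForm A x = star x.ofLp ⬝ᵥ A *ᵥ x.ofLp := by
  rw [quadForm, EuclideanSpace.inner_eq_star_dotProduct, dotProduct_comm]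
  rfl

theorem quadForm_smul (A : Matrix (Fin n) (Fin n) ℂ) (c : ℂ) (x : EuclideanSpace ℂ (Fin n)) :
    quadForm A (c • x) = (‖c‖ ^ 2 : ℝ) * quadForm A x := by
  rw [quadForm, map_smul, inner_smul_left, inner_smul_right, ← mul_assoc, Complex.conj_mul']
  push_cast
  rfl

theorem continuous_quadForm (A : Matrix (Fin n) (Fin n) ℂ) : Continuous (quadForm A) :=
  continuous_id.inner (LinearMap.continuous_of_finiteDimensional _)

theorem isCompact_numericalRange (A : Matrix (Fin n) (Fin n) ℂ) :
    IsCompact (numericalRange A) := by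
  have : numericalRange A = quadForm A '' Metric.sphere 0 1 := by
    ext z
    simp [numericalRange]
  rw [this]
  exact (isCompact_sphere 0 1).image (continuous_quadForm A)

theorem mem_numericalRange_of_eq {A : Matrix (Fin n) (Fin n) ℂ} {x : EuclideanSpace ℂ (Fin n)}
    (hx : x ≠ 0) {z : ℂ} (h : quadForm A x = (‖x‖ ^ 2 : ℝ) * z) : z ∈ numericalRange A := by
  have hx' : ‖x‖ ≠ 0 := norm_ne_zero_iff.mpr hx
  refine ⟨(‖x‖⁻¹ : ℂ) • x, ?_, ?_⟩
  · rw [norm_smul, norm_inv, Complex.norm_real, norm_norm, inv_mul_cancel₀ hx']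
  · rw [quadForm_smul, h, ← mul_assoc, ← Complex.ofReal_mul, norm_inv, Complex.norm_real, norm_norm,
      inv_pow, inv_mul_cancel₀ (pow_ne_zero 2 hx'), Complex.ofReal_one, one_mul]

/-- The Toeplitz--Hausdorff theorem. -/
theorem convex_numericalRange (A : Matrix (Fin n) (Fin n) ℂ) : Convex ℝ (numericalRange A) := by
  rintro z₁ ⟨x₁, hx₁, hq₁⟩ z₂ ⟨x₂, hx₂, hq₂⟩ α t hα ht hαt
  obtain rfl : α = 1 - t := by linarith
  by_cases hz : z₁ = z₂
  · rw [hz, ← add_smul, sub_add_cancel, one_smul]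
    exact ⟨x₂, hx₂, hq₂⟩
  have hD : z₂ - z₁ ≠ 0 := sub_ne_zero.mpr (Ne.symm hz)
  set T := Matrix.toEuclideanLin A
  -- Off-diagonal entries of (A − z₁)/(z₂ − z₁), a normalization sending z₁ to 0 and z₂ to 1. The
  -- phase e below makes the cross term real, so the normalized form is real along a path from e x₁
  -- to x₂ and the intermediate value theorem applies.
  set a : ℂ := (inner ℂ x₁ (T x₂) - z₁ * inner ℂ x₁ x₂) / (z₂ - z₁) with ha
  set b : ℂ := (inner ℂ x₂ (T x₁) - z₁ * inner ℂ x₂ x₁) / (z₂ - z₁) with hb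
  obtain ⟨e, he, hed⟩ := Complex.exists_norm_mul_eq_self (a - (starRingEnd ℂ) b)
  have hee : (starRingEnd ℂ) e * e = 1 := by rw [Complex.conj_mul', he]; simp
  have hreal : ((starRingEnd ℂ) e * a + e * b).im = 0 := by
    have h1 : (starRingEnd ℂ) e * (a - (starRingEnd ℂ) b)
        = (‖a - (starRingEnd ℂ) b‖ : ℂ) := by
      conv_lhs => rw [← hed, ← mul_assoc, hee, one_mul]
    have h2 := congrArg Complex.im h1
    simp only [Complex.mul_im, Complex.conj_re, Complex.conj_im, Complex.sub_re, Complex.sub_im,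
      Complex.ofReal_im, Complex.add_im] at h2 ⊢
    linarith
  set m := ((starRingEnd ℂ) e * a + e * b).re with hm
  have hmm : (starRingEnd ℂ) e * a + e * b = m := by
    apply Complex.ext
    · simp [hm]
    · simp [hreal]
  let ξ : ℝ → EuclideanSpace ℂ (Fin n) := fun s => ((1 - s : ℝ) * e : ℂ) • x₁ + (s : ℂ) • x₂
  let φ : ℝ → ℝ := fun s => s * (1 - s) * m + s ^ 2
  have hnn : ∀ x : EuclideanSpace ℂ (Fin n), ((‖x‖ ^ 2 : ℝ) : ℂ) = inner ℂ x x := by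
    intro x; rw [inner_self_eq_norm_sq_to_K]; push_cast; rfl
  have h11 : inner ℂ x₁ x₁ = (1 : ℂ) := by rw [← hnn, hx₁]; simp
  have h22 : inner ℂ x₂ x₂ = (1 : ℂ) := by rw [← hnn, hx₂]; simp
  have hqξ : ∀ s, quadForm A (ξ s) = (‖ξ s‖ ^ 2 : ℝ) * z₁ + (z₂ - z₁) * φ s := by
    intro s
    have e1 : inner ℂ x₁ (T x₁) = z₁ := hq₁
    have e2 : inner ℂ x₂ (T x₂) = z₂ := hq₂
    have e3 : inner ℂ x₁ (T x₂) = (z₂ - z₁) * a + z₁ * inner ℂ x₁ x₂ := by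
      rw [ha]; field_simp; ring
    have e4 : inner ℂ x₂ (T x₁) = (z₂ - z₁) * b + z₁ * inner ℂ x₂ x₁ := by
      rw [hb]; field_simp; ring
    rw [hnn, quadForm]
    change inner ℂ (ξ s) (T (ξ s)) = _
    simp only [ξ, φ, map_add, map_smul, inner_add_left, inner_add_right, inner_smul_left,
      inner_smul_right, e1, e2, e3, e4, h11, h22, map_mul, Complex.conj_ofReal]
    push_cast
    rw [← hmm]
    ring
  -- A zero on the path would make x₁ a unimodular multiple of x₂ (or x₂ zero), forcing z₁ = z₂.
  have hξ0 : ∀ s, ξ s ≠ 0 := by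
    intro s h0
    by_cases hs : (1 - s : ℝ) = 0
    · have hs1 : s = 1 := by linarith
      simp only [ξ, hs1] at h0
      simp at h0
      rw [h0, norm_zero] at hx₂
      exact zero_ne_one hx₂
    · have he0 : e ≠ 0 := by
        rintro rfl
        simp at he
      have hc : ((1 - s : ℝ) * e : ℂ) ≠ 0 := mul_ne_zero (Complex.ofReal_ne_zero.mpr hs) he0
      have h1 : x₁ = (-(s : ℂ) / ((1 - s : ℝ) * e)) • x₂ := by
        have h2 := eq_neg_of_add_eq_zero_left h0
        rw [← neg_smul] at h2
        rw [div_eq_inv_mul, mul_smul, ← h2, smul_smul, inv_mul_cancel₀ hc, one_smul]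
      have h2 : ‖(-(s : ℂ) / ((1 - s : ℝ) * e))‖ = 1 := by
        have := hx₁
        rwa [h1, norm_smul, hx₂, mul_one] at this
      refine hz ?_
      rw [← hq₁, h1, quadForm_smul, h2, hq₂]
      simp
  have hN : ∀ s, ‖ξ s‖ ^ 2 ≠ 0 := fun s => pow_ne_zero 2 (norm_ne_zero_iff.mpr (hξ0 s))
  have hξc : Continuous ξ := by
    simp only [ξ]
    fun_prop
  have hφc : Continuous φ := by
    simp only [φ]
    fun_prop
  have hcont : Continuous fun s => φ s / ‖ξ s‖ ^ 2 :=
    hφc.div₀ (hξc.norm.pow 2) hN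
  have hiv := intermediate_value_Icc (zero_le_one (α := ℝ)) hcont.continuousOn
  obtain ⟨s, -, hs⟩ := hiv (show t ∈ Set.Icc _ _ by
    simp only [φ, ξ]
    simp [hx₂, ht]
    linarith)
  refine mem_numericalRange_of_eq (hξ0 s) ?_
  rw [hqξ]
  have h1 : φ s = t * ‖ξ s‖ ^ 2 := by
    rw [← hs]
    exact (div_mul_cancel₀ _ (hN s)).symm
  rw [h1, Complex.real_smul, Complex.real_smul]
  push_cast
  ring

theorem exists_eq_re_conj_mul (f : ℂ →L[ℝ] ℝ) :
    ∃ u : ℂ, ∀ w, f w = ((starRingEnd ℂ) u * w).re := by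
  refine ⟨⟨f 1, f Complex.I⟩, fun w => ?_⟩
  have : w = w.re • (1 : ℂ) + w.im • Complex.I := by
    apply Complex.ext <;> simp
  conv_lhs => rw [this, map_add, map_smul, map_smul]
  simp [mul_comm]

/-- A closed convex set of complex numbers has a support line at every frontier point. -/
theorem exists_support {W : Set ℂ} (hconv : Convex ℝ W) (hcl : IsClosed W) {z : ℂ}
    (hz : z ∈ frontier W) : ∃ u : ℂ, u ≠ 0 ∧ ∀ w ∈ W,
      ((starRingEnd ℂ) u * w).re ≤ ((starRingEnd ℂ) u * z).re := by
  rw [frontier_eq_closure_inter_closure] at hz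
  have hzW : z ∈ W := hcl.closure_eq ▸ hz.1
  obtain ⟨ζ, hζ, hlim⟩ := mem_closure_iff_seq_limit.mp hz.2
  -- Separate W from exterior points converging to z; a limit point of the unit normals is the
  -- normal of a support line at z.
  have hsep : ∀ k, ∃ u : ℂ, ‖u‖ = 1 ∧ ∀ w ∈ W,
      ((starRingEnd ℂ) u * w).re ≤ ((starRingEnd ℂ) u * ζ k).re := by
    intro k
    obtain ⟨f, c, hf, hc⟩ := geometric_hahn_banach_closed_point hconv hcl (hζ k)
    obtain ⟨u, hu⟩ := exists_eq_re_conj_mul f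
    have hu0 : u ≠ 0 := by
      rintro rfl
      have h1 := hf z hzW
      rw [hu] at h1 hc
      simp only [map_zero, zero_mul, Complex.zero_re] at h1 hc
      linarith
    have hn : 0 < ‖u‖ := norm_pos_iff.mpr hu0
    refine ⟨(‖u‖⁻¹ : ℝ) • u, ?_, fun w hw => ?_⟩
    · rw [norm_smul, norm_inv, norm_norm, inv_mul_cancel₀ hn.ne']
    · have h1 := (hf w hw).trans hc
      rw [hu, hu] at h1
      have h2 : ∀ w : ℂ, ((starRingEnd ℂ) ((‖u‖⁻¹ : ℝ) • u) * w).re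
          = ‖u‖⁻¹ * ((starRingEnd ℂ) u * w).re := by
        intro w
        rw [Complex.real_smul, map_mul, Complex.conj_ofReal, mul_assoc, Complex.re_ofReal_mul]
      rw [h2, h2]
      exact mul_le_mul_of_nonneg_left h1.le (inv_nonneg.mpr hn.le)
  choose u hu hsup using hsep
  obtain ⟨a, ha, ψ, hψ, hψa⟩ := (isCompact_sphere (0 : ℂ) 1).tendsto_subseq
    (x := u) fun k => by simp [hu k]
  refine ⟨a, fun h0 => by simp [h0] at ha, fun w hw => ?_⟩
  have hc1 : Tendsto (fun k => ((starRingEnd ℂ) (u (ψ k)) * w).re) atTop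
      (𝓝 ((starRingEnd ℂ) a * w).re) :=
    (Complex.continuous_re.tendsto _).comp
      (((Complex.continuous_conj.tendsto _).comp hψa).mul_const w)
  have hc2 : Tendsto (fun k => ((starRingEnd ℂ) (u (ψ k)) * ζ (ψ k)).re) atTop
      (𝓝 ((starRingEnd ℂ) a * z).re) :=
    (Complex.continuous_re.tendsto _).comp
      (((Complex.continuous_conj.tendsto _).comp hψa).mul (hlim.comp hψ.tendsto_atTop))
  exact le_of_tendsto_of_tendsto' hc1 hc2 fun k => hsup _ w hw

/-! ### Extremal vectors -/

/-- The Hermitian part of `A` in the direction `u`. -/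
noncomputable def directionalPart (u : ℂ) (A : Matrix (Fin n) (Fin n) ℂ) :
    Matrix (Fin n) (Fin n) ℂ :=
  (1 / 2 : ℂ) • ((starRingEnd ℂ) u • A + u • Aᴴ)

theorem isHermitian_directionalPart (u : ℂ) (A : Matrix (Fin n) (Fin n) ℂ) :
    (directionalPart u A).IsHermitian := by
  ext i j
  simp [directionalPart]
  ring

theorem directionalPart_eq (u : ℂ) (A : Matrix (Fin n) (Fin n) ℂ) :
    directionalPart u A = (u.re : ℂ) • rePart A + (u.im : ℂ) • imPart A := by
  ext i j
  simp only [directionalPart, rePart, imPart, Matrix.smul_apply, Matrix.add_apply,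
    Matrix.sub_apply, smul_eq_mul]
  conv_lhs => rw [← Complex.re_add_im u]
  simp only [map_add, map_mul, Complex.conj_ofReal, Complex.conj_I]
  field_simp
  linear_combination ((u.im : ℂ) * (Aᴴ i j - A i j)) * Complex.I_sq

theorem star_dotProduct_directionalPart (u : ℂ) (A : Matrix (Fin n) (Fin n) ℂ) (x : Fin n → ℂ) :
    star x ⬝ᵥ directionalPart u A *ᵥ x
      = (((starRingEnd ℂ) u * (star x ⬝ᵥ A *ᵥ x)).re : ℂ) := by
  have h1 : star x ⬝ᵥ Aᴴ *ᵥ x = (starRingEnd ℂ) (star x ⬝ᵥ A *ᵥ x) := by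
    rw [starRingEnd_apply, ← Matrix.star_dotProduct, Matrix.star_mulVec, Matrix.dotProduct_mulVec]
  rw [Complex.re_eq_add_conj, map_mul, Complex.conj_conj, ← h1, directionalPart,
    Matrix.smul_mulVec, Matrix.add_mulVec, Matrix.smul_mulVec, Matrix.smul_mulVec]
  simp only [dotProduct_smul, dotProduct_add, smul_eq_mul]
  ring

/-- The quadratic form `Re (conj u ⟨A x, x⟩)`. -/
noncomputable def directionalForm (u : ℂ) (A : Matrix (Fin n) (Fin n) ℂ)
    (x : EuclideanSpace ℂ (Fin n)) : ℝ :=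
  ((starRingEnd ℂ) u * quadForm A x).re

theorem star_dotProduct_self (x : EuclideanSpace ℂ (Fin n)) :
    star x.ofLp ⬝ᵥ x.ofLp = (‖x‖ ^ 2 : ℝ) := by
  rw [dotProduct_comm, ← EuclideanSpace.inner_eq_star_dotProduct, inner_self_eq_norm_sq_to_K]
  push_cast
  rfl

theorem inner_eq_star_dotProduct' (x y : EuclideanSpace ℂ (Fin n)) :
    inner ℂ x y = star x.ofLp ⬝ᵥ y.ofLp := by
  rw [dotProduct_comm, EuclideanSpace.inner_eq_star_dotProduct]

theorem star_dotProduct_directionalPart_eq (u : ℂ) (A : Matrix (Fin n) (Fin n) ℂ)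
    (x : EuclideanSpace ℂ (Fin n)) :
    star x.ofLp ⬝ᵥ directionalPart u A *ᵥ x.ofLp = (directionalForm u A x : ℂ) := by
  rw [star_dotProduct_directionalPart, directionalForm, quadForm_eq]

theorem directionalForm_smul (u c : ℂ) (A : Matrix (Fin n) (Fin n) ℂ)
    (x : EuclideanSpace ℂ (Fin n)) :
    directionalForm u A (c • x) = ‖c‖ ^ 2 * directionalForm u A x := by
  rw [directionalForm, quadForm_smul, mul_left_comm, Complex.re_ofReal_mul, directionalForm]

theorem continuous_directionalForm (u : ℂ) (A : Matrix (Fin n) (Fin n) ℂ) :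
    Continuous (directionalForm u A) :=
  Complex.continuous_re.comp (continuous_const.mul (continuous_quadForm A))

theorem directionalForm_neg (u : ℂ) (A : Matrix (Fin n) (Fin n) ℂ)
    (x : EuclideanSpace ℂ (Fin n)) : directionalForm (-u) A x = -directionalForm u A x := by
  simp [directionalForm]

theorem directionalForm_add (u w : ℂ) (A : Matrix (Fin n) (Fin n) ℂ)
    (x : EuclideanSpace ℂ (Fin n)) :
    directionalForm (u + w) A x = directionalForm u A x + directionalForm w A x := by
  simp [directionalForm, add_mul]

theorem directionalForm_ofReal_mul (r : ℝ) (u : ℂ) (A : Matrix (Fin n) (Fin n) ℂ)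
    (x : EuclideanSpace ℂ (Fin n)) :
    directionalForm (r * u) A x = r * directionalForm u A x := by
  rw [directionalForm, map_mul, Complex.conj_ofReal, mul_assoc, Complex.re_ofReal_mul,
    directionalForm]

theorem directionalPart_add (u w : ℂ) (A : Matrix (Fin n) (Fin n) ℂ) :
    directionalPart (u + w) A = directionalPart u A + directionalPart w A := by
  simp only [directionalPart, map_add]
  module

theorem directionalPart_ofReal_mul (r : ℝ) (u : ℂ) (A : Matrix (Fin n) (Fin n) ℂ) :
    directionalPart (r * u) A = (r : ℂ) • directionalPart u A := by
  simp only [directionalPart, map_mul, Complex.conj_ofReal]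
  module

theorem directionalPart_neg (u : ℂ) (A : Matrix (Fin n) (Fin n) ℂ) :
    directionalPart (-u) A = -directionalPart u A := by
  simp only [directionalPart, map_neg]
  module

theorem norm_inv_smul {x : EuclideanSpace ℂ (Fin n)} (hx : x ≠ 0) : ‖(‖x‖⁻¹ : ℂ) • x‖ = 1 := by
  rw [norm_smul, norm_inv, Complex.norm_real, norm_norm,
    inv_mul_cancel₀ (norm_ne_zero_iff.mpr hx)]

theorem directionalForm_le {u : ℂ} {A : Matrix (Fin n) (Fin n) ℂ} {C : ℝ}
    {x : EuclideanSpace ℂ (Fin n)}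
    (h : x ≠ 0 → directionalForm u A ((‖x‖⁻¹ : ℂ) • x) ≤ C) :
    directionalForm u A x ≤ C * ‖x‖ ^ 2 := by
  by_cases hx : x = 0
  · simp [hx, directionalForm, quadForm]
  · have h1 := h hx
    have hn : 0 < ‖x‖ := norm_pos_iff.mpr hx
    rw [directionalForm_smul, norm_inv, Complex.norm_real, norm_norm, inv_pow,
      inv_mul_le_iff₀ (by positivity)] at h1
    linarith

/-- `v` is a unit vector with `⟨A v, v⟩` extremal in the direction `u`. -/
def IsExtremal (A : Matrix (Fin n) (Fin n) ℂ) (u : ℂ) (v : EuclideanSpace ℂ (Fin n)) : Prop :=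
  ‖v‖ = 1 ∧ ∀ w, ‖w‖ = 1 → directionalForm u A w ≤ directionalForm u A v

variable {A : Matrix (Fin n) (Fin n) ℂ} {u : ℂ} {v w : EuclideanSpace ℂ (Fin n)}

theorem IsExtremal.exists_of_norm_eq_one (A : Matrix (Fin n) (Fin n) ℂ) (u : ℂ) (hw : ‖w‖ = 1) :
    ∃ v, IsExtremal A u v := by
  obtain ⟨v, hv, hmax⟩ := (isCompact_sphere (0 : EuclideanSpace ℂ (Fin n)) 1).exists_isMaxOn
    ⟨w, by simpa using hw⟩ (continuous_directionalForm u A).continuousOn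
  exact ⟨v, by simpa using hv, fun x hx => hmax (by simpa using hx)⟩

namespace IsExtremal

theorem le (h : IsExtremal A u v) (x : EuclideanSpace ℂ (Fin n)) :
    directionalForm u A x ≤ directionalForm u A v * ‖x‖ ^ 2 :=
  directionalForm_le fun hx => h.2 _ (norm_inv_smul hx)

theorem of_eq (h : IsExtremal A u v) (hw : ‖w‖ = 1)
    (he : directionalForm u A w = directionalForm u A v) : IsExtremal A u w :=
  ⟨hw, fun x hx => he ▸ h.2 x hx⟩

open scoped ComplexOrder in
theorem posSemidef (h : IsExtremal A u v) :
    (-(directionalPart u A - (directionalForm u A v : ℂ) • 1)).PosSemidef := by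
  refine Matrix.PosSemidef.of_dotProduct_mulVec_nonneg ?_ fun x => ?_
  · refine ((isHermitian_directionalPart u A).sub ?_).neg
    ext i j
    by_cases hij : i = j
    · subst hij; simp
    · simp [hij, Ne.symm hij]
  · have h1 := star_dotProduct_directionalPart_eq u A (WithLp.toLp 2 x)
    have h2 := star_dotProduct_self (WithLp.toLp 2 x)
    simp only at h1 h2
    rw [neg_sub, Matrix.sub_mulVec, Matrix.smul_mulVec, Matrix.one_mulVec, dotProduct_sub,
      dotProduct_smul, h1, h2, smul_eq_mul, ← Complex.ofReal_mul, ← Complex.ofReal_sub,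
      Complex.zero_le_real]
    exact sub_nonneg.mpr (h.le _)

open scoped ComplexOrder in
theorem mulVec_sub_eq_zero (h : IsExtremal A u v) (hw : ‖w‖ = 1)
    (he : directionalForm u A w = directionalForm u A v) :
    (directionalPart u A - (directionalForm u A v : ℂ) • 1) *ᵥ w.ofLp = 0 := by
  have h1 := (h.posSemidef.dotProduct_mulVec_zero_iff w.ofLp).mp (by
    rw [neg_sub, Matrix.sub_mulVec, Matrix.smul_mulVec, Matrix.one_mulVec, dotProduct_sub,
      dotProduct_smul, star_dotProduct_directionalPart_eq, star_dotProduct_self, hw, he]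
    simp)
  rwa [Matrix.neg_mulVec, neg_eq_zero] at h1

theorem mulVec_eq (h : IsExtremal A u v) :
    directionalPart u A *ᵥ v.ofLp = (directionalForm u A v : ℂ) • v.ofLp := by
  have h1 := h.mulVec_sub_eq_zero h.1 rfl
  rwa [Matrix.sub_mulVec, Matrix.smul_mulVec, Matrix.one_mulVec, sub_eq_zero] at h1

/-- Otherwise the value could be pushed a little in the direction u inside W(A), against maximality.
-/
theorem mem_frontier (h : IsExtremal A u v) (hu : u ≠ 0) :
    quadForm A v ∈ frontier (numericalRange A) := by
  refine ⟨subset_closure ⟨v, h.1, rfl⟩, fun hint => ?_⟩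
  have h1 : ∀ᶠ s : ℝ in 𝓝[>] (0 : ℝ), quadForm A v + (s : ℂ) * u ∈ numericalRange A := by
    have hc : Tendsto (fun s : ℝ => quadForm A v + s * u) (𝓝 0) (𝓝 (quadForm A v)) := by
      have : Continuous fun s : ℝ => quadForm A v + s * u := by fun_prop
      simpa using this.tendsto 0
    exact (hc.eventually (mem_interior_iff_mem_nhds.mp hint)).filter_mono nhdsWithin_le_nhds
  obtain ⟨s, ⟨x, hx, hxs⟩, hs⟩ := (h1.and self_mem_nhdsWithin).exists
  have hs : 0 < s := hs
  have h2 := h.2 x hx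
  rw [directionalForm, directionalForm, hxs, mul_add, Complex.add_re, mul_left_comm,
    Complex.conj_mul', Complex.re_ofReal_mul] at h2
  have h3 : 0 < s * ‖u‖ ^ 2 := mul_pos hs (pow_pos (norm_pos_iff.mpr hu) 2)
  rw [← Complex.ofReal_pow, Complex.ofReal_re] at h2
  linarith

end IsExtremal

/-! ### Matrices with Gau--Wu number two -/

theorem bddAbove_gauWu (A : Matrix (Fin n) (Fin n) ℂ) :
    BddAbove {k | ∃ x : Fin k → EuclideanSpace ℂ (Fin n),
      Orthonormal ℂ x ∧ ∀ j, quadForm A (x j) ∈ frontier (numericalRange A)} := by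
  refine ⟨n, ?_⟩
  rintro k ⟨x, hx, -⟩
  simpa using hx.linearIndependent.fintype_card_le_finrank

theorem le_gauWuNumber {k : ℕ} {x : Fin k → EuclideanSpace ℂ (Fin n)} (hx : Orthonormal ℂ x)
    (h : ∀ j, quadForm A (x j) ∈ frontier (numericalRange A)) : k ≤ gauWuNumber A :=
  le_csSup (bddAbove_gauWu A) ⟨x, hx, h⟩

theorem gauWuNumber_le (A : Matrix (Fin n) (Fin n) ℂ) : gauWuNumber A ≤ n := by
  refine csSup_le' ?_
  rintro k ⟨x, hx, -⟩
  simpa using hx.linearIndependent.fintype_card_le_finrank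

theorem isStarNormal_of_directionalPart_eq {c : ℂ} (hu : u ≠ 0)
    (h : directionalPart u A = c • 1) : IsStarNormal A := by
  have h1 : star A = u⁻¹ • ((2 * c) • (1 : Matrix (Fin n) (Fin n) ℂ) - (starRingEnd ℂ) u • A) := by
    have h2 : (2 * c) • (1 : Matrix (Fin n) (Fin n) ℂ) = (starRingEnd ℂ) u • A + u • Aᴴ := by
      rw [mul_smul, ← h, directionalPart, smul_smul]
      norm_num
    rw [h2, add_sub_cancel_left, smul_smul, inv_mul_cancel₀ hu, one_smul]
    rfl
  refine ⟨?_⟩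
  rw [h1]
  exact (((Commute.one_left A).smul_left _).sub_left ((Commute.refl A).smul_left _)).smul_left _

open scoped ComplexOrder in
-- Let y minimize the form in the direction u. If minimum and maximum differ, y is an eigenvector
-- for another eigenvalue, so v, w, y would be orthonormal with values on the boundary. If they
-- agree, the directional part is scalar, any orthonormal basis has its values on the boundary, and
-- A is a normal matrix of size 2.
theorem IsExtremal.inner_ne_zero (hA : ¬ (n = 2 ∧ IsStarNormal A)) (hk : gauWuNumber A = 2)
    (hu : u ≠ 0) (hv : IsExtremal A u v) (hw : IsExtremal A u w) : inner ℂ v w ≠ 0 := by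
  intro hvw
  obtain ⟨y, hy⟩ := IsExtremal.exists_of_norm_eq_one A (-u) hv.1
  have hle : directionalForm u A y ≤ directionalForm u A v := hv.2 y hy.1
  have hmin : ∀ x, ‖x‖ = 1 → directionalForm u A y ≤ directionalForm u A x := by
    intro x hx
    have := hy.2 x hx
    rw [directionalForm_neg, directionalForm_neg] at this
    linarith
  have hwv : directionalForm u A w = directionalForm u A v :=
    le_antisymm (hv.2 w hw.1) (hw.2 v hv.1)
  rcases hle.eq_or_lt with heq | hlt
  · have hconst : ∀ x, ‖x‖ = 1 → directionalForm u A x = directionalForm u A v := fun x hx =>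
      le_antisymm (hv.2 x hx) (heq ▸ hmin x hx)
    have hn : n ≤ 2 := by
      rw [← hk]
      exact le_gauWuNumber (EuclideanSpace.basisFun (Fin n) ℂ).orthonormal fun j =>
        (hv.of_eq ((EuclideanSpace.basisFun (Fin n) ℂ).orthonormal.1 j)
          (hconst _ ((EuclideanSpace.basisFun (Fin n) ℂ).orthonormal.1 j))).mem_frontier hu
    have hn' : 2 ≤ n := hk ▸ gauWuNumber_le A
    refine hA ⟨le_antisymm hn hn', isStarNormal_of_directionalPart_eq
      (c := directionalForm u A v) hu (sub_eq_zero.mp ?_)⟩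
    ext i j
    have h1 := congrFun (hv.mulVec_sub_eq_zero (w := EuclideanSpace.single j 1) (by simp)
      (hconst _ (by simp))) i
    simpa using h1
  · have hyv := hy.mulVec_eq
    rw [directionalPart_neg, directionalForm_neg, Matrix.neg_mulVec, Complex.ofReal_neg, neg_smul,
      neg_inj] at hyv
    have horth : ∀ x, IsExtremal A u x → inner ℂ x y = 0 := by
      intro x hx
      have h1 := dotProduct_mulVec_comm_of_isHermitian (isHermitian_directionalPart u A)
        x.ofLp y.ofLp
      rw [hyv, hx.mulVec_eq, dotProduct_smul, star_smul, smul_dotProduct,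
        ← inner_eq_star_dotProduct', smul_eq_mul, smul_eq_mul, Complex.star_def,
        Complex.conj_ofReal] at h1
      have h2 : ((directionalForm u A y - directionalForm u A x : ℝ) : ℂ) * inner ℂ x y = 0 := by
        push_cast
        linear_combination h1
      refine (mul_eq_zero.mp h2).resolve_left (Complex.ofReal_ne_zero.mpr ?_)
      have := hx.2 v hv.1
      linarith
    have hon : Orthonormal ℂ ![v, w, y] := by
      rw [orthonormal_vecCons_iff, orthonormal_vecCons_iff, orthonormal_vecCons_iff]
      refine ⟨hv.1, ?_, hw.1, ?_, hy.1, ?_, ?_⟩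
      · intro i
        fin_cases i
        · exact hvw
        · exact horth v hv
      · intro i
        fin_cases i
        exact horth w hw
      · exact fun i => i.elim0
      · exact ⟨fun i => i.elim0, fun i => i.elim0⟩
    have h3 := le_gauWuNumber (A := A) hon (by
      intro j
      fin_cases j
      · exact hv.mem_frontier hu
      · exact hw.mem_frontier hu
      · exact hy.mem_frontier (neg_ne_zero.mpr hu))
    omega

theorem IsExtremal.ker (hA : ¬ (n = 2 ∧ IsStarNormal A)) (hk : gauWuNumber A = 2)
    (hu : u ≠ 0) (hv : IsExtremal A u v) {x : Fin n → ℂ}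
    (hx : (directionalPart u A - (directionalForm u A v : ℂ) • 1) *ᵥ x = 0) :
    ∃ ζ : ℂ, x = ζ • v.ofLp := by
  let y : EuclideanSpace ℂ (Fin n) := WithLp.toLp 2 x - (inner ℂ v (WithLp.toLp 2 x)) • v
  have hvy : inner ℂ v y = 0 := by
    simp only [y]
    rw [inner_sub_right, inner_smul_right, inner_self_eq_norm_sq_to_K, hv.1]
    simp
  have hyx : y.ofLp = x - (inner ℂ v (WithLp.toLp 2 x)) • v.ofLp := rfl
  have hMy : directionalPart u A *ᵥ y.ofLp = (directionalForm u A v : ℂ) • y.ofLp := by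
    rw [Matrix.sub_mulVec, Matrix.smul_mulVec, Matrix.one_mulVec, sub_eq_zero] at hx
    rw [hyx, Matrix.mulVec_sub, Matrix.mulVec_smul, hx, hv.mulVec_eq]
    module
  by_cases hy : y = 0
  · refine ⟨inner ℂ v (WithLp.toLp 2 x), ?_⟩
    rw [← sub_eq_zero, ← hyx, hy]
    rfl
  · exfalso
    have h1 := norm_inv_smul hy
    refine IsExtremal.inner_ne_zero hA hk hu hv (hv.of_eq h1 ?_) (by
      rw [inner_smul_right, hvy, mul_zero])
    have h2 := star_dotProduct_directionalPart_eq u A y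
    rw [hMy, dotProduct_smul, star_dotProduct_self, smul_eq_mul, ← Complex.ofReal_mul,
      Complex.ofReal_inj] at h2
    rw [directionalForm_smul, ← h2, norm_inv, Complex.norm_real, norm_norm]
    field_simp [norm_ne_zero_iff.mpr hy]

/-- Points of the boundary on one support line come from unit vectors of the same one-dimensional
eigenspace, which differ by a phase and have equal values. -/
theorem not_isFlatPortion (hA : ¬ (n = 2 ∧ IsStarNormal A)) (hk : gauWuNumber A = 2)
    (S : Set ℂ) : ¬ IsFlatPortion A S := by
  rintro ⟨_, ⟨u, c, hu, rfl, hle, -⟩, rfl, z, ⟨hz, hzc⟩, z', ⟨hz', hzc'⟩, hne⟩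
  have hsub : frontier (numericalRange A) ⊆ numericalRange A :=
    (isCompact_numericalRange A).isClosed.frontier_subset
  obtain ⟨x, hx, rfl⟩ := hsub hz
  obtain ⟨x', hx', rfl⟩ := hsub hz'
  have hE : IsExtremal A u x := ⟨hx, fun w hw => (hle _ ⟨w, hw, rfl⟩).trans_eq hzc.symm⟩
  obtain ⟨ζ, hζ⟩ := hE.ker hA hk hu (hE.mulVec_sub_eq_zero hx' (hzc'.trans hzc.symm))
  have hζ' : x' = ζ • x := by
    ext i; exact congrFun hζ i
  have h1 : ‖ζ‖ = 1 := by
    rwa [hζ', norm_smul, hx, mul_one] at hx'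
  refine hne ?_
  rw [hζ', quadForm_smul, h1]
  simp

/-- An extremal vector is not a reducing eigenvector. -/
theorem IsExtremal.mulVec_ne (hA : ¬ (n = 2 ∧ IsStarNormal A)) (hk : gauWuNumber A = 2)
    (hu : u ≠ 0) (hv : IsExtremal A u v) :
    directionalPart (Complex.I * u) A *ᵥ v.ofLp
      ≠ (directionalForm (Complex.I * u) A v : ℂ) • v.ofLp := by
  intro hred
  set c := directionalForm u A v with hc
  set κ := directionalForm (Complex.I * u) A v with hκ
  let K : Set (EuclideanSpace ℂ (Fin n)) := Metric.sphere 0 1 ∩ {y | inner ℂ v y = 0}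
  have hKc : IsCompact K := (isCompact_sphere 0 1).inter_right
    (isClosed_eq (continuous_const.inner continuous_id) continuous_const)
  have hKmem : ∀ y, y ≠ 0 → inner ℂ v y = 0 → ((‖y‖⁻¹ : ℂ) • y) ∈ K := by
    intro y hy hvy
    refine ⟨by simpa using norm_inv_smul hy, ?_⟩
    change inner ℂ v _ = 0
    rw [inner_smul_right, hvy, mul_zero]
  have hKne : K.Nonempty := by
    have h1 : (Submodule.span ℂ {v})ᗮ ≠ ⊥ := by
      rw [Ne, Submodule.orthogonal_eq_bot_iff]
      intro h2
      have h3 : Module.finrank ℂ (Submodule.span ℂ {v}) = 1 :=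
        finrank_span_singleton fun h0 => by simpa [h0] using hv.1
      rw [h2, finrank_top, finrank_euclideanSpace_fin] at h3
      have := hk ▸ gauWuNumber_le A
      omega
    obtain ⟨y, hy, hy0⟩ := Submodule.exists_mem_ne_zero_of_ne_bot h1
    exact ⟨_, hKmem y hy0 (Submodule.mem_orthogonal_singleton_iff_inner_right.mp hy)⟩
  have hpos : ∀ y ∈ K, 0 < c - directionalForm u A y := by
    rintro y ⟨hy, hvy⟩
    have hy1 : ‖y‖ = 1 := by simpa using hy
    refine sub_pos.mpr (lt_of_le_of_ne (hv.2 y hy1) fun he => ?_)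
    exact IsExtremal.inner_ne_zero hA hk hu hv (hv.of_eq hy1 he) hvy
  -- The maximum ρ is the threshold at which, in the direction iu + ρu, the largest value on the
  -- complement of v equals the value at v. There v and y₀ are both extremal and orthogonal.
  obtain ⟨y₀, hy₀, hmax⟩ := hKc.exists_isMaxOn hKne (f := fun y =>
      (directionalForm (Complex.I * u) A y - κ) / (c - directionalForm u A y))
    (((continuous_directionalForm _ A).sub continuous_const).continuousOn.div
      (continuous_const.sub (continuous_directionalForm u A)).continuousOn
      fun y hy => (hpos y hy).ne')
  set ρ := (directionalForm (Complex.I * u) A y₀ - κ) / (c - directionalForm u A y₀) with hρ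
  let w : ℂ := Complex.I * u + ρ * u
  have hw0 : w ≠ 0 := by
    simp only [w]
    rw [← add_mul]
    refine mul_ne_zero (fun h => ?_) hu
    simpa using congrArg Complex.im h
  have hform : ∀ x, directionalForm w A x
      = directionalForm (Complex.I * u) A x + ρ * directionalForm u A x := fun x => by
    simp only [w]
    rw [directionalForm_add, directionalForm_ofReal_mul]
  let C := κ + ρ * c
  have hwv : directionalForm w A v = C := hform v
  have hK : ∀ y ∈ K, directionalForm w A y ≤ C := by
    intro y hy
    have h1 : _ ≤ ρ := hmax hy
    simp only at h1
    rw [div_le_iff₀ (hpos y hy)] at h1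
    rw [hform]
    simp only [C]
    linarith
  have hy₀C : directionalForm w A y₀ = C := by
    have h1 := div_mul_cancel₀ (directionalForm (Complex.I * u) A y₀ - κ) (hpos y₀ hy₀).ne'
    rw [← hρ] at h1
    rw [hform]
    simp only [C]
    linarith
  have hwvec : directionalPart w A *ᵥ v.ofLp = (C : ℂ) • v.ofLp := by
    simp only [w, C]
    rw [directionalPart_add, directionalPart_ofReal_mul, Matrix.add_mulVec, Matrix.smul_mulVec,
      hred, hv.mulVec_eq]
    push_cast
    module
  have hwext : IsExtremal A w v := by
    refine ⟨hv.1, fun x hx => ?_⟩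
    rw [hwv]
    -- Since v is an eigenvector in this direction, the shifted form of x depends only on its
    -- component orthogonal to v.
    let a : ℂ := inner ℂ v x
    let y := x - a • v
    have hvy : inner ℂ v y = 0 := by
      simp only [y, a]
      rw [inner_sub_right, inner_smul_right, inner_self_eq_norm_sq_to_K, hv.1]
      simp
    have hyC : directionalForm w A y ≤ C * ‖y‖ ^ 2 :=
      directionalForm_le fun hy => hK _ (hKmem y hy hvy)
    have hxy : x.ofLp = a • v.ofLp + y.ofLp := by
      simp [y]
    let N := directionalPart w A - (C : ℂ) • (1 : Matrix (Fin n) (Fin n) ℂ)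
    have hN : N.IsHermitian := by
      refine (isHermitian_directionalPart w A).sub ?_
      ext i j
      by_cases hij : i = j
      · subst hij; simp
      · simp [hij, Ne.symm hij]
    have hNv : N *ᵥ v.ofLp = 0 := by
      simp only [N]
      rw [Matrix.sub_mulVec, Matrix.smul_mulVec, Matrix.one_mulVec, hwvec, sub_self]
    have hNx : N *ᵥ x.ofLp = N *ᵥ y.ofLp := by
      rw [hxy, Matrix.mulVec_add, Matrix.mulVec_smul, hNv, smul_zero, zero_add]
    have hform' : ∀ x : EuclideanSpace ℂ (Fin n), star x.ofLp ⬝ᵥ N *ᵥ x.ofLp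
        = ((directionalForm w A x - C * ‖x‖ ^ 2 : ℝ) : ℂ) := by
      intro x
      simp only [N]
      rw [Matrix.sub_mulVec, Matrix.smul_mulVec, Matrix.one_mulVec, dotProduct_sub,
        dotProduct_smul, star_dotProduct_directionalPart_eq, star_dotProduct_self, smul_eq_mul]
      push_cast
      ring
    have h1 : star x.ofLp ⬝ᵥ N *ᵥ x.ofLp = star y.ofLp ⬝ᵥ N *ᵥ y.ofLp := by
      rw [hNx, dotProduct_mulVec_comm_of_isHermitian hN, hNx,
        ← dotProduct_mulVec_comm_of_isHermitian hN]
    rw [hform', hform', Complex.ofReal_inj, hx] at h1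
    linarith
  have hy₀1 : ‖y₀‖ = 1 := by simpa using hy₀.1
  exact IsExtremal.inner_ne_zero hA hk hw0 hwext (hwext.of_eq hy₀1 (hy₀C.trans hwv.symm)) hy₀.2

/-! ### Coordinates adapted to a boundary point -/

theorem eval_basePolynomial (A : Matrix (Fin n) (Fin n) ℂ) (p : Fin 3 → ℂ) :
    MvPolynomial.eval p (basePolynomial A)
      = (p 0 • rePart A + p 1 • imPart A + p 2 • (1 : Matrix (Fin n) (Fin n) ℂ)).det := by
  rw [basePolynomial, RingHom.map_det]
  congr 1
  ext i j
  by_cases hij : i = j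
  · subst hij; simp
  · simp [hij]

/-- Adding a real multiple of M₀ to M₁ affects none of the conditions, because M₀v = 0; the freedom
in r serves to make M₁ invertible. -/
theorem IsExtremal.isSimplePencil (hA : ¬ (n = 2 ∧ IsStarNormal A)) (hk : gauWuNumber A = 2)
    (hu : u ≠ 0) (hv : IsExtremal A u v) (r : ℝ) :
    IsSimplePencil (directionalPart u A - (directionalForm u A v : ℂ) • 1)
      (directionalPart (Complex.I * u) A - (directionalForm (Complex.I * u) A v : ℂ) • 1
        + (r : ℂ) • (directionalPart u A - (directionalForm u A v : ℂ) • 1)) v.ofLp where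
  posSemidef := hv.posSemidef
  isHermitian := by
    have h1 : ∀ s : ℝ, ((s : ℂ) • (1 : Matrix (Fin n) (Fin n) ℂ)).IsHermitian := by
      intro s
      ext i j
      by_cases hij : i = j
      · subst hij; simp
      · simp [hij, Ne.symm hij]
    have h2 : ∀ (s : ℝ) (M : Matrix (Fin n) (Fin n) ℂ), M.IsHermitian →
        ((s : ℂ) • M).IsHermitian := by
      intro s M hM
      rw [Matrix.IsHermitian, Matrix.conjTranspose_smul, hM.eq, Complex.star_def,
        Complex.conj_ofReal]
    exact ((isHermitian_directionalPart _ A).sub (h1 _)).add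
      (h2 r _ ((isHermitian_directionalPart _ A).sub (h1 _)))
  ne_zero := fun h => by
    have : v = 0 := by ext i; exact congrFun h i
    have h1 := hv.1
    rw [this, norm_zero] at h1
    exact zero_ne_one h1
  mulVec_eq_zero := hv.mulVec_sub_eq_zero hv.1 rfl
  ker := fun _ hx => hv.ker hA hk hu hx
  isotropic := by
    rw [Matrix.add_mulVec, Matrix.smul_mulVec, hv.mulVec_sub_eq_zero hv.1 rfl, smul_zero, add_zero,
      Matrix.sub_mulVec, Matrix.smul_mulVec, Matrix.one_mulVec, dotProduct_sub, dotProduct_smul,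
      star_dotProduct_directionalPart_eq, star_dotProduct_self, hv.1]
    simp
  mulVec_ne_zero := by
    rw [Matrix.add_mulVec, Matrix.smul_mulVec, hv.mulVec_sub_eq_zero hv.1 rfl, smul_zero, add_zero,
      Matrix.sub_mulVec, Matrix.smul_mulVec, Matrix.one_mulVec, sub_ne_zero]
    exact hv.mulVec_ne hA hk hu

/-- By the block formula det(M₀ + yM₁) = −y²β(1, y, 0), which is nonzero for small real y ≠ 0; take
r = 1/y. -/
theorem IsExtremal.exists_det_ne_zero (hA : ¬ (n = 2 ∧ IsStarNormal A)) (hk : gauWuNumber A = 2)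
    (hu : u ≠ 0) (hv : IsExtremal A u v) : ∃ r : ℝ,
      (directionalPart (Complex.I * u) A - (directionalForm (Complex.I * u) A v : ℂ) • 1
        + (r : ℂ) • (directionalPart u A - (directionalForm u A v : ℂ) • 1)).det ≠ 0 := by
  have h := hv.isSimplePencil hA hk hu 0
  rw [Complex.ofReal_zero, zero_smul, add_zero] at h
  obtain ⟨α, β, hαβ, -, hβ⟩ := exists_block_formula h.posSemidef h.isHermitian h.ne_zero
    h.mulVec_eq_zero h.ker h.isotropic h.mulVec_ne_zero
  have hcont : Continuous fun y : ℝ => MvPolynomial.eval ![1, (y : ℂ), 0] β := by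
    refine (MvPolynomial.continuous_eval β).comp (continuous_pi fun i => ?_)
    fin_cases i
    · exact continuous_const
    · exact Complex.continuous_ofReal
    · exact continuous_const
  have h1 : ∀ᶠ y : ℝ in 𝓝[≠] (0 : ℝ), MvPolynomial.eval ![1, (y : ℂ), 0] β ≠ 0 :=
    (hcont.continuousAt.eventually_ne (by simpa using hβ)).filter_mono nhdsWithin_le_nhds
  obtain ⟨y, hy, hy0⟩ := (h1.and self_mem_nhdsWithin).exists
  have hy0 : (y : ℂ) ≠ 0 := Complex.ofReal_ne_zero.mpr hy0
  refine ⟨y⁻¹, fun hdet => ?_⟩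
  have h2 := hαβ ![1, (y : ℂ), 0]
  simp only [Matrix.cons_val_zero, Matrix.cons_val_one, Matrix.cons_val, zero_mul, zero_sub,
    one_smul, zero_smul, add_zero] at h2
  rw [← det_smul_eq_zero_iff hy0, smul_add, smul_smul, Complex.ofReal_inv, mul_inv_cancel₀ hy0,
    one_smul, add_comm, h2, neg_eq_zero, mul_eq_zero] at hdet
  exact hdet.elim (pow_ne_zero 2 hy0) hy

theorem not_isSingularPoint_affinePoint (hA : ¬ (n = 2 ∧ IsStarNormal A))
    (hk : gauWuNumber A = 2) {z : ℂ} (hz : z ∈ frontier (numericalRange A)) :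
    ¬ IsSingularPoint (boundaryGeneratingCurve A) (affinePoint z) := by
  obtain ⟨u, hu, hsup⟩ := exists_support (convex_numericalRange A)
    (isCompact_numericalRange A).isClosed hz
  obtain ⟨v, hv1, hvz⟩ := (isCompact_numericalRange A).isClosed.frontier_subset hz
  have hv : IsExtremal A u v := by
    refine ⟨hv1, fun w hw => ?_⟩
    rw [directionalForm, directionalForm, hvz]
    exact hsup _ ⟨w, hw, rfl⟩
  obtain ⟨r, hdet⟩ := hv.exists_det_ne_zero hA hk hu
  have hp := hv.isSimplePencil hA hk hu r
  set c := directionalForm u A v with hc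
  set κ := directionalForm (Complex.I * u) A v with hκ
  have hcz : c = u.re * z.re + u.im * z.im := by
    rw [hc, directionalForm, hvz]
    simp
  have hκz : κ = u.re * z.im - u.im * z.re := by
    rw [hκ, directionalForm, hvz]
    simp
  -- The columns are the coefficients of M₀, M₁ and I with respect to H₁, H₂ and I. The first two,
  -- as points of the plane, lie on the line dual to z, and the determinant is |u|².
  let Γ : Matrix (Fin 3) (Fin 3) ℂ :=
    !![(u.re : ℂ), -u.im + r * u.re, 0; (u.im : ℂ), u.re + r * u.im, 0; -(c : ℂ), -κ - r * c, 1]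
  have hΓ : Γ.det ≠ 0 := by
    have h1 : Γ.det = ((u.re ^ 2 + u.im ^ 2 : ℝ) : ℂ) := by
      simp [Γ, Matrix.det_fin_three]
      ring
    rw [h1, Complex.ofReal_ne_zero]
    intro h2
    refine hu (Complex.ext ?_ ?_)
    · simp only [Complex.zero_re]; nlinarith [sq_nonneg u.re, sq_nonneg u.im]
    · simp only [Complex.zero_im]; nlinarith [sq_nonneg u.re, sq_nonneg u.im]
  let g : (Fin 3 → ℂ) ≃ₗ[ℂ] (Fin 3 → ℂ) :=
    LinearEquiv.ofInjectiveEndo Γ.mulVecLin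
      (Matrix.mulVec_injective_of_isUnit ((Matrix.isUnit_iff_isUnit_det Γ).mpr hΓ.isUnit))
  have hg : ∀ p, g p = Γ *ᵥ p := fun p => rfl
  refine hp.not_isSingularPoint (g := g) (F := basePolynomial A) (fun p => ?_) hdet ?_ ?_
  · rw [eval_basePolynomial, hg]
    congr 1
    rw [directionalPart_eq, directionalPart_eq]
    simp only [Γ, Matrix.mulVec, dotProduct, Fin.sum_univ_three, Matrix.of_apply,
      Matrix.cons_val_zero, Matrix.cons_val_one, Matrix.cons_val, Complex.mul_re, Complex.mul_im,
      Complex.I_re, Complex.I_im, zero_mul, one_mul, zero_sub, zero_add, Complex.ofReal_neg]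
    module
  · obtain ⟨a, -, ha⟩ := exists_rep_eq_smul (v := ![(z.re : ℂ), (z.im : ℂ), 1])
      (fun h => one_ne_zero (congrFun h 2))
    rw [affinePoint, ha, hg]
    simp [Γ, dotProduct, Fin.sum_univ_three, hcz]
    ring
  · obtain ⟨a, -, ha⟩ := exists_rep_eq_smul (v := ![(z.re : ℂ), (z.im : ℂ), 1])
      (fun h => one_ne_zero (congrFun h 2))
    rw [affinePoint, ha, hg]
    simp [Γ, dotProduct, Fin.sum_univ_three, hcz, hκz]
    ring

end GauWu

end

theorem proposition3p4 (n : ℕ) (A : Matrix (Fin n) (Fin n) ℂ)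
    (hA : ¬ (n = 2 ∧ IsStarNormal A)) (hk : GauWu.gauWuNumber A = 2) :
    (¬ ∃ S : Set ℂ, GauWu.IsSeed A S) ∧
    (¬ ∃ S : Set ℂ, GauWu.IsFlatPortion A S) ∧
    (∀ z ∈ frontier (GauWu.numericalRange A),
      ¬ GauWu.IsSingularPoint (GauWu.boundaryGeneratingCurve A) (GauWu.affinePoint z)) := by
  have h : ¬ ∃ S : Set ℂ, GauWu.IsFlatPortion A S := fun ⟨S, hS⟩ =>
    GauWu.not_isFlatPortion hA hk S hS
  have h' : ∀ z ∈ frontier (GauWu.numericalRange A),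
      ¬ GauWu.IsSingularPoint (GauWu.boundaryGeneratingCurve A) (GauWu.affinePoint z) :=
    fun _ hz => GauWu.not_isSingularPoint_affinePoint hA hk hz
  refine ⟨?_, h, h'⟩
  rintro ⟨S, hS | ⟨z, -, hz, hsing⟩⟩
  · exact h ⟨S, hS⟩
  · exact h' z hz hsing
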